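/- Let $p$ be an odd prime. Let $\mathcal W^0$ be the identity component of $p$-adic weight space over $\mathbf Q_p$, i.e. the rigid-analytic group of continuous characters $\psi$ of $\mathbf Z_p^\times$ that are trivial on $\mu_{p-1}$, and let $\gamma$ denote any topological generator of $1+p\mathbf Z_p$. For $n\ge 0$ let $\mathcal W^0_n\subset\mathcal W^0$ be the affinoid subgroup $|\psi(\gamma)-1|\le p^{-1/(p^{n-1}(p-1))}$. Both $\mathcal W^0_n$ and the analytic function $\vartheta(\psi)=\log_p(\psi(\gamma))/\log_p(\gamma)$ on $\mathcal W^0$ are independent of the choice of $\gamma$. For a rigid-analytic group $G$ and a subgroup $H$, a surjective map $q:G\to X$ of rigid spaces is called the quotient of $G$ by $H$ if the two compositions $H\times G\rightrightarrows G\to X$ (multiplication and projection) coincide, the resulting map $H\times G\to G\times_X G$ is an isomorphism, and the analytic functions on $X$ are, via $q$, exactly the $H$-invariant analytic functions on $G$. Then for every $n\ge0$ the quotient $\mathcal W^0_n\to X_n=\mathcal W^0_n/\mathcal W^0_n[p^n]$ exists as an affinoid over $\mathbf Q_p$. For any choice of these affinoid quotients there are unique maps $X_n\to X_{n+1}$ compatible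 with the inclusions $\mathcal W^0_n\subset\mathcal W^0_{n+1}$; they are injective and identify $X_n$ with an admissible affinoid open (indeed a rational subdomain) of $X_{n+1}$. Let $X_\infty$ be the rigid space obtained by gluing the $X_n$ along these maps. The maps $\mathcal W^0_n\to X_n$ glue to a unique map $\pi:\mathcal W^0\to X_\infty$, and $\pi$ is the quotient of $\mathcal W^0$ by $\mathcal W^0_{\mathrm{tors}}$. There is a unique analytic function $\Theta:X_\infty\to\mathbf A^1$ with $\Theta\circ\pi=\vartheta$; it is an isomorphism of rigid spaces $$\mathcal W^0/\mathcal W^0_{\mathrm{tors}}=X_\infty\stackrel{\sim}{\longrightarrow}\mathbf A^1_{\mathbf Q_p},$$ and it maps $X_n$ onto the closed disc $|s|\le p^{\,n-1/(p-1)}$. -/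

import Mathlib

open CategoryTheory Opposite

noncomputable section

namespace RigidWeight

/-! ### Affinoid algebras over `ℚ_p` -/

/-- The Tate algebra `ℚ_p⟨X₁, …, X_m⟩` of power series whose coefficients tend to `0`. -/
def tateAlgebra (p : ℕ) [Fact p.Prime] (m : ℕ) :
    Subalgebra ℚ_[p] (MvPowerSeries (Fin m) ℚ_[p]) where
  toSubsemiring := (MvPowerSeries.IsRestricted.subring (fun _ : Fin m => (1 : ℝ))).toSubsemiring
  algebraMap_mem' a := MvPowerSeries.isRestricted_C _ a

/-- An affinoid algebra over `ℚ_p`: a complete ultrametric commutative normed `ℚ_p`-algebra which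
is the target of a surjective homomorphism from a Tate algebra that is bounded for the Gauss norm.
(By the open mapping theorem the norm is then equivalent to the residue norm, so the norm is just
a choice of one of the equivalent Banach norms of the affinoid algebra.) -/
structure AffinoidAlgebra (p : ℕ) [Fact p.Prime] : Type 1 where
  carrier : Type
  [normedCommRing : NormedCommRing carrier]
  [normedAlgebra : NormedAlgebra ℚ_[p] carrier]
  [completeSpace : CompleteSpace carrier]
  [isUltrametricDist : IsUltrametricDist carrier]
  exists_presentation : ∃ (m : ℕ) (π : tateAlgebra p m →ₐ[ℚ_[p]] carrier),
    Function.Surjective π ∧ ∃ C : ℝ, ∀ (f : tateAlgebra p m) (M : ℝ),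
      (∀ i, ‖MvPowerSeries.coeff i (f : MvPowerSeries (Fin m) ℚ_[p])‖ ≤ M) → ‖π f‖ ≤ C * M

namespace AffinoidAlgebra

variable {p : ℕ} [Fact p.Prime]

instance : CoeSort (AffinoidAlgebra p) Type := ⟨AffinoidAlgebra.carrier⟩

attribute [instance] normedCommRing normedAlgebra completeSpace isUltrametricDist

/-- Morphisms of affinoid algebras are the continuous `ℚ_p`-algebra homomorphisms. -/
instance : Category (AffinoidAlgebra p) where
  Hom A B := A →A[ℚ_[p]] B
  id A := ContinuousAlgHom.id ℚ_[p] A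
  comp f g := ContinuousAlgHom.comp g f

instance : ConcreteCategory (AffinoidAlgebra p) (fun A B => A →A[ℚ_[p]] B) where
  hom f := f
  ofHom f := f

end AffinoidAlgebra

/-! ### Rigid spaces

A rigid space over `ℚ_p` is given by its functor of points on affinoid spaces, that is, by a
covariant functor on affinoid algebras; morphisms of rigid spaces are then the natural
transformations (rigid spaces embed fully faithfully in this way). -/

/-- Functors of points over `ℚ_p`. -/
abbrev Space (p : ℕ) [Fact p.Prime] := AffinoidAlgebra p ⥤ Type

/-- Group-valued functors of points: (commutative) rigid-analytic groups. -/
abbrev GroupSpace (p : ℕ) [Fact p.Prime] := AffinoidAlgebra p ⥤ CommGrpCat.{0}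

section

variable {p : ℕ} [Fact p.Prime]

/-- The space underlying a rigid-analytic group. -/
abbrev GroupSpace.toSpace (G : GroupSpace p) : Space p := G ⋙ forget CommGrpCat

/-- A homomorphism of rigid-analytic groups, as a morphism of spaces. -/
abbrev GroupSpace.mapSpace {G G' : GroupSpace p} (f : G ⟶ G') : G.toSpace ⟶ G'.toSpace :=
  Functor.whiskerRight f (forget CommGrpCat)

/-- The affinoid space `Sp A`, with `R`-points the homomorphisms `A ⟶ R`. -/
abbrev Sp (A : AffinoidAlgebra p) : Space p := coyoneda.obj (op A)

/-- The rigid-analytic affine line, with `R`-points the elements of `R`.  A morphism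
`X ⟶ affineLine p` is an analytic function on `X`. -/
abbrev affineLine (p : ℕ) [Fact p.Prime] : Space p := forget (AffinoidAlgebra p)

/-- Power-boundedness. -/
def IsPowerBounded {A : Type*} [NormedCommRing A] (a : A) : Prop :=
  ∃ C : ℝ, ∀ n : ℕ, ‖a ^ n‖ ≤ C

/-- The inequality `|a| ≤ r` at all points of `Sp A`.  By the maximum modulus principle a function
is everywhere of absolute value at most `1` if and only if it is power-bounded; so the inequality
says that `c * a ^ k` is power-bounded whenever `c` is a scalar with `|c| * r ^ k ≤ 1`. It is
used for `r` with a positive power in `|ℚ_p^×|`. -/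
def SupNormLE {A : Type*} [NormedCommRing A] [NormedAlgebra ℚ_[p] A] (a : A) (r : ℝ) : Prop :=
  ∀ (k : ℕ) (c : ℚ_[p]), ‖c‖ * r ^ k ≤ 1 → IsPowerBounded (c • a ^ k)

namespace IsPowerBounded

variable {A : Type*} [NormedCommRing A]

lemma exists_nonneg {a : A} (ha : IsPowerBounded a) : ∃ C : ℝ, 0 ≤ C ∧ ∀ n : ℕ, ‖a ^ n‖ ≤ C := by
  obtain ⟨C, hC⟩ := ha
  exact ⟨C, (norm_nonneg _).trans (hC 0), hC⟩

lemma mul {a b : A} (ha : IsPowerBounded a) (hb : IsPowerBounded b) : IsPowerBounded (a * b) := by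
  obtain ⟨C, hC0, hC⟩ := ha.exists_nonneg
  obtain ⟨D, -, hD⟩ := hb.exists_nonneg
  refine ⟨C * D, fun n => ?_⟩
  rw [mul_pow]
  exact (norm_mul_le _ _).trans (mul_le_mul (hC n) (hD n) (norm_nonneg _) hC0)

lemma neg {a : A} (ha : IsPowerBounded a) : IsPowerBounded (-a) := by
  obtain ⟨C, hC⟩ := ha
  refine ⟨C, fun n => ?_⟩
  rw [neg_pow]
  rcases neg_one_pow_eq_or A n with h | h <;> rw [h]
  · rw [one_mul]; exact hC n
  · rw [neg_one_mul, norm_neg]; exact hC n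

lemma one : IsPowerBounded (1 : A) := ⟨‖(1 : A)‖, fun n => by rw [one_pow]⟩

lemma pow {a : A} (ha : IsPowerBounded a) (m : ℕ) : IsPowerBounded (a ^ m) := by
  obtain ⟨C, hC⟩ := ha
  exact ⟨C, fun n => by rw [← pow_mul]; exact hC _⟩

lemma of_pow {a : A} {m : ℕ} (hm : 0 < m) (ha : IsPowerBounded (a ^ m)) : IsPowerBounded a := by
  obtain ⟨C, hC0, hC⟩ := ha.exists_nonneg
  refine ⟨∑ i ∈ Finset.range m, C * ‖a ^ i‖, fun n => ?_⟩
  rw [← Nat.div_add_mod n m, pow_add, pow_mul]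
  refine (norm_mul_le _ _).trans ((mul_le_mul_of_nonneg_right (hC _) (norm_nonneg _)).trans ?_)
  exact Finset.single_le_sum (f := fun i => C * ‖a ^ i‖)
    (fun i _ => mul_nonneg hC0 (norm_nonneg _)) (Finset.mem_range.2 (Nat.mod_lt n hm))

lemma add [IsUltrametricDist A] {a b : A} (ha : IsPowerBounded a) (hb : IsPowerBounded b) :
    IsPowerBounded (a + b) := by
  obtain ⟨C, hC0, hC⟩ := ha.exists_nonneg
  obtain ⟨D, hD0, hD⟩ := hb.exists_nonneg
  have hn : ∀ (n : ℕ) (x : A), ‖n • x‖ ≤ ‖x‖ := fun n x => by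
    induction n with
    | zero => simp
    | succ n ih =>
      rw [succ_nsmul]
      exact (IsUltrametricDist.norm_add_le_max _ _).trans (max_le ih le_rfl)
  refine ⟨C * D, fun n => ?_⟩
  rw [add_pow]
  refine IsUltrametricDist.norm_sum_le_of_forall_le_of_nonneg (mul_nonneg hC0 hD0) fun i _ => ?_
  rw [mul_comm, ← nsmul_eq_mul]
  refine (hn _ _).trans ((norm_mul_le _ _).trans ?_)
  exact mul_le_mul (hC _) (hD _) (norm_nonneg _) hC0

lemma smul [NormedAlgebra ℚ_[p] A] {a : A} (ha : IsPowerBounded a) {c : ℚ_[p]} (hc : ‖c‖ ≤ 1) :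
    IsPowerBounded (c • a) := by
  obtain ⟨C, hC⟩ := ha
  refine ⟨C, fun n => ?_⟩
  rw [smul_pow]
  refine (norm_smul_le _ _).trans ?_
  rw [norm_pow]
  exact (mul_le_of_le_one_left (norm_nonneg _) (pow_le_one₀ (norm_nonneg _) hc)).trans (hC n)

lemma sum [IsUltrametricDist A] {ι : Type*}
    (s : Finset ι) (f : ι → A) (h : ∀ i ∈ s, IsPowerBounded (f i)) :
    IsPowerBounded (∑ i ∈ s, f i) := by
  classical
  induction s using Finset.induction_on with
  | empty =>
    refine ⟨max ‖(1 : A)‖ 0, fun n => ?_⟩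
    rcases Nat.eq_zero_or_pos n with rfl | hn
    · simp
    · simp [zero_pow hn.ne']
  | insert i s hi ih =>
    rw [Finset.sum_insert hi]
    exact (h i (Finset.mem_insert_self _ _)).add
      (ih fun j hj => h j (Finset.mem_insert_of_mem hj))

lemma map {R R' : AffinoidAlgebra p} (f : R ⟶ R') {a : R} (ha : IsPowerBounded a) :
    IsPowerBounded (f a) := by
  obtain ⟨C, hC0, hC⟩ := ha.exists_nonneg
  let g : R →L[ℚ_[p]] R' := (ConcreteCategory.hom f).toContinuousLinearMap
  obtain ⟨M, hM0, hM⟩ := g.isBoundedLinearMap.bound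
  refine ⟨M * C, fun n => ?_⟩
  rw [← map_pow]
  exact (hM _).trans (mul_le_mul_of_nonneg_left (hC n) hM0.le)

end IsPowerBounded

section

variable {A : Type*} [NormedCommRing A] [NormedAlgebra ℚ_[p] A]

lemma supNormLE_zero {r : ℝ} : SupNormLE (p := p) (0 : A) r := by
  intro k c hc
  rcases Nat.eq_zero_or_pos k with rfl | hk
  · rw [pow_zero, mul_one] at hc
    rw [pow_zero]
    exact IsPowerBounded.one.smul hc
  · rw [zero_pow hk.ne', smul_zero, ← zero_smul ℚ_[p] (1 : A)]
    exact IsPowerBounded.one.smul (by simp)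

lemma SupNormLE.mono {a : A} {r s : ℝ} (ha : SupNormLE (p := p) a r) (hr : 0 ≤ r)
    (hrs : r ≤ s) :
    SupNormLE (p := p) a s := fun k c hc =>
  ha k c ((mul_le_mul_of_nonneg_left (pow_le_pow_left₀ hr hrs k) (norm_nonneg _)).trans hc)

lemma SupNormLE.mul_left {a u : A} {r : ℝ} (ha : SupNormLE (p := p) a r) (hu : IsPowerBounded u) :
    SupNormLE (p := p) (u * a) r := fun k c hc => by
  rw [mul_pow, ← mul_smul_comm]
  exact (hu.pow k).mul (ha k c hc)

lemma SupNormLE.add [IsUltrametricDist A] {a b : A} {r : ℝ} (ha : SupNormLE (p := p) a r)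
    (hr0 : 0 ≤ r)
    (hr : ∃ (N : ℕ) (d : ℚ_[p]), 0 < N ∧ ‖d‖ * r ^ N = 1) (hb : SupNormLE (p := p) b r) :
    SupNormLE (p := p) (a + b) r := fun k c hc => by
  obtain ⟨N, d, hN, hd⟩ := hr
  have hd0 : d ≠ 0 := by rintro rfl; simp at hd
  rw [add_pow, Finset.smul_sum]
  refine IsPowerBounded.sum _ _ fun i hi => ?_
  have hik : i + (k - i) = k := by have := Finset.mem_range.1 hi; omega
  refine IsPowerBounded.of_pow hN ?_
  have key : (c • (a ^ i * b ^ (k - i) * ((k.choose i : ℕ) : A))) ^ N =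
      ((k.choose i : ℚ_[p]) ^ N * (c ^ N * (d ^ k)⁻¹)) •
        ((d • a ^ N) ^ i * (d • b ^ N) ^ (k - i)) := by
    have hch : ((k.choose i : ℕ) : A) = algebraMap ℚ_[p] A (k.choose i : ℚ_[p]) := by simp
    have hdd : d ^ k = d ^ i * d ^ (k - i) := by rw [← pow_add, hik]
    rw [hch]
    simp only [Algebra.smul_def, map_mul, map_pow, mul_pow]
    have h1 : algebraMap ℚ_[p] A (d ^ k)⁻¹ * (algebraMap ℚ_[p] A d ^ i *
        algebraMap ℚ_[p] A d ^ (k - i)) = 1 := by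
      rw [← map_pow, ← map_pow, ← map_mul, ← map_mul, ← hdd, inv_mul_cancel₀ (pow_ne_zero _ hd0),
        map_one]
    simp only [← pow_mul] at h1 ⊢
    rw [mul_comm i N, mul_comm (k - i) N]
    linear_combination (-(algebraMap ℚ_[p] A c ^ N * a ^ (N * i) * b ^ (N * (k - i)) *
      algebraMap ℚ_[p] A (k.choose i : ℚ_[p]) ^ N)) * h1
  rw [key]
  refine (((ha N d hd.le).pow i).mul ((hb N d hd.le).pow (k - i))).smul ?_
  rw [norm_mul, norm_pow, norm_mul, norm_inv, norm_pow, norm_pow]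
  have h1 : ‖(k.choose i : ℚ_[p])‖ ^ N ≤ 1 :=
    pow_le_one₀ (norm_nonneg _) (by simpa using Padic.norm_int_le_one (p := p) (k.choose i : ℤ))
  have hdpos : 0 < ‖d‖ ^ k := pow_pos (norm_pos_iff.2 hd0) k
  have h2 : ‖c‖ ^ N * (‖d‖ ^ k)⁻¹ ≤ 1 := by
    have hrN : r ^ N = ‖d‖⁻¹ := eq_inv_of_mul_eq_one_right hd
    have : (‖c‖ * r ^ k) ^ N = ‖c‖ ^ N * (‖d‖ ^ k)⁻¹ := by
      rw [mul_pow, ← pow_mul, mul_comm k N, pow_mul, hrN, inv_pow]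
    rw [← this]
    exact pow_le_one₀ (by positivity) hc
  exact mul_le_one₀ h1 (by positivity) h2

lemma SupNormLE.map {R R' : AffinoidAlgebra p} (f : R ⟶ R') {a : R} {r : ℝ}
    (ha : SupNormLE (p := p) a r) : SupNormLE (p := p) (f a) r := fun k c hc => by
  have := (ha k c hc).map f
  rwa [map_smul, map_pow] at this

end

/-- `i : Sp A' ⟶ Sp A` is an open immersion onto a rational subdomain
`{x | |f₁ x| ≤ |g x|, …, |f_m x| ≤ |g x|}` of `Sp A`, where `f₁, …, f_m, g` have no common zero:
it is injective, and its image consists of the points where `g` is invertible and all `f_j / g`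
are power-bounded.  Rational subdomains are admissible affinoid opens. -/
def IsRationalOpenImmersion {A' A : AffinoidAlgebra p} (i : Sp A' ⟶ Sp A) : Prop :=
  ∃ (m : ℕ) (f : Fin m → A) (g : A), Ideal.span (insert g (Set.range f)) = ⊤ ∧
    ∀ R : AffinoidAlgebra p, Function.Injective (i.app R) ∧
      ∀ x : A ⟶ R, (∃ y, i.app R y = x) ↔
        IsUnit (x g) ∧ ∀ j, ∃ h : R, IsPowerBounded h ∧ x (f j) = x g * h

/-- The rigid space obtained by gluing affinoids `X 0 ⟶ X 1 ⟶ X 2 ⟶ ⋯` along the transition maps.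
When these are open immersions of affinoids, this is the increasing union with the `X n` as an
admissible covering; every map from an affinoid space to it factors through some `X n`, so that
its functor of points is the colimit of those of the `X n`. -/
def gluing {X : ℕ → AffinoidAlgebra p} (i : ∀ n, Sp (X n) ⟶ Sp (X (n + 1))) : Space p :=
  Limits.colimit (Functor.ofSequence i)

/-- The canonical map from the `n`-th piece of a gluing. -/
def gluingι {X : ℕ → AffinoidAlgebra p} (i : ∀ n, Sp (X n) ⟶ Sp (X (n + 1))) (n : ℕ) :
    Sp (X n) ⟶ gluing i :=
  Limits.colimit.ι (Functor.ofSequence i) n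

/-! ### Subgroups and quotients -/

/-- A subgroup of a rigid-analytic group, on functors of points. -/
structure SubgroupSpace (G : GroupSpace p) where
  obj : ∀ R : AffinoidAlgebra p, Subgroup (G.obj R)
  map_mem : ∀ {R R' : AffinoidAlgebra p} (f : R ⟶ R') (x : G.obj R), x ∈ obj R →
    G.map f x ∈ obj R'

namespace SubgroupSpace

variable {G : GroupSpace p}

/-- The subgroup as a rigid-analytic group. -/
def toGroup (H : SubgroupSpace G) : GroupSpace p where
  obj R := CommGrpCat.of (H.obj R)
  map f := CommGrpCat.ofHom
    (((G.map f).hom.comp (H.obj _).subtype).codRestrict (H.obj _) fun x => H.map_mem f x x.2)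
  map_id R := by ext x; simp
  map_comp f g := by ext x; exact congrArg Subtype.val (Subtype.ext (by simp; rfl))

/-- The inclusion of a subgroup. -/
def ι (H : SubgroupSpace G) : H.toGroup ⟶ G where
  app R := CommGrpCat.ofHom (H.obj R).subtype

/-- The inclusion of a subgroup in a larger one. -/
def incl {H H' : SubgroupSpace G} (h : ∀ R, H.obj R ≤ H'.obj R) : H.toGroup ⟶ H'.toGroup where
  app R := CommGrpCat.ofHom (Subgroup.inclusion (h R))

end SubgroupSpace

/-- `G[m]`, the elements `g` with `g ^ m = 1`. -/
def torsionBy (G : GroupSpace p) (m : ℕ) : SubgroupSpace G where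
  obj R := (powMonoidHom m : G.obj R →* G.obj R).ker
  map_mem f x hx := by
    rw [MonoidHom.mem_ker, powMonoidHom_apply] at hx ⊢
    rw [← map_pow, hx, map_one]

/-- `G_tors`, the elements of finite order. -/
def torsion (G : GroupSpace p) : SubgroupSpace G where
  obj R := CommGroup.torsion (G.obj R)
  map_mem f _ hx := MonoidHom.isOfFinOrder (G.map f).hom hx

/-- `q : G ⟶ X` is the quotient of the rigid-analytic group `G` by its subgroup `H`. -/
structure IsQuotient {G : GroupSpace p} (H : SubgroupSpace G) {X : Space p} (q : G.toSpace ⟶ X) :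
    Prop where
  /-- `q` is surjective (on points with values in finite extensions of `ℚ_p`, which are the
  affinoid algebras that are fields; points may be lifted after a finite extension). -/
  surjective : ∀ L : AffinoidAlgebra p, IsField L → ∀ x : X.obj L,
    ∃ L' : AffinoidAlgebra p, IsField L' ∧ ∃ (f : L ⟶ L') (g : G.obj L'),
      q.app L' g = X.map f x
  /-- The two compositions `H × G ⇉ G ⟶ X` (multiplication and projection) coincide. -/
  coincide : ∀ (R : AffinoidAlgebra p) (h : H.obj R) (g : G.obj R),
    q.app R ((h : G.obj R) * g) = q.app R g
  /-- The resulting map `H × G ⟶ G ×_X G`, `(h, g) ↦ (h * g, g)`, is an isomorphism. -/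
  isIso : ∀ R : AffinoidAlgebra p, Function.Bijective
    (fun x : H.obj R × G.obj R => (⟨((x.1 : G.obj R) * x.2, x.2), coincide R x.1 x.2⟩ :
      {y : G.obj R × G.obj R // q.app R y.1 = q.app R y.2}))
  /-- The analytic functions on `X` are the `H`-invariant analytic functions on `G`. -/
  functions : ∀ f : G.toSpace ⟶ affineLine p,
    (∀ (R : AffinoidAlgebra p) (h : H.obj R) (g : G.obj R),
      f.app R ((h : G.obj R) * g) = f.app R g) →
    ∃! f' : X ⟶ affineLine p, q ≫ f' = f

end

/-! ### Weight space -/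

/-- The `p`-adic weight space `𝒲`, with `R`-points the continuous characters `ℤ_p^× → R^×`. -/
def weightSpace (p : ℕ) [Fact p.Prime] : GroupSpace p where
  obj R := CommGrpCat.of (ℤ_[p]ˣ →ₜ* Rˣ)
  map {R R'} f := CommGrpCat.ofHom
    { toFun := fun ψ => ContinuousMonoidHom.comp
        ⟨Units.map (ConcreteCategory.hom f : R →* R'),
          Continuous.units_map _ (map_continuous (ConcreteCategory.hom f))⟩ ψ
      map_one' := by ext; simp
      map_mul' := fun _ _ => by ext; simp }
  map_id R := rfl
  map_comp f g := rfl

section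

variable {p : ℕ} [Fact p.Prime]

/-- The value `ψ(u)` of a character, as an element of `R`. -/
def charValue {R : AffinoidAlgebra p} (ψ : (weightSpace p).obj R) (u : ℤ_[p]ˣ) : R :=
  (((show ℤ_[p]ˣ →ₜ* Rˣ from ψ) u : Rˣ) : R)

lemma charValue_mul {R : AffinoidAlgebra p} (ψ ψ' : (weightSpace p).obj R) (u : ℤ_[p]ˣ) :
    charValue (ψ * ψ') u = charValue ψ u * charValue ψ' u := rfl

lemma charValue_map {R R' : AffinoidAlgebra p} (f : R ⟶ R') (ψ : (weightSpace p).obj R)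
    (u : ℤ_[p]ˣ) : charValue ((weightSpace p).map f ψ) u = f (charValue ψ u) := rfl

lemma isPowerBounded_charValue {R : AffinoidAlgebra p} (ψ : (weightSpace p).obj R) (u : ℤ_[p]ˣ) :
    IsPowerBounded (charValue ψ u) := by
  have hc : Continuous fun v : ℤ_[p]ˣ => charValue ψ v :=
    Units.continuous_val.comp (map_continuous (show ℤ_[p]ˣ →ₜ* Rˣ from ψ))
  obtain ⟨C, hC⟩ := (isCompact_range hc).isBounded.exists_norm_le
  refine ⟨C, fun n => ?_⟩
  have : charValue ψ u ^ n = charValue ψ (u ^ n) := by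
    rw [charValue, charValue, map_pow, Units.val_pow_eq_pow_val]
  rw [this]
  exact hC _ ⟨_, rfl⟩

/-- `γ` is a topological generator of the pro-cyclic group `1 + p ℤ_p`. -/
def IsGenerator (γ : ℤ_[p]ˣ) : Prop :=
  closure (Subgroup.zpowers γ : Set ℤ_[p]ˣ) = {u : ℤ_[p]ˣ | (p : ℤ_[p]) ∣ (u : ℤ_[p]) - 1}

/-- The identity component `𝒲⁰`: the characters which are trivial on the roots of unity
`μ_{p-1} ⊆ ℤ_p^×`. -/
def identityComponent (p : ℕ) [Fact p.Prime] : SubgroupSpace (weightSpace p) where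
  obj R :=
    { carrier := {ψ | ∀ ζ : ℤ_[p]ˣ, ζ ^ (p - 1) = 1 → charValue ψ ζ = 1}
      one_mem' := fun _ _ => rfl
      mul_mem' := fun {a b} ha hb ζ hζ => by
        rw [charValue_mul, ha ζ hζ, hb ζ hζ, one_mul]
      inv_mem' := fun {a} ha ζ hζ => by
        have := charValue_mul a a⁻¹ ζ
        rw [ha ζ hζ, one_mul, mul_inv_cancel] at this
        rw [← this]; rfl }
  map_mem f ψ hψ ζ hζ := by
    rw [charValue_map, hψ ζ hζ, map_one]

/-- The radius `p ^ (-1 / (p ^ (n - 1) * (p - 1)))`. -/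
def discRadius (p n : ℕ) : ℝ :=
  (p : ℝ) ^ (-(1 / ((p : ℝ) ^ ((n : ℤ) - 1) * ((p : ℝ) - 1))))

lemma discRadius_pos (p : ℕ) [Fact p.Prime] (n : ℕ) : 0 < discRadius p n :=
  Real.rpow_pos_of_pos (by exact_mod_cast (Fact.out : p.Prime).pos) _

lemma discRadius_pow (p : ℕ) [hp : Fact p.Prime] (n : ℕ) :
    ∃ (N : ℕ) (d : ℚ_[p]), 0 < N ∧ ‖d‖ * discRadius p n ^ N = 1 := by
  have h1 : (1 : ℝ) < p := by exact_mod_cast hp.out.one_lt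
  have h0 : (0 : ℝ) < p := by linarith
  refine ⟨p ^ n * (p - 1), ((p : ℚ_[p]) ^ p)⁻¹,
    Nat.mul_pos (pow_pos hp.out.pos n) (Nat.sub_pos_of_lt hp.out.one_lt), ?_⟩
  have h2 : discRadius p n ^ (p ^ n * (p - 1)) = (p : ℝ) ^ (-(p : ℝ)) := by
    rw [discRadius, ← Real.rpow_natCast, ← Real.rpow_mul h0.le]
    congr 1
    rw [zpow_sub_one₀ h0.ne', zpow_natCast, Nat.cast_mul, Nat.cast_pow,
      Nat.cast_sub hp.out.one_lt.le, Nat.cast_one]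
    have h3 : (p : ℝ) - 1 ≠ 0 := by linarith
    have h4 : (p : ℝ) ^ n ≠ 0 := (pow_pos h0 n).ne'
    field_simp
  rw [h2, norm_inv, norm_pow, Padic.norm_p, inv_pow, inv_inv, Real.rpow_neg h0.le,
    Real.rpow_natCast, mul_inv_cancel₀ (pow_pos h0 p).ne']

lemma discRadius_le_succ (p : ℕ) [hp : Fact p.Prime] (n : ℕ) :
    discRadius p n ≤ discRadius p (n + 1) := by
  have h1 : (1 : ℝ) < p := by exact_mod_cast hp.out.one_lt
  have h3 : (0 : ℝ) < (p : ℝ) - 1 := by linarith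
  refine Real.rpow_le_rpow_of_exponent_le h1.le (neg_le_neg ?_)
  refine one_div_le_one_div_of_le (mul_pos (zpow_pos (by linarith) _) h3) ?_
  refine mul_le_mul_of_nonneg_right (zpow_le_zpow_right₀ h1.le ?_) h3.le
  push_cast
  linarith

/-- The affinoid subgroup `𝒲⁰_n` of `𝒲⁰` defined by `|ψ(γ) - 1| ≤ p ^ (-1 / (p ^ (n - 1) (p - 1)))`,
for the topological generators `γ` of `1 + p ℤ_p`. -/
def disc (p : ℕ) [Fact p.Prime] (n : ℕ) : SubgroupSpace (identityComponent p).toGroup where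
  obj R :=
    { carrier := {ψ | ∀ γ : ℤ_[p]ˣ, IsGenerator γ →
        SupNormLE (p := p) (charValue ((identityComponent p).ι.app R ψ) γ - 1) (discRadius p n)}
      one_mem' := fun γ _ => by
        have : charValue ((identityComponent p).ι.app R 1) γ = 1 := rfl
        rw [this, sub_self]
        exact supNormLE_zero
      mul_mem' := fun {a b} ha hb γ hγ => by
        have : charValue ((identityComponent p).ι.app R (a * b)) γ - 1 =
            charValue ((identityComponent p).ι.app R a) γ *
              (charValue ((identityComponent p).ι.app R b) γ - 1) +
            (charValue ((identityComponent p).ι.app R a) γ - 1) := by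
          rw [map_mul, charValue_mul]; ring
        rw [this]
        exact ((hb γ hγ).mul_left (isPowerBounded_charValue _ _)).add (discRadius_pos p n).le
          (discRadius_pow p n)
          (ha γ hγ)
      inv_mem' := fun {a} ha γ hγ => by
        have h1 : charValue ((identityComponent p).ι.app R a) γ *
            charValue ((identityComponent p).ι.app R a⁻¹) γ = 1 := by
          rw [← charValue_mul, ← map_mul, mul_inv_cancel]; rfl
        have : charValue ((identityComponent p).ι.app R a⁻¹) γ - 1 =
            (-charValue ((identityComponent p).ι.app R a⁻¹) γ) *
              (charValue ((identityComponent p).ι.app R a) γ - 1) := by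
          linear_combination h1
        rw [this]
        exact (ha γ hγ).mul_left (isPowerBounded_charValue _ _).neg }
  map_mem f ψ hψ γ hγ := by
    have : charValue ((identityComponent p).ι.app _ ((identityComponent p).toGroup.map f ψ)) γ - 1 =
        f (charValue ((identityComponent p).ι.app _ ψ) γ - 1) := by
      rw [map_sub, map_one, ← charValue_map]; rfl
    rw [this]
    exact (hψ γ hγ).map f

lemma disc_le_succ (p : ℕ) [Fact p.Prime] (n : ℕ) (R : AffinoidAlgebra p) :
    (disc p n).obj R ≤ (disc p (n + 1)).obj R :=
  fun _ hψ γ hγ => (hψ γ hγ).mono (discRadius_pos p n).le (discRadius_le_succ p n)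

/-- The `k`-th term, `k ≥ 0`, of the series `log_p(x) = ∑ (-1) ^ k (x - 1) ^ (k + 1) / (k + 1)`. -/
def logTerm {A : Type*} [NormedCommRing A] [NormedAlgebra ℚ_[p] A] (x : A) (k : ℕ) : A :=
  ((-1) ^ k / ((k : ℚ_[p]) + 1)) • (x - 1) ^ (k + 1)

/-- `ϑ` is the analytic function `ψ ↦ log_p(ψ(γ)) / log_p(γ)` on `𝒲⁰`, for every topological
generator `γ` of `1 + p ℤ_p` (with convergent logarithms, and `log_p(γ) ≠ 0`). -/
def IsTheta (ϑ : (identityComponent p).toGroup.toSpace ⟶ affineLine p) : Prop :=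
  ∀ γ : ℤ_[p]ˣ, IsGenerator γ → ∃ l : ℚ_[p], l ≠ 0 ∧
    HasSum (logTerm (p := p) ((γ : ℤ_[p]) : ℚ_[p])) l ∧
    ∀ (R : AffinoidAlgebra p) (ψ : (identityComponent p).toGroup.obj R),
      HasSum (logTerm (p := p) (charValue ((identityComponent p).ι.app R ψ) γ))
        (l • (ϑ.app R ψ : R))

end

end RigidWeight

end

open RigidWeight

/-!
# Weight space modulo torsion is the affine line

Everything is controlled by the logarithm. A character `ψ` in `𝒲⁰` is determined by the value `ψ(γ)`
at the topological generator `γ = 1 + p` of `1 + p ℤ_p`, and that value can be any `1 + t` with `t`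
topologically nilpotent (`char_ext`, `exists_chi_gen_eq`). So `𝒲⁰` is the open unit disc in the
variable `t`, with the multiplicative group law, and `𝒲⁰_n` is the closed disc
`|t| ≤ discRadius p n`. Up to a constant `ϑ(ψ)` is `log (1 + t)`; it is a homomorphism, so
`ϑ(ψ ^ p ^ n) = p ^ n ϑ(ψ)`.

On the smallest disc `𝒲⁰_0` the logarithm is invertible, the inverse being the exponential, so `ϑ` is
an isomorphism of `𝒲⁰_0` onto the disc `|s| ≤ p ^ (-1 / (p - 1))`
(`exists_thetaVal_eq`, `eq_of_thetaVal_eq`). Moreover `ψ` is in `𝒲⁰_n` if and only if `ψ ^ p ^ n` is in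
`𝒲⁰_0` (`pow_mem_disc_iff`). Hence `ϑ` maps `𝒲⁰_n` to the disc `|s| ≤ p ^ (n - 1 / (p - 1))`, and its
fibres are the cosets of the `p ^ n`-torsion (`pow_eq_one_iff_thetaVal`); it is surjective on points
because a `p ^ n`-th root can be adjoined to a power-bounded element of a finite extension
(`exists_root`).

It remains to identify the invariant functions. With `x = 1 + X` and `N = p ^ n`, the functions on
`𝒲⁰_n` are spanned by `1, X, …, X ^ (N - 1)` over the functions of `x ^ N - 1`
(`exists_eq_sum_powHom`). Translating by the torsion point `Y` of `B⟨Y⟩ / (Y ^ N - 1)`, where `B` is the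
ring of functions on `𝒲⁰_n`, and comparing the coefficients of `Y ^ 0` shows that an invariant function
is a function of `x ^ N - 1` alone (`exists_eq_eval_of_invariant`), hence of `p ^ n ϑ` through the
exponential. Therefore `ϑ` is the quotient of `𝒲⁰_n` by its `p ^ n`-torsion
(`isQuotient_thetaDisc`).

Any other affinoid quotient is uniquely isomorphic to this one: a quotient map onto an affinoid space is
universal for invariant maps to affinoid spaces, by the closed graph theorem
(`IsQuotient.existsUnique_desc`). So any choice of quotients `X n` consists of the discs
`|s| ≤ p ^ (n - 1 / (p - 1))` in the affine line, the transition maps are their inclusions, and the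
gluing is the affine line; since the `𝒲⁰_n` exhaust `𝒲⁰`, the map `ϑ` is the quotient of `𝒲⁰` by its
torsion (`isQuotient_torsion`).

The bound `|a| ≤ r` on an affinoid space is handled throughout as the growth condition
`‖a ^ k‖ ≤ C * r ^ k` (`GrowthLE`), and functions on the disc of radius `r` as restricted power series
(`RSeries`).
-/

noncomputable section

namespace RigidWeight

open Filter Topology

/-! ### Growth of powers -/

/-- The powers of `a` grow at most like those of `r`: `‖a ^ k‖ ≤ C * r ^ k` for some `C`. This is a
version of `SupNormLE a r` that is convenient for estimates; see `supNormLE_iff_growthLE`. -/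
def GrowthLE {A : Type*} [NormedCommRing A] (a : A) (r : ℝ) : Prop :=
  ∃ C : ℝ, ∀ k : ℕ, ‖a ^ k‖ ≤ C * r ^ k

section

variable {A : Type*} [NormedCommRing A] {a b : A} {r s : ℝ}

lemma GrowthLE.exists_nonneg (ha : GrowthLE a r) :
    ∃ C : ℝ, 0 ≤ C ∧ ∀ k : ℕ, ‖a ^ k‖ ≤ C * r ^ k := by
  obtain ⟨C, hC⟩ := ha
  exact ⟨C, by simpa using (norm_nonneg _).trans (hC 0), hC⟩

lemma growthLE_one_iff : GrowthLE a 1 ↔ IsPowerBounded a := by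
  simp [GrowthLE, IsPowerBounded]

lemma GrowthLE.mono (ha : GrowthLE a r) (hr : 0 ≤ r) (hrs : r ≤ s) : GrowthLE a s := by
  obtain ⟨C, hC0, hC⟩ := ha.exists_nonneg
  exact ⟨C, fun k => (hC k).trans (by gcongr)⟩

lemma GrowthLE.mul (ha : GrowthLE a r) (hb : GrowthLE b s) : GrowthLE (a * b) (r * s) := by
  obtain ⟨C, hC0, hC⟩ := ha.exists_nonneg
  obtain ⟨D, hD0, hD⟩ := hb.exists_nonneg
  refine ⟨C * D, fun k => ?_⟩
  rw [mul_pow, mul_pow, mul_mul_mul_comm]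
  exact (norm_mul_le _ _).trans (mul_le_mul (hC k) (hD k) (norm_nonneg _)
    ((norm_nonneg _).trans (hC k)))

lemma GrowthLE.pow (ha : GrowthLE a r) (m : ℕ) : GrowthLE (a ^ m) (r ^ m) := by
  obtain ⟨C, hC⟩ := ha
  exact ⟨C, fun k => by rw [← pow_mul, ← pow_mul]; exact hC _⟩

lemma GrowthLE.of_pow {m : ℕ} (hm : 0 < m) (hr : 0 < r) (ha : GrowthLE (a ^ m) (r ^ m)) :
    GrowthLE a r := by
  obtain ⟨C, hC0, hC⟩ := ha.exists_nonneg
  have hs : ∀ i, 0 ≤ ‖a ^ i‖ * (r ^ i)⁻¹ := fun i => by positivity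
  refine ⟨C * ∑ i ∈ Finset.range m, ‖a ^ i‖ * (r ^ i)⁻¹, fun n => ?_⟩
  have h1 : ‖a ^ (n % m)‖ ≤ (∑ i ∈ Finset.range m, ‖a ^ i‖ * (r ^ i)⁻¹) * r ^ (n % m) := by
    rw [← div_le_iff₀ (by positivity), div_eq_mul_inv]
    exact Finset.single_le_sum (f := fun i => ‖a ^ i‖ * (r ^ i)⁻¹) (fun i _ => hs i)
      (Finset.mem_range.2 (Nat.mod_lt n hm))
  calc ‖a ^ n‖ = ‖(a ^ m) ^ (n / m) * a ^ (n % m)‖ := by rw [← pow_mul, ← pow_add, Nat.div_add_mod]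
    _ ≤ _ := norm_mul_le _ _
    _ ≤ (C * (r ^ m) ^ (n / m)) *
        ((∑ i ∈ Finset.range m, ‖a ^ i‖ * (r ^ i)⁻¹) * r ^ (n % m)) :=
      mul_le_mul (hC _) h1 (norm_nonneg _) (by positivity)
    _ = _ := by
      conv_rhs => rw [← Nat.div_add_mod n m, pow_add, pow_mul]
      ring

lemma GrowthLE.of_norm_le (ha : ‖a‖ ≤ r) : GrowthLE a r := by
  refine ⟨max ‖(1 : A)‖ 1, fun k => ?_⟩
  have hr : 0 ≤ r := (norm_nonneg _).trans ha
  rcases Nat.eq_zero_or_pos k with rfl | hk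
  · simp
  · exact (norm_pow_le' a hk).trans ((pow_le_pow_left₀ (norm_nonneg _) ha k).trans
      (le_mul_of_one_le_left (by positivity) (le_max_right _ _)))

lemma GrowthLE.neg (ha : GrowthLE a r) : GrowthLE (-a) r := by
  obtain ⟨C, hC⟩ := ha
  refine ⟨C, fun n => ?_⟩
  rcases neg_one_pow_eq_or A n with h | h <;> rw [neg_pow, h]
  · rw [one_mul]; exact hC n
  · rw [neg_one_mul, norm_neg]; exact hC n

lemma GrowthLE.add [IsUltrametricDist A] (hr : 0 ≤ r) (ha : GrowthLE a r) (hb : GrowthLE b r) :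
    GrowthLE (a + b) r := by
  obtain ⟨C, hC0, hC⟩ := ha.exists_nonneg
  obtain ⟨D, hD0, hD⟩ := hb.exists_nonneg
  refine ⟨C * D, fun n => ?_⟩
  rw [add_pow]
  refine IsUltrametricDist.norm_sum_le_of_forall_le_of_nonneg (by positivity) fun i hi => ?_
  rw [mul_comm, ← nsmul_eq_mul]
  refine (IsUltrametricDist.norm_nsmul_le _ _).trans ((norm_mul_le _ _).trans ?_)
  have hi' : i + (n - i) = n := by have := Finset.mem_range.1 hi; omega
  rw [← hi', pow_add, mul_mul_mul_comm]
  simp only [hi']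
  exact mul_le_mul (hC _) (hD _) (norm_nonneg _) (by positivity)

lemma GrowthLE.sub [IsUltrametricDist A] (hr : 0 ≤ r) (ha : GrowthLE a r) (hb : GrowthLE b r) :
    GrowthLE (a - b) r := sub_eq_add_neg a b ▸ ha.add hr hb.neg

lemma growthLE_zero (hr : 0 ≤ r) : GrowthLE (0 : A) r := .of_norm_le (by simpa)

lemma growthLE_one : GrowthLE (1 : A) 1 := growthLE_one_iff.2 .one

lemma GrowthLE.sum [IsUltrametricDist A] (hr : 0 ≤ r) {ι : Type*} (s : Finset ι) (f : ι → A)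
    (h : ∀ i ∈ s, GrowthLE (f i) r) : GrowthLE (∑ i ∈ s, f i) r :=
  Finset.sum_induction f (GrowthLE · r) (fun _ _ ha hb => ha.add hr hb) (growthLE_zero hr) h

lemma growthLE_intCast [IsUltrametricDist A] (n : ℤ) : GrowthLE (n : A) 1 := by
  have hnat : ∀ m : ℕ, GrowthLE (m : A) 1 := fun m => by
    simpa using GrowthLE.sum zero_le_one (Finset.range m) (fun _ => (1 : A)) fun _ _ => growthLE_one
  obtain ⟨m, rfl | rfl⟩ := n.eq_nat_or_neg
  · simpa using hnat m
  · simpa using (hnat m).neg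

/-- Integral polynomials in a power-bounded element are power-bounded. -/
lemma GrowthLE.aeval [IsUltrametricDist A] (ha : GrowthLE a 1) (P : Polynomial ℤ) :
    GrowthLE (Polynomial.aeval a P) 1 := by
  rw [Polynomial.aeval_eq_sum_range]
  refine .sum zero_le_one _ _ fun i _ => ?_
  rw [zsmul_eq_mul]
  simpa using (growthLE_intCast (A := A) (P.coeff i)).mul (ha.pow i)

lemma GrowthLE.tendsto_pow (ha : GrowthLE a r) (hr : 0 ≤ r) (hr1 : r < 1) :
    Tendsto (fun k : ℕ => a ^ k) atTop (𝓝 0) := by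
  obtain ⟨C, hC⟩ := ha
  refine squeeze_zero_norm hC ?_
  simpa using (tendsto_pow_atTop_nhds_zero_of_lt_one hr hr1).const_mul C

end

section

variable {p : ℕ} [hp : Fact p.Prime] {A : Type*} [NormedCommRing A] [NormedAlgebra ℚ_[p] A]
  {a : A} {r : ℝ}

lemma GrowthLE.smul (ha : GrowthLE a r) (c : ℚ_[p]) : GrowthLE (c • a) (‖c‖ * r) := by
  obtain ⟨C, hC⟩ := ha
  refine ⟨C, fun k => ?_⟩
  rw [smul_pow, mul_pow, mul_left_comm, ← norm_pow]
  exact (norm_smul_le _ _).trans (mul_le_mul_of_nonneg_left (hC k) (norm_nonneg _))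

lemma GrowthLE.map {B : Type*} [NormedCommRing B] [NormedAlgebra ℚ_[p] B] (f : A →A[ℚ_[p]] B)
    (ha : GrowthLE a r) : GrowthLE (f a) r := by
  obtain ⟨C, hC⟩ := ha
  obtain ⟨M, hM0, hM⟩ := f.toContinuousLinearMap.isBoundedLinearMap.bound
  refine ⟨M * C, fun n => ?_⟩
  rw [← map_pow, mul_assoc]
  exact (hM _).trans (mul_le_mul_of_nonneg_left (hC n) hM0.le)

lemma norm_prime_mul_le (x : A) : ‖(p : A) * x‖ ≤ (p : ℝ)⁻¹ * ‖x‖ := by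
  have : (p : A) * x = (p : ℚ_[p]) • x := by simp [Algebra.smul_def]
  rw [this]
  exact (norm_smul_le _ _).trans (by rw [Padic.norm_p])

lemma supNormLE_iff_growthLE (hr : 0 < r) (hd : ∃ (N : ℕ) (d : ℚ_[p]), 0 < N ∧ ‖d‖ * r ^ N = 1) :
    SupNormLE (p := p) a r ↔ GrowthLE a r := by
  refine ⟨fun h => ?_, fun h k c hc => ?_⟩
  · obtain ⟨N, d, hN, hd⟩ := hd
    have hd0 : d ≠ 0 := by rintro rfl; simp at hd
    refine .of_pow hN hr ?_
    have h1 := (growthLE_one_iff.2 (h N d hd.le)).smul d⁻¹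
    rwa [smul_smul, inv_mul_cancel₀ hd0, one_smul, mul_one, norm_inv,
      ← eq_inv_of_mul_eq_one_right hd] at h1
  · exact growthLE_one_iff.1 (((h.pow k).smul c).mono (by positivity) hc)

end

/-- The binomial formula `(1 + t) ^ p = 1 + t ^ p + p (…)`, valid in every commutative ring. -/
lemma exists_one_add_pow_prime (p : ℕ) [hp : Fact p.Prime] : ∃ P : Polynomial ℤ,
    ∀ {A : Type*} [CommRing A] (t : A),
      (1 + t) ^ p = 1 + t ^ p + p * (t * Polynomial.aeval t P) := by
  obtain ⟨P, hP⟩ := exists_add_pow_prime_eq hp.out (1 : Polynomial ℤ) Polynomial.X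
  refine ⟨P, fun t => ?_⟩
  have := congrArg (Polynomial.aeval t) hP
  simp only [map_pow, map_add, map_one, map_mul, map_natCast, Polynomial.aeval_X, one_pow] at this
  rw [this]; ring

section

variable {p : ℕ} [hp : Fact p.Prime] {A : Type*} [NormedCommRing A] [NormedAlgebra ℚ_[p] A]
  [IsUltrametricDist A] {r : ℝ}

/-- If `x ^ p` is close to `1` and `x` is power-bounded, then `x` is close to `1`: rewriting
`t ^ p = t₀ - p * t * v` with `t = x - 1`, `t₀ = x ^ p - 1` lowers the exponent of `t`, and each
of the two terms satisfies the required bound as soon as `1 / p ≤ r ^ (p - 1)`. -/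
lemma GrowthLE.sub_one_of_pow_prime {x : A} (hr : 0 < r) (hr' : (p : ℝ)⁻¹ ≤ r ^ (p - 1))
    (hx : GrowthLE x 1) (h : GrowthLE (x ^ p - 1) (r ^ p)) : GrowthLE (x - 1) r := by
  obtain ⟨P, hP⟩ := exists_one_add_pow_prime.{_} p
  set t := x - 1 with ht
  set v := Polynomial.aeval t P with hv
  have ht1 : GrowthLE t 1 := hx.sub zero_le_one growthLE_one
  have hv1 : GrowthLE v 1 := ht1.aeval P
  set t₀ := x ^ p - 1 with ht₀
  have key : t ^ p = t₀ - p * (t * v) := by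
    have := hP t
    rw [show 1 + t = x by rw [ht]; ring] at this
    rw [ht₀, this]; ring
  obtain ⟨C, hC0, hC⟩ := h.exists_nonneg
  obtain ⟨D, hD0, hD⟩ := ht1.exists_nonneg
  obtain ⟨E, hE0, hE⟩ := hv1.exists_nonneg
  simp only [one_pow, mul_one] at hD hE
  -- a lower bound for the `r ^ b` with `b < p`
  obtain ⟨m, hm0, hm⟩ : ∃ m : ℝ, 0 < m ∧ ∀ b < p, m ≤ r ^ b := by
    refine ⟨min 1 (r ^ p), by positivity, fun b hb => ?_⟩
    rcases le_total r 1 with h1 | h1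
    · exact (min_le_right _ _).trans (pow_le_pow_of_le_one hr.le h1 hb.le)
    · exact (min_le_left _ _).trans (one_le_pow₀ h1)
  have main : ∀ b a c : ℕ, ‖t₀ ^ a * t ^ b * v ^ c‖ ≤ C * D * E * m⁻¹ * r ^ (p * a + b) := by
    intro b
    induction b using Nat.strong_induction_on with
    | _ b ih =>
      intro a c
      rcases lt_or_ge b p with hb | hb
      · calc _ ≤ ‖t₀ ^ a‖ * ‖t ^ b‖ * ‖v ^ c‖ := by
              grw [norm_mul_le, norm_mul_le]
          _ ≤ (C * (r ^ p) ^ a) * D * E := by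
              gcongr
              exacts [hC a, hD b, hE c]
          _ = C * D * E * m⁻¹ * (r ^ (p * a) * m) := by rw [← pow_mul]; field_simp
          _ ≤ _ := by
              rw [pow_add]
              gcongr
              exact hm b hb
      · obtain ⟨b, rfl⟩ := Nat.exists_eq_add_of_le hb
        have hp1 := hp.out.one_lt
        have e : t₀ ^ a * t ^ (p + b) * v ^ c =
            t₀ ^ (a + 1) * t ^ b * v ^ c - p * (t₀ ^ a * t ^ (b + 1) * v ^ (c + 1)) := by
          rw [pow_add, key]; ring
        rw [e]
        rw [sub_eq_add_neg]
        refine (IsUltrametricDist.norm_add_le_max _ _).trans (max_le ?_ ?_)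
        · refine (ih b (by omega) (a + 1) c).trans_eq ?_
          ring_nf
        · rw [norm_neg]
          refine (norm_prime_mul_le _).trans ?_
          calc (p : ℝ)⁻¹ * ‖t₀ ^ a * t ^ (b + 1) * v ^ (c + 1)‖ ≤
              r ^ (p - 1) * (C * D * E * m⁻¹ * r ^ (p * a + (b + 1))) := by
                gcongr
                exact ih (b + 1) (by omega) a (c + 1)
            _ = C * D * E * m⁻¹ * r ^ (p - 1 + (p * a + (b + 1))) := by rw [pow_add]; ring
            _ = _ := by congr 2; omega
  exact ⟨_, fun k => by simpa using main k 0 0⟩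

end

/-! ### Restricted power series -/

/-- The power series `∑ a_k X ^ k` over `A` with `‖a_k‖ * r ^ k → 0`. -/
def restrictedSubalgebra (A : Type*) [NormedCommRing A] [IsUltrametricDist A] (r : ℝ) :
    Subalgebra A (PowerSeries A) where
  carrier := {f | PowerSeries.IsRestricted r f}
  mul_mem' := PowerSeries.isRestricted.mul r
  add_mem' := PowerSeries.isRestricted.add r
  algebraMap_mem' := PowerSeries.isRestricted_C r

/-- The ring of power series `∑ a_k X ^ k` over `A` with `‖a_k‖ * r ^ k → 0`, that is, the analytic
functions on the closed disc of radius `r` over `A`; it is equipped with the Gauss norm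
`‖∑ a_k X ^ k‖ = sup ‖a_k‖ * r ^ k`. -/
def RSeries (A : Type*) [NormedCommRing A] [IsUltrametricDist A] (r : ℝ) : Type _ :=
  restrictedSubalgebra A r

namespace RSeries

variable {A : Type*} [NormedCommRing A] [IsUltrametricDist A] {r : ℝ}

instance : CommRing (RSeries A r) := inferInstanceAs (CommRing (restrictedSubalgebra A r))

instance {S : Type*} [CommSemiring S] [Algebra S A] : Algebra S (RSeries A r) :=
  inferInstanceAs (Algebra S (restrictedSubalgebra A r))

instance {S : Type*} [CommSemiring S] [Algebra S A] : IsScalarTower S A (RSeries A r) :=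
  inferInstanceAs (IsScalarTower S A (restrictedSubalgebra A r))

/-- The underlying power series. -/
def toPowerSeries : RSeries A r →+* PowerSeries A :=
  (restrictedSubalgebra A r).val.toRingHom

lemma toPowerSeries_injective : Function.Injective (toPowerSeries (A := A) (r := r)) :=
  Subtype.val_injective

/-- The `k`-th coefficient. -/
def coeff (k : ℕ) : RSeries A r →+ A :=
  (PowerSeries.coeff (R := A) k).toAddMonoidHom.comp (toPowerSeries (A := A) (r := r)).toAddMonoidHom

lemma coeff_def (k : ℕ) (f : RSeries A r) : coeff k f = PowerSeries.coeff k (toPowerSeries f) := rfl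

@[ext] lemma ext {f g : RSeries A r} (h : ∀ k, coeff k f = coeff k g) : f = g :=
  toPowerSeries_injective (PowerSeries.ext h)

lemma tendsto_coeff (f : RSeries A r) : Tendsto (fun k => ‖coeff k f‖ * r ^ k) atTop (𝓝 0) :=
  (PowerSeries.isRestricted_iff' r _).1 f.2

/-- The restricted power series with given coefficients. -/
def mk (a : ℕ → A) (ha : Tendsto (fun k => ‖a k‖ * r ^ k) atTop (𝓝 0)) : RSeries A r :=
  ⟨PowerSeries.mk a, (PowerSeries.isRestricted_iff' r _).2 (by simpa using ha)⟩

@[simp] lemma toPowerSeries_mk (a : ℕ → A) (ha : Tendsto (fun k => ‖a k‖ * r ^ k) atTop (𝓝 0)) :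
    toPowerSeries (mk a ha) = PowerSeries.mk a := rfl

@[simp] lemma coeff_mk (a : ℕ → A) (ha : Tendsto (fun k => ‖a k‖ * r ^ k) atTop (𝓝 0)) (k : ℕ) :
    coeff k (mk a ha) = a k := by simp [coeff_def]

lemma coeff_mul (k : ℕ) (f g : RSeries A r) :
    coeff k (f * g) =
      ∑ ij ∈ Finset.HasAntidiagonal.antidiagonal k, coeff ij.1 f * coeff ij.2 g := by
  simp only [coeff_def, map_mul, PowerSeries.coeff_mul]

lemma coeff_one (k : ℕ) : coeff k (1 : RSeries A r) = if k = 0 then 1 else 0 := by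
  rw [coeff_def, map_one, PowerSeries.coeff_one]

lemma toPowerSeries_algebraMap {S : Type*} [CommSemiring S] [Algebra S A] (c : S) :
    toPowerSeries (algebraMap S (RSeries A r) c) = PowerSeries.C (algebraMap S A c) :=
  PowerSeries.algebraMap_apply

@[simp] lemma coeff_smul {S : Type*} [CommSemiring S] [Algebra S A] (k : ℕ) (c : S)
    (f : RSeries A r) : coeff k (c • f) = c • coeff k f := by
  rw [Algebra.smul_def c, Algebra.smul_def, coeff_def, map_mul, toPowerSeries_algebraMap]
  exact PowerSeries.coeff_C_mul k (toPowerSeries f) (algebraMap S A c)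

/-- The monomial `a * X ^ k`. -/
def monomial (k : ℕ) (a : A) : RSeries A r :=
  mk (fun i => if i = k then a else 0) (tendsto_const_nhds.congr' (by
    filter_upwards [eventually_gt_atTop k] with i hi
    simp [hi.ne']))

lemma coeff_monomial (i k : ℕ) (a : A) :
    coeff i (monomial k a : RSeries A r) = if i = k then a else 0 := by simp [monomial]

lemma toPowerSeries_monomial (k : ℕ) (a : A) :
    toPowerSeries (monomial k a : RSeries A r) = PowerSeries.monomial k a := by
  ext i
  rw [← coeff_def, coeff_monomial, PowerSeries.coeff_monomial]

/-- The coordinate function. -/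
def X : RSeries A r := monomial 1 1

lemma X_pow (k : ℕ) : (X : RSeries A r) ^ k = monomial k 1 := by
  apply toPowerSeries_injective
  rw [map_pow, X, toPowerSeries_monomial, toPowerSeries_monomial, ← PowerSeries.X_eq,
    PowerSeries.X_pow_eq]

lemma toPowerSeries_X : toPowerSeries (X : RSeries A r) = PowerSeries.X := by
  rw [X, toPowerSeries_monomial, PowerSeries.X_eq]

lemma monomial_eq_smul (k : ℕ) (a : A) : (monomial k a : RSeries A r) = a • X ^ k := by
  ext i
  rw [X_pow, coeff_smul, coeff_monomial, coeff_monomial]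
  split_ifs <;> simp

lemma bddAbove (f : RSeries A r) : BddAbove (Set.range fun k => ‖coeff k f‖ * r ^ k) :=
  (tendsto_coeff f).bddAbove_range

variable [hr : Fact (0 < r)]

instance : NormedAddCommGroup (RSeries A r) :=
  AddGroupNorm.toNormedAddCommGroup
    { toFun := fun f => ⨆ k, ‖coeff k f‖ * r ^ k
      map_zero' := by simp
      add_le' := fun f g => ciSup_le fun k => by
        refine le_trans ?_ (add_le_add (le_ciSup (bddAbove f) k) (le_ciSup (bddAbove g) k))
        rw [map_add, ← add_mul]
        exact mul_le_mul_of_nonneg_right (norm_add_le _ _) (pow_nonneg hr.out.le _)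
      neg' := fun f => by simp
      eq_zero_of_map_eq_zero' := fun f hf => by
        ext k
        have h1 : ‖coeff k f‖ * r ^ k ≤ 0 := (le_ciSup (bddAbove f) k).trans_eq hf
        have h2 : 0 < r ^ k := pow_pos hr.out k
        have h3 : ‖coeff k f‖ ≤ 0 := by nlinarith [norm_nonneg (coeff k f)]
        simpa using h3 }

lemma norm_coeff_le (f : RSeries A r) (k : ℕ) : ‖coeff k f‖ * r ^ k ≤ ‖f‖ :=
  le_ciSup (bddAbove f) k

lemma norm_le {f : RSeries A r} {M : ℝ} (h : ∀ k, ‖coeff k f‖ * r ^ k ≤ M) : ‖f‖ ≤ M :=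
  ciSup_le h

instance : IsUltrametricDist (RSeries A r) :=
  IsUltrametricDist.isUltrametricDist_of_forall_norm_add_le_max_norm fun f g => norm_le fun k => by
    rw [map_add]
    have h := IsUltrametricDist.norm_add_le_max (coeff k f) (coeff k g)
    calc _ ≤ max ‖coeff k f‖ ‖coeff k g‖ * r ^ k :=
        mul_le_mul_of_nonneg_right h (pow_nonneg hr.out.le _)
      _ ≤ _ := by
        rw [max_mul_of_nonneg _ _ (pow_nonneg hr.out.le _)]
        exact max_le_max (norm_coeff_le f k) (norm_coeff_le g k)

instance : NormedCommRing (RSeries A r) where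
  dist_eq := fun f g => NormedAddCommGroup.dist_eq f g
  norm_mul_le f g := norm_le fun k => by
    have hk : 0 < r ^ k := pow_pos hr.out k
    rw [coeff_mul, ← le_div_iff₀ hk]
    refine IsUltrametricDist.norm_sum_le_of_forall_le_of_nonneg (by positivity) fun ij hij => ?_
    rw [le_div_iff₀ hk, ← Finset.HasAntidiagonal.mem_antidiagonal.1 hij, pow_add]
    calc _ ≤ ‖coeff ij.1 f‖ * ‖coeff ij.2 g‖ * (r ^ ij.1 * r ^ ij.2) :=
          mul_le_mul_of_nonneg_right (norm_mul_le _ _)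
            (mul_nonneg (pow_nonneg hr.out.le _) (pow_nonneg hr.out.le _))
      _ = (‖coeff ij.1 f‖ * r ^ ij.1) * (‖coeff ij.2 g‖ * r ^ ij.2) := by ring
      _ ≤ _ := mul_le_mul (norm_coeff_le f _) (norm_coeff_le g _)
          (mul_nonneg (norm_nonneg _) (pow_nonneg hr.out.le _)) (norm_nonneg _)
  mul_comm := mul_comm

instance {𝕜 : Type*} [NormedField 𝕜] [NormedAlgebra 𝕜 A] : NormedAlgebra 𝕜 (RSeries A r) where
  norm_smul_le c f := norm_le fun k => by
    rw [coeff_smul]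
    calc _ ≤ (‖c‖ * ‖coeff k f‖) * r ^ k :=
          mul_le_mul_of_nonneg_right (norm_smul_le _ _) (pow_nonneg hr.out.le _)
      _ = ‖c‖ * (‖coeff k f‖ * r ^ k) := by ring
      _ ≤ _ := mul_le_mul_of_nonneg_left (norm_coeff_le f k) (norm_nonneg _)

lemma norm_monomial_le (k : ℕ) (a : A) : ‖(monomial k a : RSeries A r)‖ ≤ ‖a‖ * r ^ k := by
  refine norm_le fun i => ?_
  rw [coeff_monomial]
  split_ifs with h
  · rw [h]
  · simpa using mul_nonneg (norm_nonneg a) (pow_nonneg hr.out.le k)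

lemma norm_coeff_sub_le (f g : RSeries A r) (k : ℕ) :
    ‖coeff k f - coeff k g‖ ≤ ‖f - g‖ / r ^ k := by
  rw [← map_sub, le_div_iff₀ (pow_pos hr.out k)]
  exact norm_coeff_le _ _

lemma continuous_coeff (k : ℕ) : Continuous (coeff k : RSeries A r → A) :=
  (AddMonoidHomClass.lipschitz_of_bound (coeff k : RSeries A r →+ A) (1 / r ^ k) fun f => by
    simpa [div_eq_inv_mul] using norm_coeff_sub_le f 0 k).continuous

/-- A restricted power series is the sum of its terms. -/
lemma hasSum_monomial (f : RSeries A r) : HasSum (fun k => monomial k (coeff k f)) f := by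
  classical
  rw [HasSum, Metric.tendsto_nhds]
  intro ε hε
  have h := (tendsto_coeff f).eventually (eventually_lt_nhds (half_pos hε))
  obtain ⟨N, hN⟩ := eventually_atTop.1 h
  rw [SummationFilter.unconditional_filter]
  filter_upwards [eventually_ge_atTop (Finset.range N)] with s hs
  rw [dist_eq_norm]
  refine (norm_le fun k => ?_).trans_lt (half_lt_self hε)
  rw [map_sub, map_sum]
  simp only [coeff_monomial, Finset.sum_ite_eq]
  split_ifs with hk
  · simpa using (half_pos hε).le
  · rw [zero_sub, norm_neg]
    refine (hN k ?_).le
    by_contra hk'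
    exact hk (hs (Finset.mem_range.2 (not_le.1 hk')))

lemma hasSum_smul_X_pow (f : RSeries A r) :
    HasSum (fun k => coeff k f • (X : RSeries A r) ^ k) f := by
  simpa only [monomial_eq_smul] using hasSum_monomial f

instance [CompleteSpace A] : CompleteSpace (RSeries A r) := by
  refine Metric.complete_of_cauchySeq_tendsto fun u hu => ?_
  have hlim : ∀ k, ∃ a : A, Tendsto (fun n => coeff k (u n)) atTop (𝓝 a) := fun k =>
    cauchySeq_tendsto_of_complete (hu.map
      (AddMonoidHomClass.uniformContinuous_of_bound (coeff k : RSeries A r →+ A) (1 / r ^ k)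
        fun f => by simpa [div_eq_inv_mul] using norm_coeff_sub_le f 0 k))
  choose a ha using hlim
  have hclose : ∀ ε > 0, ∃ N, ∀ n ≥ N, ∀ k, ‖coeff k (u n) - a k‖ * r ^ k ≤ ε := fun ε hε => by
    obtain ⟨N, hN⟩ := Metric.cauchySeq_iff.1 hu ε hε
    refine ⟨N, fun n hn k => ?_⟩
    refine le_of_tendsto (((tendsto_const_nhds.sub (ha k)).norm).mul_const _)
      (eventually_atTop.2 ⟨N, fun m hm => ?_⟩)
    rw [← map_sub]
    refine (norm_coeff_le _ _).trans ?_
    rw [← dist_eq_norm]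
    exact (hN n hn m hm).le
  have hres : Tendsto (fun k => ‖a k‖ * r ^ k) atTop (𝓝 0) := by
    rw [Metric.tendsto_atTop]
    intro ε hε
    obtain ⟨N, hN⟩ := hclose (ε / 2) (half_pos hε)
    obtain ⟨K, hK⟩ := eventually_atTop.1
      ((tendsto_coeff (u N)).eventually (eventually_lt_nhds (half_pos hε)))
    refine ⟨K, fun k hk => ?_⟩
    have hrk : 0 < r ^ k := pow_pos hr.out k
    rw [dist_zero_right, Real.norm_of_nonneg (by positivity)]
    have h1 : ‖a k‖ ≤ ‖coeff k (u N)‖ + ‖coeff k (u N) - a k‖ := by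
      simpa using norm_sub_le (coeff k (u N)) (coeff k (u N) - a k)
    calc _ ≤ (‖coeff k (u N)‖ + ‖coeff k (u N) - a k‖) * r ^ k := by gcongr
      _ < ε := by linarith [hK k hk, hN N le_rfl k]
  refine ⟨mk a hres, ?_⟩
  rw [Metric.tendsto_atTop]
  intro ε hε
  obtain ⟨N, hN⟩ := hclose (ε / 2) (half_pos hε)
  refine ⟨N, fun n hn => ?_⟩
  rw [dist_eq_norm]
  refine (norm_le fun k => ?_).trans_lt (half_lt_self hε)
  rw [map_sub, coeff_mk]
  exact hN n hn k

instance [NormOneClass A] : NormOneClass (RSeries A r) where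
  norm_one := by
    refine le_antisymm (norm_le fun k => ?_) ?_
    · rw [coeff_one]; split_ifs with h <;> simp [h]
    · simpa [coeff_one] using norm_coeff_le (1 : RSeries A r) 0

lemma norm_X_le [NormOneClass A] : ‖(X : RSeries A r)‖ ≤ r := by
  simpa [X] using norm_monomial_le (A := A) (r := r) 1 1

/-- Continuous algebra homomorphisms out of `K⟨X⟩` are determined by the image of `X`. -/
lemma hom_ext {𝕜 : Type*} [NontriviallyNormedField 𝕜] [IsUltrametricDist 𝕜]
    {R : Type*} [NormedCommRing R] [NormedAlgebra 𝕜 R]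
    {f g : RSeries 𝕜 r →A[𝕜] R} (h : f X = g X) : f = g := by
  ext F
  have hf := (hasSum_smul_X_pow F).map f f.continuous
  have hg := (hasSum_smul_X_pow F).map g g.continuous
  refine hf.unique (hg.congr_fun ?_)
  intro k
  simp [h]

end RSeries

/-! ### Evaluation of power series -/

section

variable {p : ℕ} [hp : Fact p.Prime] {C : Type*} [NormedCommRing C] [NormedAlgebra ℚ_[p] C]
  [IsUltrametricDist C]

/-- The product of the sums `∑ a_m • e m` and `∑ b_m • e m` over a monoid, for `e`
multiplicative. -/
lemma hasSum_mul_antidiagonal {M : Type*} [AddCommMonoid M] [Finset.HasAntidiagonal M] {e : M → C}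
    (he : ∀ m n, e (m + n) = e m * e n) {a b : M → ℚ_[p]} {x y : C}
    (ha : HasSum (fun m => a m • e m) x) (hb : HasSum (fun m => b m • e m) y) :
    HasSum (fun k => (∑ ij ∈ Finset.HasAntidiagonal.antidiagonal k, a ij.1 * b ij.2) • e k)
      (x * y) := by
  have : NonarchimedeanRing C := ⟨NonarchimedeanAddGroup.is_nonarchimedean⟩
  have h := ha.mul_of_nonarchimedean hb
  rw [← Finset.HasAntidiagonal.sigmaAntidiagonalEquivProd.hasSum_iff] at h
  refine h.sigma fun k => ?_
  rw [Finset.sum_smul, ← Finset.sum_coe_sort]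
  convert hasSum_fintype _ using 2 with ij
  obtain ⟨ij, hij⟩ := ij
  have := Finset.HasAntidiagonal.mem_antidiagonal.1 hij
  simp only [Function.comp_apply, Finset.HasAntidiagonal.sigmaAntidiagonalEquivProd_apply, ← this,
    he,
    smul_mul_smul_comm]

variable [CompleteSpace C]

lemma summable_smul_of_tendsto {M : Type*} {e : M → C} {w : M → ℝ} {K : ℝ}
    (hw : ∀ m, ‖e m‖ ≤ K * w m) {a : M → ℚ_[p]}
    (ha : Tendsto (fun m => ‖a m‖ * w m) cofinite (𝓝 0)) : Summable fun m => a m • e m := by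
  refine NonarchimedeanAddGroup.summable_of_tendsto_cofinite_zero
    (squeeze_zero_norm (a := fun m => K * (‖a m‖ * w m)) (fun m => ?_)
      (by simpa using ha.const_mul K))
  calc ‖a m • e m‖ ≤ ‖a m‖ * ‖e m‖ := norm_smul_le _ _
    _ ≤ ‖a m‖ * (K * w m) := by gcongr; exact hw m
    _ = _ := by ring

namespace RSeries

variable {r : ℝ}

lemma summable_eval {c : C} (hc : GrowthLE c r) (f : RSeries ℚ_[p] r) :
    Summable fun k => coeff k f • c ^ k := by
  obtain ⟨K, hK⟩ := hc
  refine summable_smul_of_tendsto hK ?_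
  rw [Nat.cofinite_eq_atTop]
  exact tendsto_coeff f

variable [hr : Fact (0 < r)]

/-- Evaluation of functions on the disc of radius `r` at an element `c` of that disc. -/
def eval (c : C) (hc : GrowthLE c r) : RSeries ℚ_[p] r →A[ℚ_[p]] C :=
  { AlgHom.ofLinearMap
      { toFun := fun f => ∑' k, coeff k f • c ^ k
        map_add' := fun f g => by
          rw [← (summable_eval hc f).tsum_add (summable_eval hc g)]
          simp only [map_add, add_smul]
        map_smul' := fun a f => by
          simp only [coeff_smul, RingHom.id_apply, smul_assoc]
          exact (summable_eval hc f).tsum_const_smul a }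
      (by
        change ∑' k, _ = _
        rw [tsum_eq_single 0 fun k hk => by simp [coeff_one, hk]]
        simp [coeff_one])
      (fun f g => by
        change ∑' k, _ = (∑' k, _) * ∑' k, _
        simp only [coeff_mul]
        exact (hasSum_mul_antidiagonal (fun m n => pow_add c m n) (summable_eval hc f).hasSum
          (summable_eval hc g).hasSum).tsum_eq) with
    cont := by
      obtain ⟨K, hK0, hK⟩ := hc.exists_nonneg
      refine (AddMonoidHomClass.lipschitz_of_bound (AlgHom.ofLinearMap _ _ _) K
        fun f => ?_).continuous
      refine IsUltrametricDist.norm_tsum_le_of_forall_le_of_nonneg (by positivity) fun k => ?_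
      calc ‖coeff k f • c ^ k‖ ≤ ‖coeff k f‖ * ‖c ^ k‖ := norm_smul_le _ _
        _ ≤ ‖coeff k f‖ * (K * r ^ k) := by gcongr; exact hK k
        _ = K * (‖coeff k f‖ * r ^ k) := by ring
        _ ≤ K * ‖f‖ := by gcongr; exact norm_coeff_le f k }

lemma hasSum_eval {c : C} (hc : GrowthLE c r) (f : RSeries ℚ_[p] r) :
    HasSum (fun k => coeff k f • c ^ k) (eval c hc f) := (summable_eval hc f).hasSum

@[simp] lemma eval_X {c : C} (hc : GrowthLE c r) : eval (p := p) c hc X = c := by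
  refine (hasSum_eval hc X).unique ?_
  convert hasSum_single (f := fun k => coeff k (X : RSeries ℚ_[p] r) • c ^ k) 1
    (fun k hk => by simp [X, coeff_monomial, hk]) using 1
  simp [X, coeff_monomial]

end RSeries

end

/-! ### Presentations of affinoid algebras -/

section

variable {p : ℕ} [hp : Fact p.Prime] {C : Type*} [NormedCommRing C] [NormedAlgebra ℚ_[p] C]

/-- Boundedness of a homomorphism for the Gauss norm of the Tate algebra. -/
def TateBounded {m : ℕ} (π : tateAlgebra p m →ₐ[ℚ_[p]] C) : Prop :=
  ∃ K : ℝ, ∀ (f : tateAlgebra p m) (M : ℝ),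
    (∀ i, ‖MvPowerSeries.coeff i (f : MvPowerSeries (Fin m) ℚ_[p])‖ ≤ M) → ‖π f‖ ≤ K * M

/-- A presentation as a quotient of a Tate algebra, as required of an affinoid algebra. -/
def HasPresentation (p : ℕ) [Fact p.Prime] (C : Type*) [NormedCommRing C] [NormedAlgebra ℚ_[p] C] :
    Prop :=
  ∃ (m : ℕ) (π : tateAlgebra p m →ₐ[ℚ_[p]] C), Function.Surjective π ∧ ∃ K : ℝ,
    ∀ (f : tateAlgebra p m) (M : ℝ),
    (∀ i, ‖MvPowerSeries.coeff i (f : MvPowerSeries (Fin m) ℚ_[p])‖ ≤ M) → ‖π f‖ ≤ K * M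

lemma tendsto_coeff_tateAlgebra {m : ℕ} (f : tateAlgebra p m) :
    Tendsto (fun n => ‖MvPowerSeries.coeff n (f : MvPowerSeries (Fin m) ℚ_[p])‖) cofinite
      (𝓝 0) := by
  have : MvPowerSeries.IsRestricted (fun _ => (1 : ℝ)) (f : MvPowerSeries (Fin m) ℚ_[p]) := f.2
  simpa [MvPowerSeries.IsRestricted, Finsupp.prod] using this

/-- The element of the Tate algebra with given coefficients. -/
def tateMk {m : ℕ} (a : (Fin m →₀ ℕ) → ℚ_[p]) (ha : Tendsto (fun n => ‖a n‖) cofinite (𝓝 0)) :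
    tateAlgebra p m :=
  ⟨(a : MvPowerSeries (Fin m) ℚ_[p]), by
    change MvPowerSeries.IsRestricted (fun _ => (1 : ℝ)) _
    simp only [MvPowerSeries.IsRestricted, Finsupp.prod, one_pow, Finset.prod_const_one, mul_one]
    exact ha⟩

lemma coeff_tateMk {m : ℕ} (a : (Fin m →₀ ℕ) → ℚ_[p]) (ha : Tendsto (fun n => ‖a n‖) cofinite (𝓝 0))
    (n : Fin m →₀ ℕ) :
    MvPowerSeries.coeff n (tateMk a ha : MvPowerSeries (Fin m) ℚ_[p]) = a n := rfl

/-- The monomials of the Tate algebra. -/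
def tateMonomial {m : ℕ} (n : Fin m →₀ ℕ) : tateAlgebra p m :=
  ⟨MvPowerSeries.monomial n 1, MvPowerSeries.isRestricted_monomial _ n 1⟩

lemma tateMonomial_add {m : ℕ} (n n' : Fin m →₀ ℕ) :
    (tateMonomial (n + n') : tateAlgebra p m) = tateMonomial n * tateMonomial n' :=
  Subtype.ext (by simp [tateMonomial, MvPowerSeries.monomial_mul_monomial])

lemma norm_coeff_tateMonomial_le {m : ℕ} (n i : Fin m →₀ ℕ) :
    ‖MvPowerSeries.coeff i ((tateMonomial n : tateAlgebra p m) : MvPowerSeries (Fin m) ℚ_[p])‖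
      ≤ 1 := by
  classical
  simp only [tateMonomial, MvPowerSeries.coeff_monomial]
  split_ifs <;> simp

/-- A bounded homomorphism of a Tate algebra is determined by the images of monomials. -/
lemma TateBounded.hasSum {m : ℕ} {π : tateAlgebra p m →ₐ[ℚ_[p]] C} (hπ : TateBounded π)
    (f : tateAlgebra p m) : HasSum (fun n =>
      MvPowerSeries.coeff n (f : MvPowerSeries (Fin m) ℚ_[p]) • π (tateMonomial n)) (π f) := by
  classical
  obtain ⟨K, hK⟩ := hπ
  rw [HasSum, Metric.tendsto_nhds]
  intro ε hε
  have hδ : 0 < ε / (2 * (|K| + 1)) := by positivity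
  have hfin := (tendsto_coeff_tateAlgebra f).eventually (eventually_lt_nhds hδ)
  rw [eventually_cofinite] at hfin
  rw [SummationFilter.unconditional_filter]
  filter_upwards [eventually_ge_atTop hfin.toFinset] with s hs
  rw [dist_comm, dist_eq_norm]
  have e : π f - ∑ n ∈ s,
      MvPowerSeries.coeff n (f : MvPowerSeries (Fin m) ℚ_[p]) • π (tateMonomial n)
      = π (f - ∑ n ∈ s,
        MvPowerSeries.coeff n (f : MvPowerSeries (Fin m) ℚ_[p]) • tateMonomial n) := by
    simp [map_sub, map_sum, map_smul]
  rw [e]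
  have h1 := hK (f - ∑ n ∈ s, MvPowerSeries.coeff n (f : MvPowerSeries (Fin m) ℚ_[p]) •
    tateMonomial n) (ε / (2 * (|K| + 1))) fun i => by
      have : MvPowerSeries.coeff i ((f - ∑ n ∈ s, MvPowerSeries.coeff n
          (f : MvPowerSeries (Fin m) ℚ_[p]) • tateMonomial n : tateAlgebra p m) :
            MvPowerSeries (Fin m) ℚ_[p]) =
          if i ∈ s then 0 else MvPowerSeries.coeff i (f : MvPowerSeries (Fin m) ℚ_[p]) := by
        simp only [AddSubgroupClass.coe_sub, AddSubmonoidClass.coe_finsetSum, map_sub, map_sum,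
          SetLike.val_smul, map_smul, tateMonomial, MvPowerSeries.coeff_monomial, smul_eq_mul]
        split_ifs with h <;> simp [h]
      rw [this]
      split_ifs with h
      · simpa using hδ.le
      · by_contra h'
        exact h (hs (by simpa using (not_le.1 h').le))
  refine h1.trans_lt ?_
  calc K * (ε / (2 * (|K| + 1))) ≤ |K| * (ε / (2 * (|K| + 1))) := by gcongr; exact le_abs_self K
    _ < (|K| + 1) * (2 * (ε / (2 * (|K| + 1)))) := by nlinarith [abs_nonneg K]
    _ = ε := by field_simp

lemma TateBounded.isPowerBounded {m : ℕ} {π : tateAlgebra p m →ₐ[ℚ_[p]] C} (hπ : TateBounded π) :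
    ∃ K : ℝ, ∀ n, ‖π (tateMonomial n)‖ ≤ K := by
  obtain ⟨K, hK⟩ := hπ
  exact ⟨K * 1, fun n => hK _ 1 (norm_coeff_tateMonomial_le n)⟩

variable [CompleteSpace C] [IsUltrametricDist C]

/-- Evaluation on the Tate algebra, along a bounded multiplicative family of monomials. -/
def tateEval {m : ℕ} (e : (Fin m →₀ ℕ) → C) (he0 : e 0 = 1) (he : ∀ n n', e (n + n') = e n * e n')
    (hb : ∃ K : ℝ, ∀ n, ‖e n‖ ≤ K) : tateAlgebra p m →ₐ[ℚ_[p]] C :=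
  have hs : ∀ f : tateAlgebra p m, Summable fun n =>
      MvPowerSeries.coeff n (f : MvPowerSeries (Fin m) ℚ_[p]) • e n := fun f => by
    obtain ⟨K, hK⟩ := hb
    exact summable_smul_of_tendsto (w := fun _ => 1) (K := K) (by simpa using hK)
      (by simpa using tendsto_coeff_tateAlgebra f)
  AlgHom.ofLinearMap
    { toFun := fun f => ∑' n, MvPowerSeries.coeff n (f : MvPowerSeries (Fin m) ℚ_[p]) • e n
      map_add' := fun f g => by
        rw [← (hs f).tsum_add (hs g)]
        simp only [Subalgebra.coe_add, map_add, add_smul]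
      map_smul' := fun a f => by
        simp only [RingHom.id_apply]
        rw [← (hs f).tsum_const_smul a]
        simp only [SetLike.val_smul, map_smul, smul_assoc] }
    (by
      classical
      change ∑' k, _ = _
      rw [tsum_eq_single 0 fun k hk => by simp [MvPowerSeries.coeff_one, hk]]
      simp [he0])
    (fun f g => by
      classical
      change ∑' k, _ = (∑' k, _) * ∑' k, _
      simp only [Subalgebra.coe_mul, MvPowerSeries.coeff_mul]
      exact (hasSum_mul_antidiagonal he (hs f).hasSum (hs g).hasSum).tsum_eq)

lemma tateEval_apply {m : ℕ} (e : (Fin m →₀ ℕ) → C) (he0 : e 0 = 1)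
    (he : ∀ n n', e (n + n') = e n * e n') (hb : ∃ K : ℝ, ∀ n, ‖e n‖ ≤ K) (f : tateAlgebra p m) :
    tateEval e he0 he hb f = ∑' n, MvPowerSeries.coeff n (f : MvPowerSeries (Fin m) ℚ_[p]) • e n :=
  rfl

lemma tateBounded_tateEval {m : ℕ} (e : (Fin m →₀ ℕ) → C) (he0 : e 0 = 1)
    (he : ∀ n n', e (n + n') = e n * e n') (hb : ∃ K : ℝ, ∀ n, ‖e n‖ ≤ K) :
    TateBounded (tateEval (p := p) e he0 he hb) := by
  obtain ⟨K, hK⟩ := id hb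
  refine ⟨K, fun f M hM => ?_⟩
  have hM0 : 0 ≤ M := (norm_nonneg _).trans (hM 0)
  have hK0 : 0 ≤ K := (norm_nonneg _).trans (hK 0)
  rw [tateEval_apply]
  refine IsUltrametricDist.norm_tsum_le_of_forall_le_of_nonneg (by positivity) fun n => ?_
  rw [mul_comm]
  exact (norm_smul_le _ _).trans (mul_le_mul (hM n) (hK n) (norm_nonneg _) hM0)

/-- A Banach algebra which is finite over the image of a Tate algebra, spanned by the powers of a
power-bounded element, is an affinoid algebra. -/
lemma TateBounded.hasPresentation {m : ℕ} {π : tateAlgebra p m →ₐ[ℚ_[p]] C} (hπ : TateBounded π)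
    {y : C} (hy : IsPowerBounded y) (N : ℕ)
    (h : ∀ c : C, ∃ g : ℕ → tateAlgebra p m, c = ∑ i ∈ Finset.range N, π (g i) * y ^ i) :
    HasPresentation p C := by
  classical
  obtain ⟨K, hK⟩ := hπ.isPowerBounded
  obtain ⟨D, hD⟩ := hy
  have hb : ∃ K : ℝ, ∀ n : Fin (m + 1) →₀ ℕ, ‖y ^ n 0 * π (tateMonomial n.tail)‖ ≤ K :=
    ⟨D * K, fun n => (norm_mul_le _ _).trans (mul_le_mul (hD _) (hK _) (norm_nonneg _)
      ((norm_nonneg _).trans (hD 0)))⟩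
  have h0 : (tateMonomial 0 : tateAlgebra p m) = 1 :=
    Subtype.ext (by simp [tateMonomial, MvPowerSeries.monomial_zero_one])
  let E := tateEval (p := p) (fun n : Fin (m + 1) →₀ ℕ => y ^ n 0 * π (tateMonomial n.tail))
    (by
      have : (0 : Fin (m + 1) →₀ ℕ).tail = 0 := by ext; simp [Finsupp.tail_apply]
      rw [this, h0]; simp)
    (fun n n' => by
      have : (n + n').tail = n.tail + n'.tail := by ext; simp [Finsupp.tail_apply]
      rw [this, tateMonomial_add, map_mul, Finsupp.add_apply, pow_add]
      ring) hb
  refine ⟨m + 1, E, fun c => ?_, tateBounded_tateEval _ _ _ hb⟩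
  have hcons : Function.Injective (fun n : Fin m →₀ ℕ => n.cons 0) := fun n n' hn => by
    simpa using congrArg Finsupp.tail hn
  have hinj : ∀ g : tateAlgebra p m, π g ∈ E.range := fun g => by
    refine ⟨tateMk (fun n => if n 0 = 0 then
      MvPowerSeries.coeff n.tail (g : MvPowerSeries (Fin m) ℚ_[p]) else 0) ?_, ?_⟩
    · rw [tendsto_order]
      refine ⟨fun a ha => Eventually.of_forall fun n => ha.trans_le (norm_nonneg _), fun a ha => ?_⟩
      have := (tendsto_coeff_tateAlgebra g).eventually (eventually_lt_nhds ha)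
      rw [eventually_cofinite] at this ⊢
      refine (this.image fun n => n.cons 0).subset fun n hn => ?_
      simp only [Set.mem_ofPred_eq] at hn
      split_ifs at hn with h
      · refine ⟨n.tail, hn, ?_⟩
        have := Finsupp.cons_tail n
        rwa [h] at this
      · simp [ha] at hn
    · change tateEval _ _ _ _ _ = _
      rw [tateEval_apply]
      refine HasSum.tsum_eq ?_
      rw [← hcons.hasSum_iff]
      · refine (hπ.hasSum g).congr_fun fun n => ?_
        simp [coeff_tateMk]
      · intro n hn
        rw [coeff_tateMk, if_neg, zero_smul]
        intro h
        refine hn ⟨n.tail, ?_⟩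
        have := Finsupp.cons_tail n
        rwa [h] at this
  have hyE : y ∈ E.range := by
    refine ⟨tateMonomial (Finsupp.single 0 1), ?_⟩
    change tateEval _ _ _ _ _ = _
    rw [tateEval_apply, tsum_eq_single (Finsupp.single 0 1)]
    · have : (Finsupp.single (0 : Fin (m + 1)) 1).tail = 0 := by ext i; simp [Finsupp.tail_apply]
      simp [tateMonomial, this]
      rw [show (⟨1, _⟩ : tateAlgebra p m) = 1 from rfl]
      simp
    · intro n hn
      simp [tateMonomial, MvPowerSeries.coeff_monomial, hn]
  obtain ⟨g, rfl⟩ := h c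
  exact sum_mem fun i _ => mul_mem (hinj _) (pow_mem hyE i)

end

/-! ### Disc algebras and root extensions are affinoid -/

/-- A convergent series is the sum of its subseries over the residue classes modulo `N`. -/
lemma eq_sum_residue_classes {C : Type*} [NormedAddCommGroup C] {u : ℕ → C} {F : C}
    (hu : HasSum u F) {N : ℕ} (hN : 0 < N) {v : ℕ → C}
    (hv : ∀ i < N, HasSum (fun k => u (N * k + i)) (v i)) : F = ∑ i ∈ Finset.range N, v i := by
  have : NeZero N := ⟨hN.ne'⟩
  have h1 : HasSum (fun k => ∑ i ∈ Finset.range N, u (N * k + i)) (∑ i ∈ Finset.range N, v i) :=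
    hasSum_sum fun i hi => hv i (Finset.mem_range.1 hi)
  refine (((Nat.divModEquiv N).symm.hasSum_iff.2 hu).prod_fiberwise
    fun k => hasSum_fintype _).unique (h1.congr_fun fun k => ?_)
  rw [Finset.sum_range]
  refine Finset.sum_congr rfl fun i _ => ?_
  simp [Nat.divModEquiv, mul_comm]

lemma tendsto_mul_add_atTop {N : ℕ} (hN : 0 < N) (i : ℕ) :
    Tendsto (fun k : ℕ => N * k + i) atTop atTop :=
  tendsto_atTop_mono
    (fun k => (Nat.le_mul_of_pos_left k hN).trans (Nat.le_add_right _ _)) tendsto_id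

section

variable {p : ℕ} [hp : Fact p.Prime] {r : ℝ} [hr : Fact (0 < r)]

lemma exists_smul_X_isPowerBounded :
    ∃ c : ℚ_[p], c ≠ 0 ∧ IsPowerBounded (c • (RSeries.X : RSeries ℚ_[p] r)) := by
  obtain ⟨n, hn⟩ := exists_pow_lt_of_lt_one (inv_pos.2 hr.out)
    (show (p : ℝ)⁻¹ < 1 from inv_lt_one_of_one_lt₀ (by exact_mod_cast hp.out.one_lt))
  refine ⟨(p : ℚ_[p]) ^ n, pow_ne_zero _ (by exact_mod_cast hp.out.ne_zero), ?_⟩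
  refine growthLE_one_iff.1 (.of_norm_le ((norm_smul_le _ _).trans ?_))
  rw [norm_pow, Padic.norm_p]
  calc _ ≤ r⁻¹ * r := by
        exact mul_le_mul hn.le RSeries.norm_X_le (norm_nonneg _) (inv_nonneg.2 hr.out.le)
    _ = 1 := inv_mul_cancel₀ hr.out.ne'

/-- The disc of radius `r` is affinoid if a power of `r` is the absolute value of a scalar: with
`‖d‖ * r ^ N = 1`, its ring of functions is spanned by the `X ^ i`, `i < N`, over the image of the
Tate algebra in the variable `d • X ^ N`. -/
lemma RSeries.hasPresentation (hd : ∃ (N : ℕ) (d : ℚ_[p]), 0 < N ∧ ‖d‖ * r ^ N = 1) :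
    HasPresentation p (RSeries ℚ_[p] r) := by
  obtain ⟨N, d, hN, hd⟩ := hd
  have hd0 : d ≠ 0 := by rintro rfl; simp at hd
  obtain ⟨c, hc0, hc⟩ := exists_smul_X_isPowerBounded (p := p) (r := r)
  have hb : ∃ K : ℝ, ∀ n : Fin 1 →₀ ℕ, ‖(d • (RSeries.X : RSeries ℚ_[p] r) ^ N) ^ n 0‖ ≤ K := by
    have h1 : ‖d • (RSeries.X : RSeries ℚ_[p] r) ^ N‖ ≤ 1 := by
      rw [RSeries.X_pow]
      refine (norm_smul_le _ _).trans (le_trans ?_ hd.le)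
      gcongr
      simpa using RSeries.norm_monomial_le (r := r) N (1 : ℚ_[p])
    exact ⟨1, fun n => (norm_pow_le _ _).trans (pow_le_one₀ (norm_nonneg _) h1)⟩
  refine (tateBounded_tateEval _ (by simp) (fun n n' => by simp [pow_add]) hb).hasPresentation hc N
    fun F => ?_
  have hinj : Function.Injective fun n : Fin 1 →₀ ℕ => n 0 := fun n n' h => Finsupp.ext fun i => by
    rw [Subsingleton.elim i 0]; exact h
  have hsurj : Function.Surjective fun n : Fin 1 →₀ ℕ => n 0 := fun k =>
    ⟨Finsupp.single 0 k, by simp⟩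
  have ha : ∀ i, Tendsto (fun n : Fin 1 →₀ ℕ =>
      ‖F.coeff (N * n 0 + i) * (d⁻¹) ^ n 0 * (c⁻¹) ^ i‖) cofinite (𝓝 0) := fun i => by
    have h1 : Tendsto (fun k : ℕ => ‖F.coeff (N * k + i) * (d⁻¹) ^ k * (c⁻¹) ^ i‖) atTop (𝓝 0) := by
      have h2 := tendsto_mul_add_atTop hN i
      have h3 := ((RSeries.tendsto_coeff F).comp h2).mul_const ((r ^ i)⁻¹ * ‖c⁻¹‖ ^ i)
      rw [zero_mul] at h3
      refine h3.congr fun k => ?_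
      have h4 : ‖d⁻¹‖ = r ^ N := by rw [norm_inv]; exact (eq_inv_of_mul_eq_one_right hd).symm
      have := hr.out.ne'
      rw [norm_mul, norm_mul, norm_pow, norm_pow, h4, Function.comp_apply, pow_add, pow_mul]
      field_simp
    rw [← Nat.cofinite_eq_atTop] at h1
    exact h1.comp hinj.tendsto_cofinite
  refine ⟨fun i => tateMk _ (ha i), eq_sum_residue_classes (RSeries.hasSum_smul_X_pow F) hN
    fun i hi => ?_⟩
  have h1 := ((tateBounded_tateEval (p := p) (fun n : Fin 1 →₀ ℕ =>
    (d • (RSeries.X : RSeries ℚ_[p] r) ^ N) ^ n 0) (by simp) (fun n n' => by simp [pow_add])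
    hb).hasSum (tateMk _ (ha i))).mul_right ((c • (RSeries.X : RSeries ℚ_[p] r)) ^ i)
  refine (Function.Injective.hasSum_iff hinj (fun k hk => (hk (hsurj k)).elim)).1
    (h1.congr_fun fun n => ?_)
  rw [coeff_tateMk, tateEval_apply, tsum_eq_single n
    (fun n' hn' => by simp [tateMonomial, MvPowerSeries.coeff_monomial, hn'])]
  simp only [tateMonomial, MvPowerSeries.coeff_monomial_same, one_smul, Function.comp_apply]
  have e : (d⁻¹ ^ n 0 * d ^ n 0) * (c⁻¹ ^ i * c ^ i) = 1 := by
    rw [← mul_pow, ← mul_pow, inv_mul_cancel₀ hd0, inv_mul_cancel₀ hc0, one_pow, one_pow, mul_one]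
  simp only [smul_pow, ← pow_mul, smul_mul_assoc, mul_smul_comm, smul_smul, ← pow_add]
  congr 1
  linear_combination (-F.coeff (N * n 0 + i)) * e

/-- The affinoid algebra of functions on the disc of radius `r`. -/
def discAlgebra (p : ℕ) [Fact p.Prime] (r : ℝ) [Fact (0 < r)]
    (hd : ∃ (N : ℕ) (d : ℚ_[p]), 0 < N ∧ ‖d‖ * r ^ N = 1) : AffinoidAlgebra p where
  carrier := RSeries ℚ_[p] r
  exists_presentation := RSeries.hasPresentation hd

end

section

/-- The quotient of a Banach algebra by a closed ideal, with the quotient norm. -/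
def ClosedQuotient {A : Type*} [NormedCommRing A] (J : Ideal A) : Type _ := A ⧸ J

namespace ClosedQuotient

variable {𝕜 : Type*} [NormedField 𝕜] {A : Type*} [NormedCommRing A] [NormedAlgebra 𝕜 A]
  (J : Ideal A) [IsClosed (J : Set A)]

instance : NormedCommRing (ClosedQuotient J) := inferInstanceAs (NormedCommRing (A ⧸ J))

instance : NormedAlgebra 𝕜 (ClosedQuotient J) := inferInstanceAs (NormedAlgebra 𝕜 (A ⧸ J))

instance [CompleteSpace A] : CompleteSpace (ClosedQuotient J) :=
  inferInstanceAs (CompleteSpace (A ⧸ J))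

/-- The quotient homomorphism. -/
def mk : A →A[𝕜] ClosedQuotient J where
  toFun a := (Ideal.Quotient.mk J a : A ⧸ J)
  map_one' := rfl
  map_mul' _ _ := rfl
  map_zero' := rfl
  map_add' _ _ := rfl
  commutes' _ := rfl
  cont := (LipschitzWith.of_dist_le_mul (K := 1) fun a b => by
    rw [dist_eq_norm a b, NNReal.coe_one, one_mul]
    exact (dist_eq_norm (E := ClosedQuotient J) _ _).trans_le
      (Ideal.Quotient.norm_mk_le J (a - b))).continuous

variable {J}

lemma mk_surjective : Function.Surjective (mk (𝕜 := 𝕜) J) := Ideal.Quotient.mk_surjective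

lemma mk_eq_mk_iff {a b : A} : mk (𝕜 := 𝕜) J a = mk (𝕜 := 𝕜) J b ↔ a - b ∈ J :=
  Ideal.Quotient.eq

lemma isField (hJ : J.IsMaximal) : IsField (ClosedQuotient J) := (Ideal.Quotient.field J).toIsField

instance [IsUltrametricDist A] : IsUltrametricDist (ClosedQuotient J) :=
  IsUltrametricDist.isUltrametricDist_of_forall_norm_add_le_max_norm fun x y => by
    refine le_of_forall_pos_le_add fun ε hε => ?_
    obtain ⟨a, rfl, ha⟩ := Ideal.Quotient.norm_mk_lt (I := J) x hε
    obtain ⟨b, rfl, hb⟩ := Ideal.Quotient.norm_mk_lt (I := J) y hε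
    rw [← max_add_add_right]
    exact (Ideal.Quotient.norm_mk_le J (a + b)).trans ((IsUltrametricDist.norm_add_le_max _ _).trans
      (max_le_max ha.le hb.le))

end ClosedQuotient

variable {p : ℕ} [hp : Fact p.Prime] {A : AffinoidAlgebra p}

/-- The constants in the ring of functions on the unit disc over `A`. -/
def constHom (A : AffinoidAlgebra p) : A →A[ℚ_[p]] RSeries A 1 :=
  { IsScalarTower.toAlgHom ℚ_[p] A (RSeries A 1) with
    cont := (AddMonoidHomClass.lipschitz_of_bound
      (IsScalarTower.toAlgHom ℚ_[p] A (RSeries A 1)) 1 fun a => by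
        have : algebraMap A (RSeries A 1) a = RSeries.monomial 0 a := by
          rw [RSeries.monomial_eq_smul, Algebra.smul_def]; simp
        simpa [this] using RSeries.norm_monomial_le (r := 1) 0 a).continuous }

lemma constHom_apply (a : A) : constHom A a = algebraMap A (RSeries A 1) a := rfl

lemma isPowerBounded_X {A : Type*} [NormedCommRing A] [IsUltrametricDist A] :
    IsPowerBounded (RSeries.X : RSeries A 1) :=
  ⟨‖(1 : A)‖, fun n => by
    rw [RSeries.X_pow]; simpa using RSeries.norm_monomial_le (r := 1) n (1 : A)⟩

variable {w : A} {N : ℕ} {J : Ideal (RSeries A 1)}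

/-- The quotient homomorphism `A⟨X⟩ → A⟨X⟩ / J` by a closed ideal. -/
def quotientHom (J : Ideal (RSeries A 1)) [IsClosed (J : Set (RSeries A 1))] :
    RSeries A 1 →A[ℚ_[p]] ClosedQuotient J := ClosedQuotient.mk J

/-- Adjoining a root of `X ^ N = w` for a power-bounded `w` preserves affinoid algebras. -/
lemma hasPresentation_quotient [IsClosed (J : Set (RSeries A 1))] (hN : 0 < N)
    (hw : IsPowerBounded w) (hJ : RSeries.X ^ N - algebraMap A (RSeries A 1) w ∈ J) :
    HasPresentation p (ClosedQuotient J) := by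
  obtain ⟨m, π, hπs, K, hK⟩ := A.exists_presentation
  obtain ⟨D, hD0, hD⟩ := hw.exists_nonneg
  let φ : A →A[ℚ_[p]] ClosedQuotient J := (quotientHom J).comp (constHom A)
  have hφ : ∀ a : A, φ a = quotientHom J (algebraMap A (RSeries A 1) a) := fun a => rfl
  let E : tateAlgebra p m →ₐ[ℚ_[p]] ClosedQuotient J := (φ : A →ₐ[ℚ_[p]] ClosedQuotient J).comp π
  have hE : TateBounded E := by
    obtain ⟨M, hM0, hM⟩ := φ.toContinuousLinearMap.isBoundedLinearMap.bound
    refine ⟨M * K, fun f B hB => ?_⟩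
    rw [mul_assoc]
    exact (hM _).trans (mul_le_mul_of_nonneg_left (hK f B hB) hM0.le)
  have hy : IsPowerBounded (quotientHom J RSeries.X) :=
    growthLE_one_iff.1 ((growthLE_one_iff.2 isPowerBounded_X).map (quotientHom J))
  refine hE.hasPresentation hy N fun c => ?_
  obtain ⟨F, rfl⟩ := ClosedQuotient.mk_surjective (𝕜 := ℚ_[p]) c
  have hs : ∀ i, Summable fun k => F.coeff (N * k + i) * w ^ k := fun i => by
    refine NonarchimedeanAddGroup.summable_of_tendsto_cofinite_zero ?_
    rw [Nat.cofinite_eq_atTop]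
    refine squeeze_zero_norm (a := fun k => ‖F.coeff (N * k + i)‖ * D) (fun k =>
      (norm_mul_le _ _).trans (mul_le_mul_of_nonneg_left (hD k) (norm_nonneg _))) ?_
    have h2 := tendsto_mul_add_atTop hN i
    simpa using ((RSeries.tendsto_coeff F).comp h2).mul_const D
  choose g hg using fun i => hπs (∑' k, F.coeff (N * k + i) * w ^ k)
  refine ⟨g, eq_sum_residue_classes
    ((RSeries.hasSum_smul_X_pow F).map (quotientHom J) (quotientHom J).continuous) hN
    fun i hi => ?_⟩
  have h1 : HasSum (fun k => φ (F.coeff (N * k + i) * w ^ k)) (E (g i)) := by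
    change HasSum _ (φ (π (g i)))
    rw [hg]
    exact (hs i).hasSum.map φ φ.continuous
  refine (h1.mul_right (quotientHom J RSeries.X ^ i)).congr_fun fun k => ?_
  have hX : quotientHom J (RSeries.X ^ N) = quotientHom J (algebraMap A (RSeries A 1) w) :=
    ClosedQuotient.mk_eq_mk_iff.2 hJ
  simp only [Function.comp_apply, hφ, Algebra.smul_def, map_mul, map_pow,
    pow_add, pow_mul] at hX ⊢
  rw [hX, mul_assoc]

/-- The quotient `A⟨X⟩ / J` by a closed ideal containing `X ^ N - w`, as an affinoid algebra. -/
def quotientAlgebra (J : Ideal (RSeries A 1)) [IsClosed (J : Set (RSeries A 1))] (hN : 0 < N)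
    (hw : IsPowerBounded w) (hJ : RSeries.X ^ N - algebraMap A (RSeries A 1) w ∈ J) :
    AffinoidAlgebra p where
  carrier := ClosedQuotient J
  exists_presentation := hasPresentation_quotient hN hw hJ

/-- Over an affinoid field, a root of a power-bounded element `w` exists after a finite
extension, in which it is power-bounded. -/
lemma exists_root {L : AffinoidAlgebra p} (hL : IsField L) {w : L} (hw : IsPowerBounded w)
    (hN : 0 < N) : ∃ (L' : AffinoidAlgebra p) (f : L ⟶ L') (y : L'), IsField L' ∧
      IsPowerBounded y ∧ y ^ N = f w := by
  have : Nontrivial L := hL.nontrivial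
  obtain ⟨D, hD0, hD⟩ := hw.exists_nonneg
  set F : RSeries L 1 := RSeries.X ^ N - algebraMap L (RSeries L 1) w with hF
  have hnu : ¬ IsUnit F := by
    rintro hu
    obtain ⟨G, hG⟩ := hu.exists_right_inv
    have hc : ∀ k, RSeries.coeff k (F * G) =
        (if N ≤ k then G.coeff (k - N) else 0) - w * G.coeff k := fun k => by
      rw [hF, sub_mul, map_sub, ← Algebra.smul_def, RSeries.coeff_smul, smul_eq_mul]
      congr 1
      rw [RSeries.coeff_def, map_mul, map_pow, RSeries.toPowerSeries_X,
        PowerSeries.coeff_X_pow_mul']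
      rfl
    -- the recursion forces `w ^ (k + 1) * b_{N k} = -1`, although `b_{N k} → 0`
    have hrec : ∀ k, w ^ (k + 1) * G.coeff (N * k) = -1 := fun k => by
      induction k with
      | zero =>
        have := hc 0
        rw [hG, RSeries.coeff_one, if_pos rfl, if_neg (by omega)] at this
        simp only [mul_zero, zero_add, pow_one]
        linear_combination this
      | succ k ih =>
        have := hc (N * (k + 1))
        rw [hG, RSeries.coeff_one, if_neg (by positivity), if_pos (by nlinarith),
          show N * (k + 1) - N = N * k by rw [mul_add, mul_one, Nat.add_sub_cancel]] at this
        rw [pow_succ, ← ih]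
        linear_combination w ^ (k + 1) * this
    have h2 := tendsto_mul_add_atTop hN 0
    have h3 : Tendsto (fun k => D * ‖G.coeff (N * k)‖) atTop (𝓝 0) := by
      simpa using ((RSeries.tendsto_coeff G).comp h2).const_mul D
    have h4 : Tendsto (fun k => w ^ (k + 1) * G.coeff (N * k)) atTop (𝓝 0) :=
      squeeze_zero_norm (fun k => (norm_mul_le _ _).trans
        (mul_le_mul_of_nonneg_right (hD _) (norm_nonneg _))) h3
    simp only [hrec] at h4
    exact neg_ne_zero.2 one_ne_zero (tendsto_nhds_unique tendsto_const_nhds h4)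
  obtain ⟨J, hJ, hFJ⟩ := exists_max_ideal_of_mem_nonunits hnu
  have hJc : IsClosed (J : Set (RSeries L 1)) := Ideal.IsMaximal.isClosed
  let φ : L →A[ℚ_[p]] ClosedQuotient J := (quotientHom J).comp (constHom L)
  refine ⟨quotientAlgebra J hN hw hFJ, φ, quotientHom J RSeries.X,
    ClosedQuotient.isField hJ, ?_, ?_⟩
  · exact growthLE_one_iff.1 ((growthLE_one_iff.2 isPowerBounded_X).map (p := p) (quotientHom J))
  · exact (map_pow (quotientHom J) _ _).symm.trans (ClosedQuotient.mk_eq_mk_iff.2 hFJ)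

end

/-! ### The radii -/

section

variable (p : ℕ) [hp : Fact p.Prime]

lemma one_lt_prime_real : (1 : ℝ) < p := by exact_mod_cast hp.out.one_lt

lemma prime_real_pos : (0 : ℝ) < p := zero_lt_one.trans (one_lt_prime_real p)

instance fact_discRadius_pos (n : ℕ) : Fact (0 < discRadius p n) := ⟨discRadius_pos p n⟩

lemma discRadius_succ_pow (n : ℕ) : discRadius p (n + 1) ^ p = discRadius p n := by
  have h0 := prime_real_pos p
  have h1 : (p : ℝ) - 1 ≠ 0 := by linarith [one_lt_prime_real p]
  rw [discRadius, discRadius, ← Real.rpow_natCast, ← Real.rpow_mul h0.le]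
  congr 1
  rw [Nat.cast_succ, add_sub_cancel_right, zpow_sub_one₀ h0.ne', zpow_natCast]
  field_simp

lemma discRadius_pow_pow (m n : ℕ) : discRadius p (m + n) ^ p ^ n = discRadius p m := by
  induction n with
  | zero => simp
  | succ n ih => rw [pow_succ', pow_mul, ← add_assoc, discRadius_succ_pow, ih]

lemma discRadius_mono {m n : ℕ} (h : m ≤ n) : discRadius p m ≤ discRadius p n :=
  monotone_nat_of_le_succ (discRadius_le_succ p) h

lemma discRadius_one_pow : discRadius p 1 ^ (p - 1) = (p : ℝ)⁻¹ := by
  have h0 := prime_real_pos p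
  have h1 : (p : ℝ) - 1 ≠ 0 := by linarith [one_lt_prime_real p]
  rw [discRadius, ← Real.rpow_natCast, ← Real.rpow_mul h0.le, Nat.cast_sub hp.out.one_lt.le,
    ← Real.rpow_neg_one]
  congr 1
  simp
  field_simp

lemma inv_le_discRadius_succ_pow (n : ℕ) : (p : ℝ)⁻¹ ≤ discRadius p (n + 1) ^ (p - 1) := by
  rw [← discRadius_one_pow]
  exact pow_le_pow_left₀ (discRadius_pos p 1).le (discRadius_mono p (by omega)) _

lemma discRadius_lt_one (n : ℕ) : discRadius p n < 1 := by
  refine Real.rpow_lt_one_of_one_lt_of_neg (one_lt_prime_real p) ?_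
  have h1 : 0 < (p : ℝ) - 1 := by linarith [one_lt_prime_real p]
  have h2 : (0 : ℝ) < (p : ℝ) ^ ((n : ℤ) - 1) := zpow_pos (prime_real_pos p) _
  have : 0 < 1 / ((p : ℝ) ^ ((n : ℤ) - 1) * ((p : ℝ) - 1)) := by positivity
  linarith

lemma discRadius_zero_pow : discRadius p 0 ^ (p - 1) = ((p : ℝ) ^ p)⁻¹ := by
  rw [← discRadius_succ_pow p 0, ← pow_mul, mul_comm, pow_mul, zero_add, discRadius_one_pow,
    inv_pow]

lemma discRadius_zero_le : discRadius p 0 ≤ (p : ℝ)⁻¹ := by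
  have h0 := prime_real_pos p
  refine le_of_pow_le_pow_left₀ (Nat.sub_ne_zero_of_lt hp.out.one_lt) (by positivity)
    ((discRadius_zero_pow p).trans_le ?_)
  rw [inv_pow]
  exact inv_anti₀ (by positivity)
    (pow_le_pow_right₀ (one_lt_prime_real p).le (Nat.sub_le p 1))

lemma inv_mul_discRadius_succ_le (n : ℕ) : (p : ℝ)⁻¹ * discRadius p (n + 1) ≤ discRadius p n := by
  rw [← discRadius_succ_pow p n, ← pow_sub_one_mul hp.out.ne_zero]
  exact mul_le_mul_of_nonneg_right (inv_le_discRadius_succ_pow p n) (discRadius_pos p _).le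

/-- The radius `p ^ (n - 1 / (p - 1))` of the disc `X_n`. -/
def quotRadius (n : ℕ) : ℝ := (p : ℝ) ^ ((n : ℝ) - 1 / ((p : ℝ) - 1))

lemma quotRadius_eq (n : ℕ) : quotRadius p n = (p : ℝ) ^ n * (p * discRadius p 0) := by
  have h0 := prime_real_pos p
  have h1 : (p : ℝ) - 1 ≠ 0 := by linarith [one_lt_prime_real p]
  rw [quotRadius, discRadius, ← Real.rpow_natCast]
  nth_rw 4 [← Real.rpow_one p]
  rw [← Real.rpow_add h0, ← Real.rpow_add h0]
  congr 1
  simp [zpow_neg]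
  field_simp
  ring

lemma quotRadius_pos (n : ℕ) : 0 < quotRadius p n := Real.rpow_pos_of_pos (prime_real_pos p) _

instance fact_quotRadius_pos (n : ℕ) : Fact (0 < quotRadius p n) := ⟨quotRadius_pos p n⟩

lemma quotRadius_pow (n : ℕ) :
    ∃ (N : ℕ) (d : ℚ_[p]), 0 < N ∧ ‖d‖ * quotRadius p n ^ N = 1 := by
  obtain ⟨N, d, hN, hd⟩ := discRadius_pow p 0
  refine ⟨N, (p : ℚ_[p]) ^ ((n + 1) * N) * d, hN, ?_⟩
  have h0 := prime_real_pos p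
  rw [quotRadius_eq, norm_mul, norm_pow, Padic.norm_p, ← mul_assoc, ← pow_succ, mul_pow, ← pow_mul,
    mul_mul_mul_comm, hd, mul_one, inv_pow, inv_mul_cancel₀ (by positivity)]

lemma exists_le_quotRadius (B : ℝ) : ∃ n, B ≤ quotRadius p n := by
  have h0 := prime_real_pos p
  have h1 := discRadius_pos p 0
  obtain ⟨n, hn⟩ := pow_unbounded_of_one_lt (B / (p * discRadius p 0)) (one_lt_prime_real p)
  refine ⟨n, ?_⟩
  rw [quotRadius_eq]
  exact ((div_lt_iff₀ (by positivity)).1 hn).le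

end

/-! ### Raising to the power `p` -/

lemma norm_aeval_int_le {A : Type*} [NormedCommRing A] [IsUltrametricDist A] [NormOneClass A]
    {t : A} (ht : ‖t‖ ≤ 1) (P : Polynomial ℤ) :
    ‖Polynomial.aeval t P‖ ≤ 1 := by
  rw [Polynomial.aeval_eq_sum_range]
  refine IsUltrametricDist.norm_sum_le_of_forall_le_of_nonneg zero_le_one fun i _ => ?_
  exact (IsUltrametricDist.norm_zsmul_le _ _).trans
    ((norm_pow_le _ _).trans (pow_le_one₀ (norm_nonneg _) ht))

section

variable {p : ℕ} [hp : Fact p.Prime] {A : Type*} [NormedCommRing A] [NormedAlgebra ℚ_[p] A]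

lemma GrowthLE.prime_mul {a : A} {r : ℝ} (ha : GrowthLE a r) :
    GrowthLE ((p : A) * a) ((p : ℝ)⁻¹ * r) := by
  have := ha.smul (p := p) (p : ℚ_[p])
  rwa [Algebra.smul_def, map_natCast, Padic.norm_p] at this

variable [IsUltrametricDist A]

lemma growthLE_pow_prime_sub_one {x : A} {n : ℕ} (h : GrowthLE (x - 1) (discRadius p (n + 1))) :
    GrowthLE (x ^ p - 1) (discRadius p n) := by
  obtain ⟨P, hP⟩ := exists_one_add_pow_prime.{_} p
  have h0 := discRadius_pos p (n + 1)
  have e : x ^ p - 1 = (x - 1) ^ p + p * ((x - 1) * Polynomial.aeval (x - 1) P) := by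
    have := hP (x - 1)
    rw [add_sub_cancel] at this
    rw [this]; ring
  rw [e]
  refine GrowthLE.add (discRadius_pos p n).le ?_ ?_
  · rw [← discRadius_succ_pow p n]
    exact h.pow p
  · have h1 := (h.mul ((h.mono h0.le (discRadius_lt_one p _).le).aeval P)).prime_mul (p := p)
    rw [mul_one] at h1
    have := prime_real_pos p
    exact h1.mono (by positivity) (inv_mul_discRadius_succ_le p n)

/-- `x ↦ x ^ p ^ n` maps the disc of level `m + n` about `1` to the disc of level `m`. -/
lemma growthLE_pow_prime_pow_sub_one {x : A} {m n : ℕ}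
    (h : GrowthLE (x - 1) (discRadius p (m + n))) :
    GrowthLE (x ^ p ^ n - 1) (discRadius p m) := by
  induction n generalizing x with
  | zero => simpa using h
  | succ n ih => rw [pow_succ', pow_mul]; exact ih (growthLE_pow_prime_sub_one h)

/-- Conversely, a power-bounded `x` with `x ^ p ^ n` in the disc of level `m` about `1` lies in the
disc of level `m + n`. -/
lemma GrowthLE.sub_one_of_pow_prime_pow {x : A} {m n : ℕ} (hx : GrowthLE x 1)
    (h : GrowthLE (x ^ p ^ n - 1) (discRadius p m)) : GrowthLE (x - 1) (discRadius p (m + n)) := by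
  induction n generalizing x with
  | zero => simpa using h
  | succ n ih =>
    rw [pow_succ', pow_mul] at h
    refine hx.sub_one_of_pow_prime (p := p) (discRadius_pos p _) (inv_le_discRadius_succ_pow p _) ?_
    rw [← add_assoc, discRadius_succ_pow]
    exact ih (by simpa using hx.pow p) h

lemma norm_pow_prime_sub_one_le [NormOneClass A] {x : A} {n : ℕ}
    (h : ‖x - 1‖ ≤ discRadius p (n + 1)) : ‖x ^ p - 1‖ ≤ discRadius p n := by
  obtain ⟨P, hP⟩ := exists_one_add_pow_prime.{_} p
  have h0 := prime_real_pos p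
  have e : x ^ p - 1 = (x - 1) ^ p + p * ((x - 1) * Polynomial.aeval (x - 1) P) := by
    have := hP (x - 1)
    rw [add_sub_cancel] at this
    rw [this]; ring
  rw [e]
  refine (IsUltrametricDist.norm_add_le_max _ _).trans (max_le ?_ ?_)
  · rw [← discRadius_succ_pow p n]
    exact (norm_pow_le _ _).trans (pow_le_pow_left₀ (norm_nonneg _) h p)
  · refine (norm_prime_mul_le (p := p) _).trans (le_trans ?_ (inv_mul_discRadius_succ_le p n))
    gcongr
    refine (norm_mul_le _ _).trans (mul_le_of_le_one_right (norm_nonneg _) ?_ |>.trans h)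
    exact norm_aeval_int_le (h.trans (discRadius_lt_one p _).le) P

lemma norm_pow_prime_pow_sub_one_le [NormOneClass A] {x : A} {m n : ℕ}
    (h : ‖x - 1‖ ≤ discRadius p (m + n)) : ‖x ^ p ^ n - 1‖ ≤ discRadius p m := by
  induction n generalizing x with
  | zero => simpa using h
  | succ n ih => rw [pow_succ', pow_mul]; exact ih (norm_pow_prime_sub_one_le h)

end

/-! ### The logarithm -/

section

variable {p : ℕ} [hp : Fact p.Prime]

lemma norm_natCast_eq_pow {n : ℕ} (hn : n ≠ 0) :
    ‖(n : ℚ_[p])‖ = ((p : ℝ) ^ padicValNat p n)⁻¹ := by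
  rw [Padic.norm_eq_zpow_neg_valuation (by exact_mod_cast hn), Padic.valuation_natCast, zpow_neg,
    zpow_natCast]

lemma norm_natCast_le_one (n : ℕ) : ‖(n : ℚ_[p])‖ ≤ 1 := by
  simpa using Padic.norm_int_le_one (p := p) n

lemma norm_inv_succ_le (k : ℕ) : ‖((k : ℚ_[p]) + 1)⁻¹‖ ≤ (k : ℝ) + 1 := by
  have := norm_natCast_eq_pow (p := p) k.succ_ne_zero
  rw [Nat.cast_succ] at this
  rw [norm_inv, this, inv_inv]
  exact_mod_cast Nat.le_of_dvd k.succ_pos pow_padicValNat_dvd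

lemma norm_neg_one_pow_div (k : ℕ) : ‖((-1) ^ k / ((k : ℚ_[p]) + 1))‖ = ‖((k : ℚ_[p]) + 1)⁻¹‖ := by
  rw [div_eq_mul_inv, norm_mul, norm_pow, norm_neg, norm_one, one_pow, one_mul]

lemma tendsto_norm_prime_pow : Tendsto (fun n : ℕ => ((p : ℝ) ^ n)⁻¹) atTop (𝓝 0) := by
  simpa using tendsto_pow_atTop_nhds_zero_of_lt_one (inv_nonneg.2 (prime_real_pos p).le)
    (inv_lt_one_of_one_lt₀ (one_lt_prime_real p))

lemma choose_prime_pow_succ_div (n k : ℕ) : ((p ^ n).choose (k + 1) : ℚ_[p]) / (p : ℚ_[p]) ^ n =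
    ((k : ℚ_[p]) + 1)⁻¹ * ((p ^ n - 1).choose k : ℚ_[p]) := by
  have h1 : p ^ n - 1 + 1 = p ^ n :=
    Nat.sub_add_cancel (Nat.pos_of_ne_zero (pow_ne_zero n hp.out.ne_zero))
  have h := Nat.add_one_mul_choose_eq (p ^ n - 1) k
  rw [h1] at h
  have h2 : ((p : ℚ_[p]) ^ n) * ((p ^ n - 1).choose k : ℚ_[p]) =
      ((p ^ n).choose (k + 1)) * ((k : ℚ_[p]) + 1) := by
    exact_mod_cast h
  have h3 : (k : ℚ_[p]) + 1 ≠ 0 := by exact_mod_cast k.succ_ne_zero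
  have h4 : (p : ℚ_[p]) ^ n ≠ 0 := pow_ne_zero _ (by exact_mod_cast hp.out.ne_zero)
  field_simp
  linear_combination -h2

lemma tendsto_choose_prime_pow_sub_one (k : ℕ) :
    Tendsto (fun n : ℕ => ((p ^ n - 1).choose k : ℚ_[p])) atTop (𝓝 ((-1) ^ k)) := by
  induction k with
  | zero => simp
  | succ k ih =>
    have h1 : Tendsto (fun n : ℕ => ((p ^ n).choose (k + 1) : ℚ_[p])) atTop (𝓝 0) := by
      refine squeeze_zero_norm (a := fun n => ((k : ℝ) + 1) * ((p : ℝ) ^ n)⁻¹) (fun n => ?_)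
        (by simpa using (tendsto_norm_prime_pow (p := p)).const_mul ((k : ℝ) + 1))
      have h4 : (p : ℚ_[p]) ^ n ≠ 0 := pow_ne_zero _ (by exact_mod_cast hp.out.ne_zero)
      rw [(div_eq_iff h4).1 (choose_prime_pow_succ_div n k), norm_mul, norm_mul, norm_pow,
        Padic.norm_p, inv_pow]
      have := prime_real_pos p
      gcongr
      exact mul_le_of_le_one_right (norm_nonneg _) (norm_natCast_le_one _) |>.trans
        (norm_inv_succ_le k)
    have h2 := h1.sub ih
    rw [zero_sub, ← neg_one_mul, ← pow_succ'] at h2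
    refine h2.congr fun n => ?_
    have h3 : p ^ n - 1 + 1 = p ^ n :=
      Nat.sub_add_cancel (Nat.pos_of_ne_zero (pow_ne_zero n hp.out.ne_zero))
    have h5 := Nat.choose_succ_succ (p ^ n - 1) k
    rw [Nat.succ_eq_add_one, h3] at h5
    rw [h5]
    push_cast
    ring

end

section

variable {p : ℕ} [hp : Fact p.Prime] {C : Type*} [NormedCommRing C] [NormedAlgebra ℚ_[p] C]

variable (p) in
/-- The `p`-adic logarithm, as the sum of its Taylor series. -/
def plog (x : C) : C := ∑' k, logTerm (p := p) x k

lemma logTerm_one (k : ℕ) : logTerm (p := p) (1 : C) k = 0 := by simp [logTerm]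

@[simp] lemma plog_one : plog p (1 : C) = 0 := by simp [plog, logTerm_one]

lemma summable_mul_geometric {r : ℝ} (hr : 0 ≤ r) (hr1 : r < 1) (K : ℝ) :
    Summable fun k : ℕ => ((k : ℝ) + 1) * (K * r ^ (k + 1)) := by
  have h := (summable_pow_mul_geometric_of_norm_lt_one 1 (r := r)
    (by rwa [Real.norm_of_nonneg hr])).comp_injective (add_left_injective 1)
  refine (h.mul_left K).congr fun k => ?_
  simp
  ring

lemma norm_logTerm_le {x : C} {r K : ℝ} (hK : ∀ k, ‖(x - 1) ^ k‖ ≤ K * r ^ k) (k : ℕ) :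
    ‖logTerm (p := p) x k‖ ≤ ((k : ℝ) + 1) * (K * r ^ (k + 1)) := by
  refine (norm_smul_le _ _).trans ?_
  rw [norm_neg_one_pow_div]
  exact mul_le_mul (norm_inv_succ_le k) (hK _) (norm_nonneg _) (by positivity)

lemma norm_logTerm_le_of_norm_le {x : C} (h : ‖x - 1‖ ≤ (p : ℝ)⁻¹) (k : ℕ) :
    ‖logTerm (p := p) x k‖ ≤ (2 / p) ^ k * ‖x - 1‖ := by
  have h0 := prime_real_pos p
  refine (norm_smul_le _ _).trans ?_
  rw [norm_neg_one_pow_div]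
  have h1 : (k : ℝ) + 1 ≤ 2 ^ k := by exact_mod_cast Nat.lt_two_pow_self (n := k)
  calc _ ≤ 2 ^ k * (((p : ℝ)⁻¹) ^ k * ‖x - 1‖) := by
        refine mul_le_mul ((norm_inv_succ_le k).trans h1) ?_ (norm_nonneg _) (by positivity)
        refine (norm_pow_le' _ k.succ_pos).trans ?_
        rw [pow_succ]
        gcongr
    _ = _ := by rw [div_eq_mul_inv, mul_pow, mul_assoc]

lemma GrowthLE.mul_sub_one [IsUltrametricDist C] {x y : C} {r : ℝ} (hr : 0 ≤ r) (hr1 : r ≤ 1)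
    (hx : GrowthLE (x - 1) r) (hy : GrowthLE (y - 1) r) : GrowthLE (x * y - 1) r := by
  have e : x * y - 1 = (x - 1) * y + (y - 1) := by ring
  have hy' : GrowthLE y 1 := by
    simpa using (hy.mono hr hr1).add zero_le_one growthLE_one
  rw [e]
  exact GrowthLE.add hr (by simpa using hx.mul hy') hy

lemma GrowthLE.pow_sub_one [IsUltrametricDist C] {x : C} {r : ℝ} (hr : 0 ≤ r) (hr1 : r ≤ 1)
    (hx : GrowthLE (x - 1) r) (n : ℕ) : GrowthLE (x ^ n - 1) r := by
  induction n with
  | zero => simpa using growthLE_zero hr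
  | succ n ih => rw [pow_succ]; exact ih.mul_sub_one hr hr1 hx

lemma norm_plog_le [IsUltrametricDist C] {x : C} (h : ‖x - 1‖ ≤ (p : ℝ)⁻¹) :
    ‖plog p x‖ ≤ ‖x - 1‖ := by
  refine IsUltrametricDist.norm_tsum_le_of_forall_le_of_nonneg (norm_nonneg _) fun k => ?_
  refine (norm_logTerm_le_of_norm_le h k).trans (mul_le_of_le_one_left (norm_nonneg _) ?_)
  exact pow_le_one₀ (by positivity) ((div_le_one (prime_real_pos p)).2
    (by exact_mod_cast hp.out.two_le))

variable [CompleteSpace C]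

lemma hasSum_plog {x : C} {r : ℝ} (hr : 0 ≤ r) (hr1 : r < 1) (hx : GrowthLE (x - 1) r) :
    HasSum (logTerm (p := p) x) (plog p x) := by
  obtain ⟨K, hK⟩ := hx
  exact (Summable.of_norm_bounded (summable_mul_geometric hr hr1 K)
    (norm_logTerm_le hK)).hasSum

lemma plog_map {C' : Type*} [NormedCommRing C'] [NormedAlgebra ℚ_[p] C'] (f : C →A[ℚ_[p]] C')
    {x : C} {r : ℝ} (hr : 0 ≤ r) (hr1 : r < 1) (hx : GrowthLE (x - 1) r) :
    f (plog p x) = plog p (f x) := by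
  refine (((hasSum_plog hr hr1 hx).map f f.continuous).tsum_eq.symm).trans ?_
  refine tsum_congr fun k => ?_
  simp [logTerm]

/-- The logarithm is the derivative at `0` of `s ↦ x ^ s`, computed along `s = p ^ n → 0`. -/
lemma tendsto_pow_sub_one_div {x : C} {r : ℝ} (hr : 0 ≤ r) (hr1 : r < 1)
    (hx : GrowthLE (x - 1) r) :
    Tendsto (fun n : ℕ => ((p : ℚ_[p]) ^ n)⁻¹ • (x ^ p ^ n - 1)) atTop (𝓝 (plog p x)) := by
  obtain ⟨K, hK⟩ := hx
  have key := tendsto_tsum_of_dominated_convergence (𝓕 := atTop)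
    (f := fun (n : ℕ) (k : ℕ) => (((p ^ n).choose (k + 1) : ℚ_[p]) / (p : ℚ_[p]) ^ n) •
      (x - 1) ^ (k + 1)) (g := logTerm (p := p) x) (summable_mul_geometric hr hr1 K)
    (fun k => by
      refine Tendsto.smul_const ?_ _
      simp only [choose_prime_pow_succ_div]
      rw [div_eq_inv_mul]
      exact (tendsto_choose_prime_pow_sub_one k).const_mul _)
    (Eventually.of_forall fun n k => by
      refine (norm_smul_le _ _).trans (mul_le_mul ?_ (hK _) (norm_nonneg _) (by positivity))
      rw [choose_prime_pow_succ_div, norm_mul]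
      exact (mul_le_of_le_one_right (norm_nonneg _) (norm_natCast_le_one _)).trans
        (norm_inv_succ_le k))
  refine key.congr fun n => ?_
  rw [tsum_eq_sum (s := Finset.range (p ^ n)) fun k hk => by
    rw [Nat.choose_eq_zero_of_lt (by simpa [Nat.lt_succ_iff] using hk)]; simp]
  have h1 : x ^ p ^ n - 1 = ∑ k ∈ Finset.range (p ^ n),
      ((p ^ n).choose (k + 1) : ℚ_[p]) • (x - 1) ^ (k + 1) := by
    have := add_pow (x - 1) 1 (p ^ n)
    rw [sub_add_cancel, Finset.sum_range_succ'] at this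
    rw [this]
    simp [Algebra.smul_def, mul_comm]
  rw [h1, Finset.smul_sum]
  refine Finset.sum_congr rfl fun k _ => ?_
  rw [smul_smul, div_eq_inv_mul]

variable [IsUltrametricDist C]

lemma plog_mul {x y : C} {r : ℝ} (hr : 0 ≤ r) (hr1 : r < 1) (hx : GrowthLE (x - 1) r)
    (hy : GrowthLE (y - 1) r) : plog p (x * y) = plog p x + plog p y := by
  have hx' := tendsto_pow_sub_one_div (p := p) hr hr1 hx
  have hy' := tendsto_pow_sub_one_div (p := p) hr hr1 hy
  have hxy := tendsto_pow_sub_one_div (p := p) hr hr1 (hx.mul_sub_one hr hr1.le hy)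
  refine tendsto_nhds_unique hxy ?_
  have hp0 : Tendsto (fun n : ℕ => (p : ℚ_[p]) ^ n) atTop (𝓝 0) := by
    refine squeeze_zero_norm (fun n => ?_) (tendsto_norm_prime_pow (p := p))
    rw [norm_pow, Padic.norm_p, inv_pow]
  have h1 : Tendsto (fun n : ℕ => ((p : ℚ_[p]) ^ n)⁻¹ • (x ^ p ^ n - 1) +
      (((p : ℚ_[p]) ^ n)⁻¹ • (y ^ p ^ n - 1) + ((p : ℚ_[p]) ^ n) •
      ((((p : ℚ_[p]) ^ n)⁻¹ • (x ^ p ^ n - 1)) * (((p : ℚ_[p]) ^ n)⁻¹ • (y ^ p ^ n - 1))))) atTop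
      (𝓝 (plog p x + (plog p y + (0 : ℚ_[p]) • (plog p x * plog p y)))) :=
    hx'.add (hy'.add (hp0.smul (hx'.mul hy')))
  rw [zero_smul, add_zero] at h1
  refine h1.congr fun n => ?_
  have h4 : (p : ℚ_[p]) ^ n ≠ 0 := pow_ne_zero _ (by exact_mod_cast hp.out.ne_zero)
  rw [smul_mul_smul_comm, smul_smul, mul_inv_cancel_left₀ h4, ← smul_add, ← smul_add]
  congr 1
  ring

lemma plog_pow {x : C} {r : ℝ} (hr : 0 ≤ r) (hr1 : r < 1) (hx : GrowthLE (x - 1) r) (n : ℕ) :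
    plog p (x ^ n) = n • plog p x := by
  induction n with
  | zero => simp
  | succ n ih => rw [pow_succ, plog_mul hr hr1 (hx.pow_sub_one hr hr1.le n) hx, ih, succ_nsmul]

lemma norm_plog_sub_le {x : C} (h : ‖x - 1‖ ≤ (p : ℝ)⁻¹) :
    ‖plog p x - (x - 1)‖ ≤ 2 / p * ‖x - 1‖ := by
  have h0 := prime_real_pos p
  have hs := hasSum_plog (p := p) (inv_nonneg.2 h0.le) (inv_lt_one_of_one_lt₀ (one_lt_prime_real p))
    (.of_norm_le h)
  rw [← hs.tsum_eq, hs.summable.tsum_eq_zero_add]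
  have : logTerm (p := p) x 0 = x - 1 := by simp [logTerm]
  rw [this, add_sub_cancel_left]
  refine IsUltrametricDist.norm_tsum_le_of_forall_le_of_nonneg (by positivity) fun k => ?_
  refine (norm_logTerm_le_of_norm_le h (k + 1)).trans ?_
  have h2 : 2 / (p : ℝ) ≤ 1 := (div_le_one h0).2 (by exact_mod_cast hp.out.two_le)
  rw [pow_succ]
  refine mul_le_mul_of_nonneg_right (mul_le_of_le_one_left (by positivity) ?_) (norm_nonneg _)
  exact pow_le_one₀ (by positivity) h2

end

/-! ### Logarithm and exponential on the small disc -/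

section

variable {p : ℕ} [hp : Fact p.Prime]

lemma norm_one_add_X_sub_one_le (n : ℕ) :
    ‖(1 + RSeries.X - 1 : RSeries ℚ_[p] (discRadius p n))‖ ≤ discRadius p n := by
  rw [add_sub_cancel_left]; exact RSeries.norm_X_le

variable {C : Type*} [NormedCommRing C] [NormedAlgebra ℚ_[p] C] [CompleteSpace C]
  [IsUltrametricDist C]

lemma eval_plog {t : C} {n : ℕ} (ht : GrowthLE t (discRadius p n)) :
    RSeries.eval (p := p) t ht (plog p (1 + RSeries.X)) = plog p (1 + t) := by
  rw [plog_map _ (discRadius_pos p n).le (discRadius_lt_one p n)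
    (.of_norm_le (norm_one_add_X_sub_one_le n))]
  simp

lemma growthLE_plog {x : C} (h : GrowthLE (x - 1) (discRadius p 0)) :
    GrowthLE (plog p x) (discRadius p 0) := by
  have h1 := norm_one_add_X_sub_one_le (p := p) 0
  have := (GrowthLE.of_norm_le ((norm_plog_le (h1.trans (discRadius_zero_le p))).trans h1)).map
    (RSeries.eval (x - 1) h)
  rwa [eval_plog, add_sub_cancel] at this

/-- The series `log (1 + X) / X`. -/
def logQuotient (p : ℕ) [Fact p.Prime] : RSeries ℚ_[p] (discRadius p 0) :=
  RSeries.mk (fun k => (-1) ^ k / ((k : ℚ_[p]) + 1)) (by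
    have h := (summable_mul_geometric (discRadius_pos p 0).le (discRadius_lt_one p 0)
      (discRadius p 0)⁻¹).tendsto_atTop_zero
    refine squeeze_zero (fun k => mul_nonneg (norm_nonneg _) (pow_nonneg (discRadius_pos p 0).le _))
      (fun k => ?_) h
    have h0 := discRadius_pos p 0
    rw [norm_neg_one_pow_div, pow_succ', inv_mul_cancel_left₀ h0.ne']
    exact mul_le_mul_of_nonneg_right (norm_inv_succ_le k) (by positivity))

lemma isUnit_logQuotient (hp2 : p ≠ 2) : IsUnit (logQuotient p) := by
  have h0 := prime_real_pos p
  have h3 : (2 : ℝ) / p < 1 := (div_lt_one h0).2 (by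
    exact_mod_cast lt_of_le_of_ne hp.out.two_le (Ne.symm hp2))
  have h1 : ‖1 - logQuotient p‖ < 1 := by
    refine (RSeries.norm_le fun k => ?_).trans_lt h3
    rw [map_sub, RSeries.coeff_one, logQuotient, RSeries.coeff_mk]
    rcases Nat.eq_zero_or_pos k with rfl | hk
    · simpa using (div_pos two_pos h0).le
    · rw [if_neg hk.ne', zero_sub, norm_neg, norm_neg_one_pow_div]
      have h5 : (k : ℝ) + 1 ≤ 2 ^ k := by exact_mod_cast Nat.lt_two_pow_self (n := k)
      have h6 := discRadius_pos p 0
      calc _ ≤ (2 : ℝ) ^ k * ((p : ℝ)⁻¹) ^ k := mul_le_mul ((norm_inv_succ_le k).trans h5)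
            (pow_le_pow_left₀ h6.le (discRadius_zero_le p) k) (by positivity) (by positivity)
        _ = (2 / p) ^ k := by rw [div_eq_mul_inv, mul_pow]
        _ ≤ 2 / p := pow_le_of_le_one (by positivity) h3.le hk.ne'
  simpa using (Units.oneSub (1 - logQuotient p) h1).isUnit

/-- The logarithm is injective on the small disc: there `log (1 + t)` is `t` times a unit. -/
lemma eq_one_of_plog_eq_zero (hp2 : p ≠ 2) {x : C} (h : GrowthLE (x - 1) (discRadius p 0))
    (hx : plog p x = 0) : x = 1 := by
  have h1 := (RSeries.hasSum_eval h (logQuotient p)).mul_left (x - 1)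
  have h2 : (x - 1) * RSeries.eval (x - 1) h (logQuotient p) = plog p x := by
    refine h1.unique ((hasSum_plog (p := p) (discRadius_pos p 0).le (discRadius_lt_one p 0)
      h).congr_fun fun k => ?_)
    rw [logTerm, logQuotient, RSeries.coeff_mk, mul_smul_comm, pow_succ']
  rw [hx] at h2
  exact sub_eq_zero.1 (((isUnit_logQuotient hp2).map
    (RSeries.eval (x - 1) h)).mul_left_eq_zero.1 h2)

lemma norm_inv_factorial_pow (k : ℕ) : ‖((k.factorial : ℚ_[p]))⁻¹‖ ^ (p - 1) =
    (p : ℝ) ^ ((p - 1) * padicValNat p k.factorial) := by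
  rw [norm_inv, norm_natCast_eq_pow k.factorial_ne_zero, inv_inv, ← pow_mul, mul_comm]

lemma norm_inv_factorial_mul_le (k : ℕ) :
    ‖((k.factorial : ℚ_[p]))⁻¹‖ * discRadius p 0 ^ k ≤ ((p : ℝ) ^ k)⁻¹ := by
  have h0 := prime_real_pos p
  refine le_of_pow_le_pow_left₀ (Nat.sub_ne_zero_of_lt hp.out.one_lt) (by positivity) ?_
  rw [mul_pow, norm_inv_factorial_pow, pow_right_comm, discRadius_zero_pow, inv_pow, inv_pow,
    ← pow_mul, ← pow_mul, ← div_eq_mul_inv, div_le_iff₀ (by positivity),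
    ← div_eq_inv_mul, le_div_iff₀ (by positivity), ← pow_add]
  refine pow_le_pow_right₀ (one_lt_prime_real p).le ?_
  rw [sub_one_mul_padicValNat_factorial]
  have : p * k = k * (p - 1) + k := by
    obtain ⟨q, hq⟩ := Nat.exists_eq_add_of_lt hp.out.one_lt
    rw [hq]; simp; ring
  omega

lemma norm_inv_factorial_mul_le_discRadius {k : ℕ} (hk : k ≠ 0) :
    ‖((k.factorial : ℚ_[p]))⁻¹‖ * discRadius p 0 ^ k ≤ discRadius p 0 := by
  have h0 := prime_real_pos p
  have h1 := discRadius_pos p 0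
  refine le_of_pow_le_pow_left₀ (Nat.sub_ne_zero_of_lt hp.out.one_lt) h1.le ?_
  rw [mul_pow, norm_inv_factorial_pow, pow_right_comm, discRadius_zero_pow, inv_pow, ← pow_mul,
    ← div_eq_mul_inv, div_le_iff₀ (by positivity), ← div_eq_inv_mul, le_div_iff₀ (by positivity),
    ← pow_add]
  refine pow_le_pow_right₀ (one_lt_prime_real p).le ?_
  have h2 := sub_one_mul_padicValNat_factorial_lt_of_ne_zero p hk
  obtain ⟨j, rfl⟩ := Nat.exists_eq_succ_of_ne_zero hk
  have : p * j.succ = p * j + p := by rw [Nat.mul_succ]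
  have := Nat.le_mul_of_pos_left j hp.out.pos
  omega

/-- The exponential series, as a function on the small disc. -/
def expSeries (p : ℕ) [Fact p.Prime] : RSeries ℚ_[p] (discRadius p 0) :=
  RSeries.mk (fun k => ((k.factorial : ℚ_[p]))⁻¹)
    (squeeze_zero (fun _ => mul_nonneg (norm_nonneg _) (pow_nonneg (discRadius_pos p 0).le _))
      norm_inv_factorial_mul_le tendsto_norm_prime_pow)

lemma coeff_expSeries_pow (m k : ℕ) :
    RSeries.coeff k (expSeries p ^ m) = (m : ℚ_[p]) ^ k * ((k.factorial : ℚ_[p]))⁻¹ := by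
  have h : RSeries.toPowerSeries (expSeries p) = PowerSeries.exp ℚ_[p] := by
    ext k
    simp [expSeries, PowerSeries.coeff_exp]
  rw [RSeries.coeff_def, map_pow, h, PowerSeries.exp_pow_eq_rescale_exp, PowerSeries.coeff_rescale,
    PowerSeries.coeff_exp]
  simp

lemma norm_expSeries_sub_one_le : ‖expSeries p - 1‖ ≤ discRadius p 0 := by
  refine RSeries.norm_le fun k => ?_
  rw [map_sub, RSeries.coeff_one, expSeries, RSeries.coeff_mk]
  rcases eq_or_ne k 0 with rfl | hk
  · simpa using (discRadius_pos p 0).le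
  · rw [if_neg hk, sub_zero]
    exact norm_inv_factorial_mul_le_discRadius hk

/-- `log (exp X) = X`, since `(exp (p ^ n * X) - 1) / p ^ n → X`. -/
lemma plog_expSeries : plog p (expSeries p) = RSeries.X := by
  refine tendsto_nhds_unique (tendsto_pow_sub_one_div (p := p) (discRadius_pos p 0).le
    (discRadius_lt_one p 0) (.of_norm_le norm_expSeries_sub_one_le)) ?_
  rw [tendsto_iff_norm_sub_tendsto_zero]
  refine squeeze_zero (fun n => norm_nonneg _) (fun n => ?_) (tendsto_norm_prime_pow (p := p))
  have h0 := prime_real_pos p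
  have h4 : (p : ℚ_[p]) ^ n ≠ 0 := pow_ne_zero _ (by exact_mod_cast hp.out.ne_zero)
  refine RSeries.norm_le fun i => ?_
  rw [map_sub, RSeries.coeff_smul, map_sub, coeff_expSeries_pow, RSeries.coeff_one, RSeries.X,
    RSeries.coeff_monomial]
  rcases i with _ | _ | k
  · simp
  · simp [h4]
  · simp only [Nat.cast_pow, Nat.add_eq_zero_iff, one_ne_zero, and_false, if_false, sub_zero,
      smul_eq_mul, Nat.add_eq_right]
    have e : ((p : ℚ_[p]) ^ n)⁻¹ * (((p : ℚ_[p]) ^ n) ^ (k + 1 + 1) *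
        (((k + 1 + 1).factorial : ℚ_[p]))⁻¹) = ((p : ℚ_[p]) ^ n) ^ (k + 1) *
        (((k + 1 + 1).factorial : ℚ_[p]))⁻¹ := by
      rw [pow_succ _ (k + 1)]; field_simp
    rw [e, norm_mul, norm_pow, norm_pow, Padic.norm_p, mul_assoc]
    have h5 : ((p : ℝ)⁻¹ ^ n) ≤ 1 :=
      pow_le_one₀ (by positivity) (inv_le_one_of_one_le₀ (one_lt_prime_real p).le)
    refine (mul_le_mul (pow_le_of_le_one (by positivity) h5 k.succ_ne_zero)
      ((norm_inv_factorial_mul_le (p := p) (k + 1 + 1)).trans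
        (inv_le_one_of_one_le₀ (one_le_pow₀ (one_lt_prime_real p).le)))
      (mul_nonneg (norm_nonneg _) (pow_nonneg (discRadius_pos p 0).le _)) (by positivity)).trans_eq ?_
    rw [mul_one, inv_pow]

lemma growthLE_exp_sub_one {y : C} (hy : GrowthLE y (discRadius p 0)) :
    GrowthLE (RSeries.eval y hy (expSeries p) - 1) (discRadius p 0) := by
  simpa using (GrowthLE.of_norm_le (norm_expSeries_sub_one_le (p := p))).map (RSeries.eval y hy)

lemma plog_exp {y : C} (hy : GrowthLE y (discRadius p 0)) :
    plog p (RSeries.eval y hy (expSeries p)) = y := by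
  have h := plog_map (RSeries.eval y hy) (x := expSeries p) (discRadius_pos p 0).le
    (discRadius_lt_one p 0) (.of_norm_le norm_expSeries_sub_one_le)
  rw [plog_expSeries, RSeries.eval_X] at h
  exact h.symm

lemma eq_of_plog_eq (hp2 : p ≠ 2) {x y : C} (hx : GrowthLE (x - 1) (discRadius p 0))
    (hy : GrowthLE (y - 1) (discRadius p 0)) (h : plog p x = plog p y) : x = y := by
  have h0 := (discRadius_pos p 0).le
  have h1 := discRadius_lt_one p 0
  have hl := (growthLE_plog hy).neg
  set z := RSeries.eval _ hl (expSeries p) with hz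
  have hz1 : GrowthLE (z - 1) (discRadius p 0) := growthLE_exp_sub_one hl
  have hz2 : plog p z = -plog p y := plog_exp hl
  have hyz : y * z = 1 := eq_one_of_plog_eq_zero hp2 (hy.mul_sub_one h0 h1.le hz1) (by
    rw [plog_mul h0 h1 hy hz1, hz2, add_neg_cancel])
  have hxz : x * z = 1 := eq_one_of_plog_eq_zero hp2 (hx.mul_sub_one h0 h1.le hz1) (by
    rw [plog_mul h0 h1 hx hz1, hz2, h, add_neg_cancel])
  linear_combination y * hxz - x * hyz

end

/-! ### The group `ℤ_p^×` -/

section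

variable {p : ℕ} [hp : Fact p.Prime]

variable (p) in
/-- The subgroup `1 + p ℤ_p` of `ℤ_p^×`. -/
def principalUnits : Subgroup ℤ_[p]ˣ where
  carrier := {u | (p : ℤ_[p]) ∣ (u : ℤ_[p]) - 1}
  one_mem' := by simp
  mul_mem' := fun {u v} hu hv => by
    have e : ((u * v : ℤ_[p]ˣ) : ℤ_[p]) - 1 = (u : ℤ_[p]) * (v - 1) + (u - 1) := by
      push_cast; ring
    change (p : ℤ_[p]) ∣ ((u * v : ℤ_[p]ˣ) : ℤ_[p]) - 1
    rw [e]
    exact dvd_add (hv.mul_left _) hu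
  inv_mem' := fun {u} hu => by
    have e : ((u⁻¹ : ℤ_[p]ˣ) : ℤ_[p]) - 1 = -((u⁻¹ : ℤ_[p]ˣ) : ℤ_[p]) * (u - 1) := by
      rw [neg_mul, mul_sub, Units.inv_mul]; ring
    change (p : ℤ_[p]) ∣ ((u⁻¹ : ℤ_[p]ˣ) : ℤ_[p]) - 1
    rw [e]
    exact Dvd.dvd.mul_left hu _

lemma mem_principalUnits {u : ℤ_[p]ˣ} : u ∈ principalUnits p ↔ (p : ℤ_[p]) ∣ (u : ℤ_[p]) - 1 :=
  Iff.rfl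

lemma norm_sub_one_of_mem {u : ℤ_[p]ˣ} (hu : u ∈ principalUnits p) :
    ‖((u : ℤ_[p]) : ℚ_[p]) - 1‖ ≤ (p : ℝ)⁻¹ := by
  obtain ⟨c, hc⟩ := mem_principalUnits.1 hu
  have : ((u : ℤ_[p]) : ℚ_[p]) - 1 = (p : ℚ_[p]) * c := by
    rw [← PadicInt.coe_one, ← PadicInt.coe_sub, hc]; simp
  rw [this, norm_mul, Padic.norm_p]
  exact mul_le_of_le_one_right (inv_nonneg.2 (prime_real_pos p).le) (PadicInt.norm_le_one c)

lemma tendsto_coe_units : Tendsto (fun u : ℤ_[p]ˣ => ((u : ℤ_[p]) : ℚ_[p])) (𝓝 1) (𝓝 1) := by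
  have h1 : Continuous fun z : ℤ_[p] => (z : ℚ_[p]) := continuous_subtype_val
  have h : Continuous fun u : ℤ_[p]ˣ => ((u : ℤ_[p]) : ℚ_[p]) := h1.comp Units.continuous_val
  simpa using h.tendsto 1

lemma principalUnits_mem_nhds : (principalUnits p : Set ℤ_[p]ˣ) ∈ 𝓝 1 := by
  have h := (tendsto_coe_units (p := p)).eventually (Metric.ball_mem_nhds 1 one_pos)
  filter_upwards [h] with u hu
  change (p : ℤ_[p]) ∣ (u : ℤ_[p]) - 1
  rw [← PadicInt.norm_lt_one_iff_dvd, PadicInt.norm_def]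
  simpa [dist_eq_norm] using hu

lemma pow_sub_one_mem (u : ℤ_[p]ˣ) : u ^ (p - 1) ∈ principalUnits p := by
  rw [mem_principalUnits, ← Ideal.mem_span_singleton, ← PadicInt.maximalIdeal_eq_span_p,
    ← PadicInt.ker_toZMod, RingHom.mem_ker]
  have := ZMod.pow_card_sub_one_eq_one (p := p) (a := PadicInt.toZMod (u : ℤ_[p]))
    (u.isUnit.map PadicInt.toZMod).ne_zero
  simp [this]

/-- Every unit is a root of unity of order dividing `p - 1` times a principal unit. -/
lemma exists_root_of_unity (u : ℤ_[p]ˣ) : ∃ ζ : ℤ_[p]ˣ, ζ ^ (p - 1) = 1 ∧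
    ζ⁻¹ * u ∈ principalUnits p := by
  have hp1 : p - 1 ≠ 0 := Nat.sub_ne_zero_of_lt hp.out.one_lt
  have hd : ‖Polynomial.aeval (u : ℤ_[p])
      (Polynomial.X ^ (p - 1) - 1 : Polynomial ℤ_[p]).derivative‖ = 1 := by
    have : ‖((p - 1 : ℕ) : ℤ_[p])‖ = 1 := by
      rw [PadicInt.norm_def, PadicInt.coe_natCast]; exact Padic.norm_natCast_p_sub_one
    simp [Polynomial.derivative_X_pow, PadicInt.norm_units, this]
  obtain ⟨z, hz, hz1, -⟩ := hensels_lemma (p := p) (R := ℤ_[p])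
    (F := Polynomial.X ^ (p - 1) - 1) (a := (u : ℤ_[p])) (by
      rw [hd, one_pow]
      have := PadicInt.norm_lt_one_iff_dvd _ |>.2 (mem_principalUnits.1 (pow_sub_one_mem u))
      simpa using this)
  rw [hd] at hz1
  have hz' : z ^ (p - 1) = 1 := by simpa [sub_eq_zero] using hz
  let ζ : ℤ_[p]ˣ := Units.ofPowEqOne z (p - 1) hz' hp1
  refine ⟨ζ, Units.ext (by simp [ζ]), ?_⟩
  have e : ((ζ⁻¹ * u : ℤ_[p]ˣ) : ℤ_[p]) - 1 = -(((ζ⁻¹ : ℤ_[p]ˣ) : ℤ_[p]) * (z - u)) := by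
    have : ((ζ⁻¹ : ℤ_[p]ˣ) : ℤ_[p]) * z = 1 := ζ.inv_mul
    rw [mul_sub, this]; push_cast; ring
  rw [mem_principalUnits, e, dvd_neg]
  exact Dvd.dvd.mul_left ((PadicInt.norm_lt_one_iff_dvd _).1 hz1) _

/-- The logarithm on `1 + p ℤ_p`. -/
def unitLog (u : ℤ_[p]ˣ) : ℚ_[p] := plog p ((u : ℤ_[p]) : ℚ_[p])

lemma growthLE_unit {u : ℤ_[p]ˣ} (hu : u ∈ principalUnits p) :
    GrowthLE (((u : ℤ_[p]) : ℚ_[p]) - 1) (p : ℝ)⁻¹ := .of_norm_le (norm_sub_one_of_mem hu)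

lemma inv_prime_nonneg : 0 ≤ (p : ℝ)⁻¹ := inv_nonneg.2 (prime_real_pos p).le

lemma inv_prime_lt_one : (p : ℝ)⁻¹ < 1 := inv_lt_one_of_one_lt₀ (one_lt_prime_real p)

lemma unitLog_mul {u v : ℤ_[p]ˣ} (hu : u ∈ principalUnits p) (hv : v ∈ principalUnits p) :
    unitLog (u * v) = unitLog u + unitLog v := by
  rw [unitLog, Units.val_mul, PadicInt.coe_mul]
  exact plog_mul inv_prime_nonneg inv_prime_lt_one (growthLE_unit hu) (growthLE_unit hv)

lemma unitLog_one : unitLog (1 : ℤ_[p]ˣ) = 0 := by simp [unitLog]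

lemma norm_unitLog (hp2 : p ≠ 2) {u : ℤ_[p]ˣ} (hu : u ∈ principalUnits p) :
    ‖unitLog u‖ = ‖((u : ℤ_[p]) : ℚ_[p]) - 1‖ := by
  rcases eq_or_ne (((u : ℤ_[p]) : ℚ_[p]) - 1) 0 with h | h
  · have : ((u : ℤ_[p]) : ℚ_[p]) = 1 := sub_eq_zero.1 h
    rw [unitLog, this, plog_one, sub_self]
  · have h1 := norm_plog_sub_le (norm_sub_one_of_mem hu)
    rw [sub_eq_add_neg] at h1
    have h3 : (2 : ℝ) / p < 1 := (div_lt_one (prime_real_pos p)).2 (by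
      exact_mod_cast lt_of_le_of_ne hp.out.two_le (Ne.symm hp2))
    rw [← norm_neg (((u : ℤ_[p]) : ℚ_[p]) - 1)]
    refine IsUltrametricDist.norm_eq_of_add_norm_lt_max (h1.trans_lt (lt_max_of_lt_right ?_))
    rw [norm_neg]
    exact mul_lt_of_lt_one_left (norm_pos_iff.2 h) h3

lemma unitLog_pow {u : ℤ_[p]ˣ} (hu : u ∈ principalUnits p) (n : ℕ) :
    unitLog (u ^ n) = n • unitLog u := by
  rw [unitLog, Units.val_pow_eq_pow_val, PadicInt.coe_pow]
  exact plog_pow inv_prime_nonneg inv_prime_lt_one (growthLE_unit hu) n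

variable (p) in
/-- The topological generator `1 + p` of `1 + p ℤ_p`. -/
def gen : ℤ_[p]ˣ := IsUnit.unit (a := (1 + p : ℤ_[p])) (PadicInt.isUnit_iff.2 (by
  have h1 : ‖(p : ℤ_[p])‖ < ‖(1 : ℤ_[p])‖ := by
    rw [PadicInt.norm_p, norm_one]; exact inv_prime_lt_one
  rw [IsUltrametricDist.norm_add_eq_max_of_norm_ne_norm h1.ne', max_eq_left h1.le, norm_one]))

lemma val_gen : (gen p : ℤ_[p]) = 1 + p := rfl

lemma gen_mem : gen p ∈ principalUnits p := by rw [mem_principalUnits, val_gen]; simp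

lemma norm_unitLog_gen (hp2 : p ≠ 2) : ‖unitLog (gen p)‖ = (p : ℝ)⁻¹ := by
  rw [norm_unitLog hp2 gen_mem, val_gen]
  simp

lemma unitLog_gen_ne_zero (hp2 : p ≠ 2) : unitLog (gen p) ≠ 0 := by
  rw [← norm_pos_iff, norm_unitLog_gen hp2]
  exact inv_pos.2 (prime_real_pos p)

/-- The homomorphism `u ↦ log (u ^ (p - 1)) / ((p - 1) * log (1 + p))` from `ℤ_p^×` to `ℤ_p`: it
kills the roots of unity and gives the exponent `a` of an element `(1 + p) ^ a` of `1 + p ℤ_p`. -/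
def exponent (hp2 : p ≠ 2) (u : ℤ_[p]ˣ) : ℤ_[p] :=
  ⟨unitLog (u ^ (p - 1)) / (((p - 1 : ℕ) : ℚ_[p]) * unitLog (gen p)), by
    rw [norm_div, norm_mul, Padic.norm_natCast_p_sub_one, one_mul, norm_unitLog_gen hp2,
      norm_unitLog hp2 (pow_sub_one_mem u)]
    exact (div_le_one (inv_pos.2 (prime_real_pos p))).2 (norm_sub_one_of_mem (pow_sub_one_mem u))⟩

lemma coe_exponent (hp2 : p ≠ 2) (u : ℤ_[p]ˣ) : (exponent hp2 u : ℚ_[p]) =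
    unitLog (u ^ (p - 1)) / (((p - 1 : ℕ) : ℚ_[p]) * unitLog (gen p)) := rfl

lemma natCast_prime_sub_one_ne_zero : ((p - 1 : ℕ) : ℚ_[p]) ≠ 0 := by
  exact_mod_cast Nat.sub_ne_zero_of_lt hp.out.one_lt

lemma coe_exponent_of_mem (hp2 : p ≠ 2) {u : ℤ_[p]ˣ} (hu : u ∈ principalUnits p) :
    (exponent hp2 u : ℚ_[p]) = unitLog u / unitLog (gen p) := by
  have := natCast_prime_sub_one_ne_zero (p := p)
  rw [coe_exponent, unitLog_pow hu, nsmul_eq_mul, mul_div_mul_left _ _ this]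

lemma exponent_mul (hp2 : p ≠ 2) (u v : ℤ_[p]ˣ) :
    exponent hp2 (u * v) = exponent hp2 u + exponent hp2 v := by
  apply PadicInt.ext
  rw [PadicInt.coe_add, coe_exponent, coe_exponent, coe_exponent, mul_pow,
    unitLog_mul (pow_sub_one_mem u) (pow_sub_one_mem v), add_div]

lemma exponent_gen (hp2 : p ≠ 2) : exponent hp2 (gen p) = 1 := by
  apply PadicInt.ext
  rw [coe_exponent_of_mem hp2 gen_mem, div_self (unitLog_gen_ne_zero hp2), PadicInt.coe_one]

lemma exponent_root_of_unity (hp2 : p ≠ 2) {ζ : ℤ_[p]ˣ} (hζ : ζ ^ (p - 1) = 1) :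
    exponent hp2 ζ = 0 := by
  apply PadicInt.ext
  rw [coe_exponent, hζ, unitLog_one, zero_div, PadicInt.coe_zero]

lemma tendsto_unitLog (hp2 : p ≠ 2) : Tendsto (unitLog (p := p)) (𝓝 1) (𝓝 0) := by
  have h1 : Tendsto (fun u : ℤ_[p]ˣ => ‖((u : ℤ_[p]) : ℚ_[p]) - 1‖) (𝓝 1) (𝓝 0) := by
    simpa using ((tendsto_coe_units (p := p)).sub_const 1).norm
  rw [tendsto_zero_iff_norm_tendsto_zero]
  refine h1.congr' ?_
  filter_upwards [principalUnits_mem_nhds] with u hu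
  exact (norm_unitLog hp2 hu).symm

/-- `exponent` as a homomorphism to the multiplicative version of `ℤ_p`. -/
def exponentHom (hp2 : p ≠ 2) : ℤ_[p]ˣ →* Multiplicative ℤ_[p] where
  toFun u := .ofAdd (exponent hp2 u)
  map_one' := by
    change Multiplicative.ofAdd (exponent hp2 1) = Multiplicative.ofAdd 0
    rw [exponent_root_of_unity hp2 (one_pow _)]
  map_mul' u v := by rw [exponent_mul]; rfl

lemma continuous_exponentHom (hp2 : p ≠ 2) : Continuous (exponentHom (p := p) hp2) := by
  refine continuous_of_continuousAt_one _ ?_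
  have h1 : Tendsto (fun u : ℤ_[p]ˣ => (exponent hp2 u : ℚ_[p])) (𝓝 1) (𝓝 0) := by
    have h2 : Tendsto (fun u : ℤ_[p]ˣ => u ^ (p - 1)) (𝓝 1) (𝓝 1) := by
      simpa using (continuous_pow (M := ℤ_[p]ˣ) (p - 1)).tendsto 1
    have h3 := ((tendsto_unitLog hp2).comp h2).div_const (((p - 1 : ℕ) : ℚ_[p]) * unitLog (gen p))
    rwa [zero_div] at h3
  have h3 : Tendsto (fun u : ℤ_[p]ˣ => exponent hp2 u) (𝓝 1) (𝓝 0) :=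
    tendsto_subtype_rng.2 h1
  rw [ContinuousAt, map_one]
  exact h3

lemma tendsto_units_val {ι : Type*} {l : Filter ι} {f : ι → ℤ_[p]ˣ} {u : ℤ_[p]ˣ}
    (h : Tendsto (fun i => ‖((f i : ℤ_[p]) : ℚ_[p]) - (u : ℤ_[p])‖) l (𝓝 0)) :
    Tendsto f l (𝓝 u) := by
  rw [Units.isOpenEmbedding_val.tendsto_nhds_iff]
  exact tendsto_subtype_rng.2 (tendsto_iff_norm_sub_tendsto_zero.2 h)

/-- `1 + p` is a topological generator of `1 + p ℤ_p`, for odd `p`: if natural numbers `k` tend to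
`log u / log (1 + p)`, then `(1 + p) ^ k` tends to `u`. -/
lemma isGenerator_gen (hp2 : p ≠ 2) : IsGenerator (gen p) := by
  refine Set.Subset.antisymm ?_ fun u hu => ?_
  · refine closure_minimal (Subgroup.zpowers_le.2 (gen_mem (p := p)) : _ ≤ principalUnits p)
      (Subgroup.isClosed_of_isOpen _ (Subgroup.isOpen_of_mem_nhds _ principalUnits_mem_nhds))
  · obtain ⟨k, hk⟩ := mem_closure_iff_seq_limit.1
      (PadicInt.denseRange_natCast (p := p) (exponent hp2 u))
    choose m hm using hk.1
    refine mem_closure_of_tendsto (f := fun i => gen p ^ m i) (b := atTop) (tendsto_units_val ?_)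
      (Eventually.of_forall fun i => Subgroup.npow_mem_zpowers _ _)
    have hu' : u ∈ principalUnits p := hu
    have key : ∀ i, ‖((m i : ℚ_[p]) - exponent hp2 u) * unitLog (gen p)‖ =
        ‖(((gen p ^ m i : ℤ_[p]ˣ) : ℤ_[p]) : ℚ_[p]) - (u : ℤ_[p])‖ := fun i => by
      have h1 : gen p ^ m i * u⁻¹ ∈ principalUnits p :=
        mul_mem (pow_mem gen_mem _) (inv_mem hu')
      have h2 := norm_unitLog hp2 h1
      have h3 : unitLog (gen p ^ m i * u⁻¹) =
          ((m i : ℚ_[p]) - exponent hp2 u) * unitLog (gen p) := by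
        have h4 := unitLog_mul h1 hu'
        rw [inv_mul_cancel_right, unitLog_pow gen_mem, nsmul_eq_mul] at h4
        rw [coe_exponent_of_mem hp2 hu', sub_mul, div_mul_cancel₀ _ (unitLog_gen_ne_zero hp2), h4]
        ring
      rw [← h3, h2]
      have h5 : (((gen p ^ m i : ℤ_[p]ˣ) : ℤ_[p]) : ℚ_[p]) - (u : ℤ_[p]) =
          ((((gen p ^ m i * u⁻¹ : ℤ_[p]ˣ) : ℤ_[p]) : ℚ_[p]) - 1) * (u : ℤ_[p]) := by
        rw [sub_mul, ← PadicInt.coe_mul, ← Units.val_mul, inv_mul_cancel_right, one_mul]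
      rw [h5, norm_mul, ← PadicInt.norm_def (z := (u : ℤ_[p])), PadicInt.norm_units, mul_one]
    refine Tendsto.congr key ?_
    have h6 : Tendsto (fun i => (m i : ℚ_[p])) atTop (𝓝 (exponent hp2 u : ℚ_[p])) := by
      have h7 : Continuous fun z : ℤ_[p] => (z : ℚ_[p]) := continuous_subtype_val
      refine ((h7.tendsto _).comp hk.2).congr fun i => ?_
      rw [Function.comp_apply, ← hm i, PadicInt.coe_natCast]
    have h8 := ((h6.sub_const (exponent hp2 u : ℚ_[p])).mul_const (unitLog (gen p))).norm
    rwa [sub_self, zero_mul, norm_zero] at h8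

/-- A closed subgroup containing a topological generator contains `1 + p ℤ_p`. -/
lemma IsGenerator.mem_of_isClosed {γ : ℤ_[p]ˣ} (hγ : IsGenerator γ) {H : Subgroup ℤ_[p]ˣ}
    (hH : IsClosed (H : Set ℤ_[p]ˣ)) (hγH : γ ∈ H) {u : ℤ_[p]ˣ} (hu : u ∈ principalUnits p) :
    u ∈ H := by
  have h1 : u ∈ closure (Subgroup.zpowers γ : Set ℤ_[p]ˣ) := by rw [hγ]; exact hu
  exact closure_minimal (Subgroup.zpowers_le.2 hγH) hH h1

lemma IsGenerator.mem_principalUnits {γ : ℤ_[p]ˣ} (hγ : IsGenerator γ) : γ ∈ principalUnits p := by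
  have h1 : γ ∈ closure (Subgroup.zpowers γ : Set ℤ_[p]ˣ) :=
    subset_closure (Subgroup.mem_zpowers γ)
  rw [hγ] at h1
  exact h1

/-- An open subgroup containing a topological generator contains `1 + p ℤ_p`. -/
lemma IsGenerator.mem_of_mem_nhds {γ : ℤ_[p]ˣ} (hγ : IsGenerator γ) {H : Subgroup ℤ_[p]ˣ}
    (hH : (H : Set ℤ_[p]ˣ) ∈ 𝓝 1) (hγH : γ ∈ H) {u : ℤ_[p]ˣ} (hu : u ∈ principalUnits p) : u ∈ H :=
  hγ.mem_of_isClosed (Subgroup.isClosed_of_isOpen _ (Subgroup.isOpen_of_mem_nhds _ hH)) hγH hu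

/-- A continuous homomorphism `D` on `1 + p ℤ_p` vanishing at a topological generator is zero. -/
lemma IsGenerator.eq_zero {γ : ℤ_[p]ˣ} (hγ : IsGenerator γ) {R : Type*} [NormedAddCommGroup R]
    [IsUltrametricDist R] {D : ℤ_[p]ˣ → R}
    (hD : ∀ u ∈ principalUnits p, ∀ v ∈ principalUnits p, D (u * v) = D u + D v)
    (hDc : Tendsto D (𝓝 1) (𝓝 0)) (hDγ : D γ = 0) {u : ℤ_[p]ˣ} (hu : u ∈ principalUnits p) :
    D u = 0 := by
  have h1 : D 1 = 0 := by simpa using hD 1 (one_mem _) 1 (one_mem _)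
  rw [← norm_le_zero_iff]
  refine le_of_forall_gt fun ε hε => ?_
  let H : Subgroup ℤ_[p]ˣ :=
    { carrier := {u | u ∈ principalUnits p ∧ ‖D u‖ < ε}
      one_mem' := ⟨one_mem _, by rwa [h1, norm_zero]⟩
      mul_mem' := fun {u v} hu hv => ⟨mul_mem hu.1 hv.1, by
        rw [hD u hu.1 v hv.1]
        exact (IsUltrametricDist.norm_add_le_max _ _).trans_lt (max_lt hu.2 hv.2)⟩
      inv_mem' := fun {u} hu => ⟨inv_mem hu.1, by
        have h2 := hD u hu.1 u⁻¹ (inv_mem hu.1)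
        rw [mul_inv_cancel, h1] at h2
        rw [← norm_neg, neg_eq_of_add_eq_zero_left h2.symm]
        exact hu.2⟩ }
  refine (hγ.mem_of_mem_nhds (H := H) ?_ ⟨hγ.mem_principalUnits, by rwa [hDγ, norm_zero]⟩ hu).2
  refine inter_mem principalUnits_mem_nhds ?_
  have h3 := hDc.norm
  rw [norm_zero] at h3
  exact h3.eventually (eventually_lt_nhds hε)

lemma IsGenerator.unitLog_ne_zero (hp2 : p ≠ 2) {γ : ℤ_[p]ˣ} (hγ : IsGenerator γ) :
    unitLog γ ≠ 0 := fun h =>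
  unitLog_gen_ne_zero hp2 (hγ.eq_zero (fun _ hu _ hv => unitLog_mul hu hv) (tendsto_unitLog hp2) h
    gen_mem)

end

/-! ### Characters in the identity component -/

section

variable {p : ℕ} [hp : Fact p.Prime] {R : AffinoidAlgebra p}

/-- The value `ψ(u)` of a character in the identity component. -/
def chi (ψ : (identityComponent p).toGroup.obj R) (u : ℤ_[p]ˣ) : R :=
  charValue ((identityComponent p).ι.app R ψ) u

lemma chi_mul_char (ψ ψ' : (identityComponent p).toGroup.obj R) (u : ℤ_[p]ˣ) :
    chi (ψ * ψ') u = chi ψ u * chi ψ' u := rfl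

lemma chi_one_char (u : ℤ_[p]ˣ) : chi (1 : (identityComponent p).toGroup.obj R) u = 1 := rfl

lemma chi_pow_char (ψ : (identityComponent p).toGroup.obj R) (n : ℕ) (u : ℤ_[p]ˣ) :
    chi (ψ ^ n) u = chi ψ u ^ n := by
  induction n with
  | zero => simp [chi_one_char]
  | succ n ih => rw [pow_succ, pow_succ, chi_mul_char, ih]

lemma chi_map {R' : AffinoidAlgebra p} (f : R ⟶ R') (ψ : (identityComponent p).toGroup.obj R)
    (u : ℤ_[p]ˣ) : chi ((identityComponent p).toGroup.map f ψ) u = f (chi ψ u) := rfl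

lemma chi_mul (ψ : (identityComponent p).toGroup.obj R) (u v : ℤ_[p]ˣ) :
    chi ψ (u * v) = chi ψ u * chi ψ v := by
  rw [chi, charValue, map_mul, Units.val_mul]; rfl

lemma chi_one (ψ : (identityComponent p).toGroup.obj R) : chi ψ 1 = 1 := by
  rw [chi, charValue, map_one, Units.val_one]

lemma chi_pow (ψ : (identityComponent p).toGroup.obj R) (u : ℤ_[p]ˣ) (n : ℕ) :
    chi ψ (u ^ n) = chi ψ u ^ n := by
  rw [chi, charValue, map_pow, Units.val_pow_eq_pow_val]; rfl

lemma continuous_chi (ψ : (identityComponent p).toGroup.obj R) : Continuous (chi ψ) :=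
  Units.continuous_val.comp
    (map_continuous (show ℤ_[p]ˣ →ₜ* Rˣ from (identityComponent p).ι.app R ψ))

lemma chi_root_of_unity (ψ : (identityComponent p).toGroup.obj R) {ζ : ℤ_[p]ˣ}
    (hζ : ζ ^ (p - 1) = 1) : chi ψ ζ = 1 := ψ.2 ζ hζ

lemma growthLE_chi (ψ : (identityComponent p).toGroup.obj R) (u : ℤ_[p]ˣ) :
    GrowthLE (chi ψ u) 1 := growthLE_one_iff.2 (isPowerBounded_charValue _ _)

lemma tendsto_chi (ψ : (identityComponent p).toGroup.obj R) : Tendsto (chi ψ) (𝓝 1) (𝓝 1) := by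
  simpa only [chi_one] using (continuous_chi ψ).tendsto 1

lemma eventually_norm_chi_sub_one_le (ψ : (identityComponent p).toGroup.obj R) (n : ℕ) :
    ∀ᶠ u in 𝓝 (1 : ℤ_[p]ˣ), ‖chi ψ u - 1‖ ≤ discRadius p n := by
  have h := (tendsto_iff_norm_sub_tendsto_zero.1 (tendsto_chi ψ))
  exact (h.eventually (eventually_lt_nhds (discRadius_pos p n))).mono fun _ h => h.le

lemma tendsto_pow_prime_pow (hp2 : p ≠ 2) {u : ℤ_[p]ˣ} (hu : u ∈ principalUnits p) :
    Tendsto (fun n : ℕ => u ^ p ^ n) atTop (𝓝 1) := by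
  refine tendsto_units_val ?_
  have h := (tendsto_norm_prime_pow (p := p)).mul_const ‖unitLog u‖
  rw [zero_mul] at h
  refine h.congr fun n => ?_
  rw [Units.val_one, PadicInt.coe_one, ← norm_unitLog hp2 (pow_mem hu _), unitLog_pow hu,
    nsmul_eq_mul, norm_mul, Nat.cast_pow, norm_pow, Padic.norm_p, inv_pow]

/-- Every character lies in one of the discs: `ψ(u) ^ p ^ n = ψ(u ^ p ^ n)` tends to `1`. -/
lemma exists_growthLE_chi_sub_one (hp2 : p ≠ 2) (ψ : (identityComponent p).toGroup.obj R)
    {u : ℤ_[p]ˣ} (hu : u ∈ principalUnits p) : ∃ n, GrowthLE (chi ψ u - 1) (discRadius p n) := by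
  obtain ⟨n, hn⟩ := ((tendsto_pow_prime_pow hp2 hu).eventually
    (eventually_norm_chi_sub_one_le ψ 0)).exists
  rw [chi_pow] at hn
  exact ⟨0 + n, (growthLE_chi ψ u).sub_one_of_pow_prime_pow (.of_norm_le hn)⟩

lemma growthLE_chi_sub_one_of_isGenerator (ψ : (identityComponent p).toGroup.obj R) {n : ℕ}
    {γ : ℤ_[p]ˣ} (hγ : IsGenerator γ) (h : GrowthLE (chi ψ γ - 1) (discRadius p n))
    {u : ℤ_[p]ˣ} (hu : u ∈ principalUnits p) : GrowthLE (chi ψ u - 1) (discRadius p n) := by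
  have h0 := (discRadius_pos p n).le
  let H : Subgroup ℤ_[p]ˣ :=
    { carrier := {u | GrowthLE (chi ψ u - 1) (discRadius p n)}
      one_mem' := by
        change GrowthLE (chi ψ 1 - 1) _
        rw [chi_one, sub_self]
        exact growthLE_zero h0
      mul_mem' := fun {u v} hu hv => by
        change GrowthLE (chi ψ (u * v) - 1) _
        rw [chi_mul]
        exact GrowthLE.mul_sub_one h0 (discRadius_lt_one p n).le hu hv
      inv_mem' := fun {u} hu => by
        change GrowthLE (chi ψ u⁻¹ - 1) _
        have h1 : chi ψ u * chi ψ u⁻¹ = 1 := by rw [← chi_mul, mul_inv_cancel, chi_one]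
        have e : chi ψ u⁻¹ - 1 = -(chi ψ u⁻¹ * (chi ψ u - 1)) := by linear_combination h1
        rw [e]
        simpa using ((growthLE_chi ψ u⁻¹).mul hu).neg }
  refine hγ.mem_of_mem_nhds (H := H) ?_ h hu
  filter_upwards [eventually_norm_chi_sub_one_le ψ n] with u hu
  exact GrowthLE.of_norm_le hu

lemma mem_disc_iff_of_isGenerator {n : ℕ} {γ : ℤ_[p]ˣ} (hγ : IsGenerator γ)
    {ψ : (identityComponent p).toGroup.obj R} :
    ψ ∈ (disc p n).obj R ↔ GrowthLE (chi ψ γ - 1) (discRadius p n) := by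
  refine ⟨fun h => (supNormLE_iff_growthLE (discRadius_pos p n) (discRadius_pow p n)).1 (h γ hγ),
    fun h γ' hγ' => (supNormLE_iff_growthLE (discRadius_pos p n) (discRadius_pow p n)).2 ?_⟩
  exact growthLE_chi_sub_one_of_isGenerator ψ hγ h hγ'.mem_principalUnits

lemma mem_disc_iff (hp2 : p ≠ 2) {n : ℕ} {ψ : (identityComponent p).toGroup.obj R} :
    ψ ∈ (disc p n).obj R ↔ GrowthLE (chi ψ (gen p) - 1) (discRadius p n) :=
  mem_disc_iff_of_isGenerator (isGenerator_gen hp2)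

lemma exists_mem_disc (hp2 : p ≠ 2) (ψ : (identityComponent p).toGroup.obj R) :
    ∃ n, ψ ∈ (disc p n).obj R := by
  obtain ⟨n, hn⟩ := exists_growthLE_chi_sub_one hp2 ψ gen_mem
  exact ⟨n, (mem_disc_iff hp2).2 hn⟩

lemma disc_mono {m n : ℕ} (h : m ≤ n) (R : AffinoidAlgebra p) :
    (disc p m).obj R ≤ (disc p n).obj R :=
  monotone_nat_of_le_succ (f := fun n => (disc p n).obj R) (fun n => disc_le_succ p n R) h

lemma char_ext' {ψ ψ' : (identityComponent p).toGroup.obj R} (h : ∀ u, chi ψ u = chi ψ' u) :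
    ψ = ψ' := by
  refine Subtype.ext ?_
  change (show ℤ_[p]ˣ →ₜ* Rˣ from ψ.1) = (show ℤ_[p]ˣ →ₜ* Rˣ from ψ'.1)
  exact ContinuousMonoidHom.ext fun u => Units.ext (h u)

/-- A character in the identity component is determined by its value at a topological generator. -/
lemma char_ext (hp2 : p ≠ 2) {ψ ψ' : (identityComponent p).toGroup.obj R}
    (h : chi ψ (gen p) = chi ψ' (gen p)) : ψ = ψ' := by
  refine char_ext' fun u => ?_
  obtain ⟨ζ, hζ, hu⟩ := exists_root_of_unity u
  let H : Subgroup ℤ_[p]ˣ := MonoidHom.eqLocus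
    (show ℤ_[p]ˣ →ₜ* Rˣ from (identityComponent p).ι.app R ψ).toMonoidHom
    (show ℤ_[p]ˣ →ₜ* Rˣ from (identityComponent p).ι.app R ψ').toMonoidHom
  have hH : ∀ v, v ∈ H ↔ chi ψ v = chi ψ' v := fun v => Units.ext_iff
  have hc : IsClosed (H : Set ℤ_[p]ˣ) := by
    have : (H : Set ℤ_[p]ˣ) = {v | chi ψ v = chi ψ' v} := Set.ext hH
    rw [this]
    exact isClosed_eq (continuous_chi ψ) (continuous_chi ψ')
  have h1 := (hH _).1 ((isGenerator_gen hp2).mem_of_isClosed hc ((hH _).2 h) hu)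
  rw [← mul_inv_cancel_left ζ u, chi_mul ψ ζ, chi_mul ψ' ζ, h1, chi_root_of_unity ψ hζ,
    chi_root_of_unity ψ' hζ]

/-- There is a character with value `1 + t` at `1 + p`, if `t` is topologically nilpotent. -/
lemma exists_chi_gen_eq (hp2 : p ≠ 2) {t : R} (ht : Tendsto (fun k : ℕ => t ^ k) atTop (𝓝 0)) :
    ∃ ψ : (identityComponent p).toGroup.obj R, chi ψ (gen p) = 1 + t := by
  let _ : Algebra ℤ_[p] R := Algebra.compHom R (PadicInt.Coe.ringHom (p := p))
  have hb : IsBoundedSMul ℤ_[p] R := IsBoundedSMul.of_norm_smul_le fun c x => by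
    change ‖(c : ℚ_[p]) • x‖ ≤ _
    exact norm_smul_le _ _
  let κ := PadicInt.addChar_of_value_at_one (p := p) t ht
  have hκ : Continuous κ := PadicInt.continuous_addChar_of_value_at_one ht
  let f : ℤ_[p]ˣ →* R := κ.toMonoidHom.comp (exponentHom hp2)
  have hf : ∀ u, f u = κ (exponent hp2 u) := fun u => rfl
  have hfc : Continuous f := hκ.comp (continuous_exponentHom hp2)
  let F : ℤ_[p]ˣ →ₜ* Rˣ :=
    { f.toHomUnits with
      continuous_toFun := Units.continuous_iff.2 ⟨hfc, by
        have : (fun u : ℤ_[p]ˣ => ((f.toHomUnits u)⁻¹ : Rˣ).val) = fun u => f u⁻¹ := by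
          funext u
          rw [← map_inv]; rfl
        exact this ▸ hfc.comp continuous_inv⟩ }
  refine ⟨⟨F, fun ζ hζ => ?_⟩, ?_⟩
  · change f ζ = 1
    rw [hf, exponent_root_of_unity hp2 hζ, AddChar.map_zero_eq_one]
  · change f (gen p) = 1 + t
    rw [hf, exponent_gen]
    exact PadicInt.addChar_of_value_at_one_def ht

lemma exists_mem_disc_chi_gen_eq (hp2 : p ≠ 2) {x : R} {n : ℕ}
    (hx : GrowthLE (x - 1) (discRadius p n)) :
    ∃ ψ ∈ (disc p n).obj R, chi ψ (gen p) = x := by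
  obtain ⟨ψ, hψ⟩ := exists_chi_gen_eq hp2
    (hx.tendsto_pow (discRadius_pos p n).le (discRadius_lt_one p n))
  rw [add_sub_cancel] at hψ
  exact ⟨ψ, (mem_disc_iff hp2).2 (hψ ▸ hx), hψ⟩

end

/-! ### The function `ϑ` -/

section

variable {p : ℕ} [hp : Fact p.Prime] {R : AffinoidAlgebra p}

/-- The value `log ψ(1 + p) / log (1 + p)` of `ϑ` at `ψ`. -/
def thetaVal (ψ : (identityComponent p).toGroup.obj R) : R :=
  (unitLog (gen p))⁻¹ • plog p (chi ψ (gen p))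

lemma plog_chi_mul_char (hp2 : p ≠ 2) (ψ ψ' : (identityComponent p).toGroup.obj R) {u : ℤ_[p]ˣ}
    (hu : u ∈ principalUnits p) :
    plog p (chi (ψ * ψ') u) = plog p (chi ψ u) + plog p (chi ψ' u) := by
  obtain ⟨m, hm⟩ := exists_growthLE_chi_sub_one hp2 ψ hu
  obtain ⟨n, hn⟩ := exists_growthLE_chi_sub_one hp2 ψ' hu
  rw [chi_mul_char]
  exact plog_mul (discRadius_pos p _).le (discRadius_lt_one p (max m n))
    (hm.mono (discRadius_pos p _).le (discRadius_mono p (le_max_left _ _)))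
    (hn.mono (discRadius_pos p _).le (discRadius_mono p (le_max_right _ _)))

lemma plog_chi_mul (hp2 : p ≠ 2) (ψ : (identityComponent p).toGroup.obj R) {u v : ℤ_[p]ˣ}
    (hu : u ∈ principalUnits p) (hv : v ∈ principalUnits p) :
    plog p (chi ψ (u * v)) = plog p (chi ψ u) + plog p (chi ψ v) := by
  obtain ⟨m, hm⟩ := exists_growthLE_chi_sub_one hp2 ψ hu
  obtain ⟨n, hn⟩ := exists_growthLE_chi_sub_one hp2 ψ hv
  rw [chi_mul]
  exact plog_mul (discRadius_pos p _).le (discRadius_lt_one p (max m n))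
    (hm.mono (discRadius_pos p _).le (discRadius_mono p (le_max_left _ _)))
    (hn.mono (discRadius_pos p _).le (discRadius_mono p (le_max_right _ _)))

lemma hasSum_plog_chi (hp2 : p ≠ 2) (ψ : (identityComponent p).toGroup.obj R) {u : ℤ_[p]ˣ}
    (hu : u ∈ principalUnits p) : HasSum (logTerm (p := p) (chi ψ u)) (plog p (chi ψ u)) := by
  obtain ⟨m, hm⟩ := exists_growthLE_chi_sub_one hp2 ψ hu
  exact hasSum_plog (discRadius_pos p m).le (discRadius_lt_one p m) hm

lemma tendsto_plog_chi (ψ : (identityComponent p).toGroup.obj R) :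
    Tendsto (fun u => plog p (chi ψ u)) (𝓝 1) (𝓝 0) := by
  refine squeeze_zero_norm' ?_ (tendsto_iff_norm_sub_tendsto_zero.1 (tendsto_chi ψ))
  filter_upwards [eventually_norm_chi_sub_one_le ψ 0] with u hu
  exact norm_plog_le (hu.trans (discRadius_zero_le p))

/-- `log ψ(u)` is proportional to `log u`. -/
lemma plog_chi_eq (hp2 : p ≠ 2) (ψ : (identityComponent p).toGroup.obj R) {u : ℤ_[p]ˣ}
    (hu : u ∈ principalUnits p) : plog p (chi ψ u) = unitLog u • thetaVal ψ := by
  rw [← sub_eq_zero]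
  refine (isGenerator_gen hp2).eq_zero
    (D := fun u => plog p (chi ψ u) - unitLog u • thetaVal ψ) (fun u hu v hv => ?_) ?_ ?_ hu
  · rw [plog_chi_mul hp2 ψ hu hv, unitLog_mul hu hv, add_smul]
    abel
  · simpa using (tendsto_plog_chi ψ).sub ((tendsto_unitLog hp2).smul_const (thetaVal ψ))
  · rw [thetaVal, smul_smul, mul_inv_cancel₀ (unitLog_gen_ne_zero hp2), one_smul, sub_self]

lemma map_thetaVal (hp2 : p ≠ 2) {R' : AffinoidAlgebra p} (f : R ⟶ R')
    (ψ : (identityComponent p).toGroup.obj R) :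
    thetaVal ((identityComponent p).toGroup.map f ψ) = f (thetaVal ψ) := by
  obtain ⟨m, hm⟩ := exists_growthLE_chi_sub_one hp2 ψ gen_mem
  have h := plog_map (p := p) (show R →A[ℚ_[p]] R' from f) (discRadius_pos p m).le
    (discRadius_lt_one p m) hm
  rw [thetaVal, thetaVal, chi_map]
  refine Eq.trans ?_ (map_smul (show R →A[ℚ_[p]] R' from f) _ _).symm
  rw [h]
  rfl

/-- The analytic function `ϑ` on `𝒲⁰`. -/
def theta (hp2 : p ≠ 2) : (identityComponent p).toGroup.toSpace ⟶ affineLine p where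
  app R := ↾fun ψ => thetaVal (p := p) (R := R) ψ
  naturality R R' f := by
    ext ψ
    exact map_thetaVal hp2 f ψ

lemma theta_app (hp2 : p ≠ 2) (ψ : (identityComponent p).toGroup.obj R) :
    (theta hp2).app R ψ = thetaVal ψ := rfl

lemma isTheta_theta (hp2 : p ≠ 2) : IsTheta (theta (p := p) hp2) := fun γ hγ => by
  have hm := hγ.mem_principalUnits
  refine ⟨unitLog γ, hγ.unitLog_ne_zero hp2, ?_, fun R ψ => ?_⟩
  · exact hasSum_plog inv_prime_nonneg inv_prime_lt_one (growthLE_unit hm)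
  · rw [theta_app, ← plog_chi_eq hp2 ψ hm]
    exact hasSum_plog_chi hp2 ψ hm

lemma IsTheta.eq_theta (hp2 : p ≠ 2) {ϑ : (identityComponent p).toGroup.toSpace ⟶ affineLine p}
    (h : IsTheta ϑ) : ϑ = theta hp2 := by
  obtain ⟨l, hl0, hl, h⟩ := h (gen p) (isGenerator_gen hp2)
  have hl' : l = unitLog (gen p) := hl.unique
    (hasSum_plog inv_prime_nonneg inv_prime_lt_one (growthLE_unit gen_mem))
  ext R ψ
  have h1 := (h R ψ).unique (hasSum_plog_chi hp2 ψ gen_mem)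
  rw [plog_chi_eq hp2 ψ gen_mem, ← hl'] at h1
  exact smul_right_injective _ hl0 h1

lemma thetaVal_mul (hp2 : p ≠ 2) (ψ ψ' : (identityComponent p).toGroup.obj R) :
    thetaVal (ψ * ψ') = thetaVal ψ + thetaVal ψ' := by
  rw [thetaVal, plog_chi_mul_char hp2 _ _ gen_mem, smul_add]; rfl

lemma thetaVal_pow (hp2 : p ≠ 2) (ψ : (identityComponent p).toGroup.obj R) (n : ℕ) :
    thetaVal (ψ ^ n) = n • thetaVal ψ := by
  induction n with
  | zero => simp [thetaVal, chi_one_char]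
  | succ n ih => rw [pow_succ, thetaVal_mul hp2, ih, succ_nsmul]

/-- `ψ ↦ ψ ^ p ^ n` maps `𝒲⁰_{m+n}` to `𝒲⁰_m`, and `𝒲⁰_{m+n}` is the preimage of `𝒲⁰_m`. -/
lemma pow_mem_disc_iff (hp2 : p ≠ 2) {m n : ℕ} {ψ : (identityComponent p).toGroup.obj R} :
    ψ ^ p ^ n ∈ (disc p m).obj R ↔ ψ ∈ (disc p (m + n)).obj R := by
  rw [mem_disc_iff hp2, mem_disc_iff hp2, chi_pow_char]
  exact ⟨(growthLE_chi ψ _).sub_one_of_pow_prime_pow, growthLE_pow_prime_pow_sub_one⟩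

lemma growthLE_thetaVal_zero (hp2 : p ≠ 2) {ψ : (identityComponent p).toGroup.obj R}
    (h : ψ ∈ (disc p 0).obj R) : GrowthLE (thetaVal ψ) (quotRadius p 0) := by
  have h1 := (growthLE_plog ((mem_disc_iff hp2).1 h)).smul (unitLog (gen p))⁻¹
  rwa [norm_inv, norm_unitLog_gen hp2, inv_inv, ← one_mul (_ * _), ← pow_zero (p : ℝ),
    ← quotRadius_eq] at h1

lemma natCast_prime_pow_ne_zero (n : ℕ) : ((p ^ n : ℕ) : ℚ_[p]) ≠ 0 := by
  exact_mod_cast pow_ne_zero n hp.out.ne_zero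

lemma nsmul_eq_padic_smul {A : Type*} [NormedCommRing A] [NormedAlgebra ℚ_[p] A] (n : ℕ) (a : A) :
    n • a = (n : ℚ_[p]) • a := by
  rw [Nat.cast_smul_eq_nsmul]

lemma quotRadius_eq_mul_zero (n : ℕ) : quotRadius p n = (p : ℝ) ^ n * quotRadius p 0 := by
  rw [quotRadius_eq, quotRadius_eq, pow_zero, one_mul]

lemma norm_natCast_prime_pow (n : ℕ) : ‖((p ^ n : ℕ) : ℚ_[p])‖ = ((p : ℝ) ^ n)⁻¹ := by
  rw [Nat.cast_pow, norm_pow, Padic.norm_p, inv_pow]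

lemma growthLE_quotRadius_iff {A : Type*} [NormedCommRing A] [NormedAlgebra ℚ_[p] A] {a : A}
    {n : ℕ} :
    GrowthLE a (quotRadius p n) ↔ GrowthLE (p ^ n • a) (quotRadius p 0) := by
  have h0 := pow_pos (prime_real_pos p) n
  rw [nsmul_eq_padic_smul (p := p), quotRadius_eq_mul_zero]
  refine ⟨fun h => ?_, fun h => ?_⟩
  · have := h.smul ((p ^ n : ℕ) : ℚ_[p])
    rwa [norm_natCast_prime_pow, inv_mul_cancel_left₀ h0.ne'] at this
  · have := h.smul ((p ^ n : ℕ) : ℚ_[p])⁻¹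
    rwa [norm_inv, norm_natCast_prime_pow, inv_inv, smul_smul,
      inv_mul_cancel₀ (natCast_prime_pow_ne_zero n), one_smul] at this

lemma growthLE_thetaVal (hp2 : p ≠ 2) {n : ℕ} {ψ : (identityComponent p).toGroup.obj R}
    (h : ψ ∈ (disc p n).obj R) : GrowthLE (thetaVal ψ) (quotRadius p n) := by
  rw [growthLE_quotRadius_iff, ← thetaVal_pow hp2]
  refine growthLE_thetaVal_zero hp2 ((pow_mem_disc_iff hp2).2 ?_)
  rwa [zero_add]

/-- `ϑ` is injective on `𝒲⁰_0`, as the logarithm is injective on the small disc. -/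
lemma eq_of_thetaVal_eq (hp2 : p ≠ 2) {ψ ψ' : (identityComponent p).toGroup.obj R}
    (h : ψ ∈ (disc p 0).obj R) (h' : ψ' ∈ (disc p 0).obj R) (e : thetaVal ψ = thetaVal ψ') :
    ψ = ψ' := by
  refine char_ext hp2 (eq_of_plog_eq hp2 ((mem_disc_iff hp2).1 h) ((mem_disc_iff hp2).1 h') ?_)
  rw [plog_chi_eq hp2 ψ gen_mem, plog_chi_eq hp2 ψ' gen_mem, e]

/-- `ϑ : 𝒲⁰_0 → {|s| ≤ p ^ (-1 / (p - 1))}` is bijective, with inverse given by the exponential. -/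
lemma exists_thetaVal_eq (hp2 : p ≠ 2) {a : R} (ha : GrowthLE a (quotRadius p 0)) :
    ∃ ψ ∈ (disc p 0).obj R, thetaVal ψ = a := by
  have h1 := ha.smul (unitLog (gen p))
  have h2 : ‖unitLog (gen p)‖ * quotRadius p 0 = discRadius p 0 := by
    rw [norm_unitLog_gen hp2, quotRadius_eq, pow_zero, one_mul,
      inv_mul_cancel_left₀ (prime_real_pos p).ne']
  rw [h2] at h1
  obtain ⟨ψ, hψ, e⟩ := exists_mem_disc_chi_gen_eq hp2 (growthLE_exp_sub_one h1)
  refine ⟨ψ, hψ, ?_⟩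
  rw [thetaVal, e, plog_exp, smul_smul, inv_mul_cancel₀ (unitLog_gen_ne_zero hp2), one_smul]

/-- On `𝒲⁰_n`, the fibres of `ϑ` are the cosets of the `p ^ n`-torsion. -/
lemma pow_eq_one_iff_thetaVal (hp2 : p ≠ 2) {n : ℕ} {ψ : (identityComponent p).toGroup.obj R}
    (h : ψ ∈ (disc p n).obj R) : ψ ^ p ^ n = 1 ↔ thetaVal ψ = 0 := by
  have h1 : thetaVal (1 : (identityComponent p).toGroup.obj R) = 0 := by
    simpa using thetaVal_pow hp2 (1 : (identityComponent p).toGroup.obj R) 0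
  rw [← zero_add n, ← pow_mem_disc_iff hp2] at h
  have h2 : thetaVal (ψ ^ p ^ n) = 0 ↔ thetaVal ψ = 0 := by
    rw [thetaVal_pow hp2, nsmul_eq_padic_smul (p := p), smul_eq_zero_iff_right
      (natCast_prime_pow_ne_zero n)]
  rw [← h2]
  exact ⟨fun e => by rw [e, h1], fun e => eq_of_thetaVal_eq hp2 h (one_mem _) (e.trans h1.symm)⟩

lemma thetaVal_eq_zero_of_isOfFinOrder (hp2 : p ≠ 2) {ψ : (identityComponent p).toGroup.obj R}
    (h : IsOfFinOrder ψ) : thetaVal ψ = 0 := by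
  obtain ⟨n, hn, e⟩ := isOfFinOrder_iff_pow_eq_one.1 h
  have h1 := thetaVal_pow hp2 ψ n
  rw [e, ← pow_zero ψ, thetaVal_pow hp2, zero_smul, nsmul_eq_padic_smul (p := p)] at h1
  exact (smul_eq_zero_iff_right (by exact_mod_cast hn.ne')).1 h1.symm

end

/-! ### Functions on affinoids and maps out of quotients -/

section

variable {p : ℕ} [hp : Fact p.Prime]

/-- The function on `Sp A` given by an element of `A`. -/
def spFun {A : AffinoidAlgebra p} (a : A) : Sp A ⟶ affineLine p where
  app R := ↾fun (x : A ⟶ R) => x a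

/-- Every function on `Sp A` is given by an element of `A`. -/
lemma eq_spFun {A : AffinoidAlgebra p} (f : Sp A ⟶ affineLine p) :
    f = spFun ((f.app A (𝟙 A) : affineLine p |>.obj A) : A) := by
  ext R x
  have := congrArg (fun g => g (𝟙 A)) (f.naturality x)
  simp at this
  exact this

lemma spFun_injective {A : AffinoidAlgebra p} {a b : A} (h : spFun a = spFun b) : a = b := by
  have h1 := congrArg (fun f : Sp A ⟶ affineLine p => f.app A (𝟙 A)) h
  exact h1

/-- The morphism of affinoid spaces given by a homomorphism of algebras. -/
def spMap {A B : AffinoidAlgebra p} (φ : A ⟶ B) : Sp B ⟶ Sp A := coyoneda.map φ.op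

/-- A quotient map onto an affinoid space is universal for invariant maps to affinoid spaces.  The
homomorphism of algebras is obtained from the functions on the quotient, and its continuity from
the closed graph theorem. -/
lemma IsQuotient.existsUnique_desc {G : GroupSpace p} {H : SubgroupSpace G} {X : AffinoidAlgebra p}
    {q : G.toSpace ⟶ Sp X} (hq : IsQuotient H q) {A : AffinoidAlgebra p} (m : G.toSpace ⟶ Sp A)
    (hm : ∀ (R : AffinoidAlgebra p) (h : H.obj R) (g : G.obj R),
      m.app R ((h : G.obj R) * g) = m.app R g) :
    ∃! m' : Sp X ⟶ Sp A, q ≫ m' = m := by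
  let ev (R : AffinoidAlgebra p) (g : G.obj R) : X →A[ℚ_[p]] R := q.app R g
  let ev' (R : AffinoidAlgebra p) (g : G.obj R) : A →A[ℚ_[p]] R := m.app R g
  -- functions on `X` are determined by their pullbacks to `G`
  have huniq : ∀ x y : X, (∀ R g, ev R g x = ev R g y) → x = y := fun x y hxy => by
    obtain ⟨f', -, hf'⟩ := hq.functions (q ≫ spFun x) fun R h g =>
      congrArg (fun z : (Sp X).obj R => (spFun x).app R z) (hq.coincide R h g)
    refine spFun_injective ((hf' _ rfl).trans (hf' _ ?_).symm)
    ext R g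
    exact (hxy R g).symm
  have hex : ∀ a : A, ∃ x : X, ∀ R g, ev R g x = ev' R g a := fun a => by
    obtain ⟨f', hf', -⟩ := hq.functions (m ≫ spFun a) fun R h g =>
      congrArg (fun z : (Sp A).obj R => (spFun a).app R z) (hm R h g)
    rw [eq_spFun f'] at hf'
    exact ⟨_, fun R g => congrArg (fun f : G.toSpace ⟶ affineLine p => f.app R g) hf'⟩
  choose φ hφ using hex
  let φa : A →ₐ[ℚ_[p]] X :=
    { toFun := φ
      map_one' := huniq _ _ fun R g => by rw [hφ, map_one, map_one]
      map_mul' := fun a b => huniq _ _ fun R g => by rw [hφ, map_mul, map_mul, hφ, hφ]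
      map_zero' := huniq _ _ fun R g => by rw [hφ, map_zero, map_zero]
      map_add' := fun a b => huniq _ _ fun R g => by rw [hφ, map_add, map_add, hφ, hφ]
      commutes' := fun c => huniq _ _ fun R g =>
        by rw [hφ, AlgHomClass.commutes, AlgHomClass.commutes] }
  have hφc : Continuous φa.toLinearMap := by
    refine φa.toLinearMap.continuous_of_seq_closed_graph fun u a x hu hx => huniq _ _ fun R g => ?_
    have h1 : Tendsto (fun k => ev R g (φ (u k))) atTop (𝓝 (ev R g x)) :=
      ((ev R g).continuous.tendsto x).comp hx
    have h2 : Tendsto (fun k => ev' R g (u k)) atTop (𝓝 (ev' R g a)) :=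
      ((ev' R g).continuous.tendsto a).comp hu
    refine tendsto_nhds_unique h1 ?_
    simp only [hφ]
    exact (hφ a R g).symm ▸ h2
  let Φ : A →A[ℚ_[p]] X := { φa with cont := hφc }
  refine ⟨spMap (show A ⟶ X from Φ), ?_, fun m' hm' => ?_⟩
  · ext R g
    exact ContinuousAlgHom.ext fun a => hφ a R g
  · obtain ⟨ψ, rfl⟩ : ∃ ψ : A ⟶ X, m' = spMap ψ :=
      ⟨coyonedaEquiv m', (coyonedaEquiv.symm_apply_apply m').symm⟩
    have h : (show A →A[ℚ_[p]] X from ψ) = Φ := ContinuousAlgHom.ext fun a =>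
      huniq _ _ fun R g => by
        have h1 := congrArg (fun f : G.toSpace ⟶ Sp A => (show A →A[ℚ_[p]] R from f.app R g) a) hm'
        exact h1.trans (hφ a R g).symm
    exact congrArg spMap h

end

/-! ### Invariant functions on the disc -/

section

variable {A : Type*} [NormedCommRing A] [IsUltrametricDist A] {N : ℕ}

lemma coeff_X_pow_mul (G : RSeries A 1) (k : ℕ) :
    RSeries.coeff k (RSeries.X ^ N * G) = if N ≤ k then RSeries.coeff (k - N) G else 0 := by
  rw [RSeries.coeff_def, map_mul, map_pow, RSeries.toPowerSeries_X, PowerSeries.coeff_X_pow_mul']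
  rfl

variable [CompleteSpace A]

lemma summable_coeff_mul (hN : 0 < N) (G : RSeries A 1) :
    Summable fun k => RSeries.coeff (N * k) G := by
  refine NonarchimedeanAddGroup.summable_of_tendsto_cofinite_zero ?_
  rw [Nat.cofinite_eq_atTop, tendsto_zero_iff_norm_tendsto_zero]
  have h := (RSeries.tendsto_coeff G).comp (tendsto_mul_add_atTop hN 0)
  simpa [Function.comp_def] using h

/-- The sum of the coefficients of the powers of `X ^ N`, that is, the coefficient of `1` with
respect to the basis `1, X, …, X ^ (N - 1)` modulo `X ^ N - 1`. -/
def multSum (hN : 0 < N) : RSeries A 1 →+ A where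
  toFun G := ∑' k, RSeries.coeff (N * k) G
  map_zero' := by simp
  map_add' G G' := by
    simp only [map_add]
    exact (summable_coeff_mul hN G).tsum_add (summable_coeff_mul hN G')

lemma multSum_apply (hN : 0 < N) (G : RSeries A 1) :
    multSum hN G = ∑' k, RSeries.coeff (N * k) G := rfl

lemma continuous_multSum (hN : 0 < N) : Continuous (multSum (A := A) hN) :=
  (AddMonoidHomClass.lipschitz_of_bound (multSum (A := A) hN) 1 fun G => by
    rw [one_mul]
    refine IsUltrametricDist.norm_tsum_le_of_forall_le_of_nonneg (norm_nonneg _) fun k => ?_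
    simpa using RSeries.norm_coeff_le G (N * k)).continuous

lemma multSum_smul (hN : 0 < N) (a : A) (G : RSeries A 1) :
    multSum hN (a • G) = a * multSum hN G := by
  simp only [multSum_apply, RSeries.coeff_smul, smul_eq_mul]
  exact (summable_coeff_mul hN G).tsum_mul_left a

lemma multSum_X_pow (hN : 0 < N) {j : ℕ} (hj : j < N) :
    multSum hN (RSeries.X ^ j : RSeries A 1) = if j = 0 then 1 else 0 := by
  rw [multSum_apply, tsum_eq_single 0 fun k hk => ?_]
  · rw [mul_zero, RSeries.X_pow, RSeries.coeff_monomial]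
    simp only [eq_comm]
  · rw [RSeries.X_pow, RSeries.coeff_monomial, if_neg]
    have := Nat.le_mul_of_pos_right N (Nat.pos_of_ne_zero hk)
    omega

lemma multSum_mul_eq_zero (hN : 0 < N) (G : RSeries A 1) :
    multSum hN ((RSeries.X ^ N - 1) * G) = 0 := by
  have h : multSum hN (RSeries.X ^ N * G) = multSum hN G := by
    have hs := summable_coeff_mul hN (RSeries.X ^ N * G)
    rw [multSum_apply, multSum_apply, hs.tsum_eq_zero_add, mul_zero, coeff_X_pow_mul,
      if_neg (by omega), zero_add]
    refine tsum_congr fun k => ?_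
    rw [coeff_X_pow_mul, if_pos (Nat.le_mul_of_pos_right N k.succ_pos), mul_add, mul_one,
      Nat.add_sub_cancel]
  rw [sub_mul, one_mul, map_sub, h, sub_self]

lemma multSum_eq_zero_of_mem (hN : 0 < N) {G : RSeries A 1}
    (hG : G ∈ (Ideal.span {(RSeries.X ^ N - 1 : RSeries A 1)}).closure) : multSum hN G = 0 := by
  have hc : IsClosed {G : RSeries A 1 | multSum hN G = 0} :=
    isClosed_eq (continuous_multSum hN) continuous_const
  refine closure_minimal (fun G hG => ?_) hc hG
  obtain ⟨G', rfl⟩ := Ideal.mem_span_singleton.1 hG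
  exact multSum_mul_eq_zero hN G'

lemma multSum_smul_X_sub_one_pow (hN : 0 < N) (a : A) {i : ℕ} (hi : i < N) :
    multSum hN ((a • RSeries.X + (-1 : RSeries A 1)) ^ i) = (-1) ^ i := by
  have h : (a • RSeries.X + (-1 : RSeries A 1)) ^ i = ∑ j ∈ Finset.range (i + 1),
      (a ^ j * (-1) ^ (i - j) * (i.choose j : A)) • (RSeries.X : RSeries A 1) ^ j := by
    rw [add_pow]
    refine Finset.sum_congr rfl fun j _ => ?_
    simp only [Algebra.smul_def, map_mul, map_pow, map_neg, map_one, map_natCast, mul_pow]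
    ring
  rw [h, map_sum, Finset.sum_eq_single 0]
  · rw [multSum_smul, multSum_X_pow hN hN]
    simp
  · intro j hj hj0
    rw [multSum_smul, multSum_X_pow hN (by have := Finset.mem_range.1 hj; omega), if_neg hj0,
      mul_zero]
  · simp

end

section

variable {p : ℕ} [hp : Fact p.Prime]

/-- The function `(1 + X) ^ p ^ n - 1` on the disc `|X| ≤ discRadius p n`. -/
def powMap (p : ℕ) [Fact p.Prime] (n : ℕ) : RSeries ℚ_[p] (discRadius p n) :=
  (1 + RSeries.X) ^ p ^ n - 1

lemma norm_powMap_le (n : ℕ) : ‖powMap p n‖ ≤ discRadius p 0 := by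
  refine norm_pow_prime_pow_sub_one_le ?_
  rw [zero_add]
  exact norm_one_add_X_sub_one_le n

/-- Composition of functions on the disc of radius `discRadius p 0` with `(1 + X) ^ p ^ n - 1`. -/
def powHom (p : ℕ) [Fact p.Prime] (n : ℕ) :
    RSeries ℚ_[p] (discRadius p 0) →A[ℚ_[p]] RSeries ℚ_[p] (discRadius p n) :=
  RSeries.eval (powMap p n) (.of_norm_le (norm_powMap_le n))

lemma powHom_X (n : ℕ) : powHom p n RSeries.X = powMap p n := RSeries.eval_X _

lemma powMap_eq_sum (n M : ℕ) (hM : p ^ n = M + 1) : powMap p n =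
    ∑ i ∈ Finset.range M, ((p ^ n).choose (i + 1) : ℚ_[p]) • RSeries.X ^ (i + 1) +
      RSeries.X ^ (M + 1) := by
  have h := add_pow (RSeries.X : RSeries ℚ_[p] (discRadius p n)) 1 (M + 1)
  rw [Finset.sum_range_succ', Finset.sum_range_succ] at h
  rw [powMap, hM, add_comm (1 : RSeries ℚ_[p] (discRadius p n)), h]
  simp [Algebra.smul_def, mul_comm]

lemma norm_choose_mul_le (n i : ℕ) :
    ‖((p ^ n).choose (i + 1) : ℚ_[p])‖ * discRadius p n ^ (i + 1) ≤ discRadius p n ^ p ^ n := by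
  have h := discRadius_pow_pow p 0 n
  rw [zero_add] at h
  rw [h]
  refine le_trans ?_ (norm_powMap_le n)
  have h1 : RSeries.coeff (i + 1) (powMap p n) = ((p ^ n).choose (i + 1) : ℚ_[p]) := by
    have h2 : (1 + PowerSeries.X : PowerSeries ℚ_[p]) ^ p ^ n =
        (((1 + Polynomial.X) ^ p ^ n : Polynomial ℚ_[p]) : PowerSeries ℚ_[p]) := by simp
    rw [powMap, map_sub, RSeries.coeff_one, if_neg i.succ_ne_zero, sub_zero, RSeries.coeff_def,
      map_pow, map_add, map_one, RSeries.toPowerSeries_X, h2, Polynomial.coeff_coe,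
      Polynomial.coeff_one_add_X_pow]
  rw [← h1]
  exact RSeries.norm_coeff_le _ _

/-- The coefficients of `X ^ m` in the basis `1, X, …, X ^ (p ^ n - 1)` over the functions of
`(1 + X) ^ p ^ n - 1`. -/
def reduction (p : ℕ) [Fact p.Prime] (n : ℕ) : ℕ → ℕ → RSeries ℚ_[p] (discRadius p 0)
  | 0, 0 => 1
  | 0, _ + 1 => 0
  | m + 1, 0 => RSeries.X * reduction p n m (p ^ n - 1)
  | m + 1, i + 1 =>
    reduction p n m i - ((p ^ n).choose (i + 1) : ℚ_[p]) • reduction p n m (p ^ n - 1)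

lemma X_pow_eq_sum_reduction (n m : ℕ) : (RSeries.X : RSeries ℚ_[p] (discRadius p n)) ^ m =
    ∑ i ∈ Finset.range (p ^ n), powHom p n (reduction p n m i) * RSeries.X ^ i := by
  obtain ⟨M, hM⟩ := Nat.exists_eq_succ_of_ne_zero (pow_ne_zero n hp.out.ne_zero)
  have hM' : p ^ n - 1 = M := by rw [hM]; rfl
  rw [hM]
  induction m with
  | zero =>
    rw [Finset.sum_range_succ']
    simp [reduction]
  | succ m ih =>
    have hT := powMap_eq_sum (p := p) n M hM
    rw [pow_succ', ih, Finset.sum_range_succ, Finset.sum_range_succ']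
    simp only [reduction, hM', map_sub, map_mul, powHom_X, map_smul, hT]
    simp only [sub_mul, Finset.sum_sub_distrib, mul_add, add_mul, Finset.mul_sum, Finset.sum_mul,
      pow_zero, mul_one]
    have h1 : ∀ i, RSeries.X * (powHom p n (reduction p n m i) * RSeries.X ^ i) =
        powHom p n (reduction p n m i) * RSeries.X ^ (i + 1) := fun i => by ring
    have h2 : ∀ i, ((p ^ n).choose (i + 1) : ℚ_[p]) • powHom p n (reduction p n m M) *
        RSeries.X ^ (i + 1) = ((p ^ n).choose (i + 1) : ℚ_[p]) • RSeries.X ^ (i + 1) *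
        powHom p n (reduction p n m M) := fun i => by
      rw [smul_mul_assoc, smul_mul_assoc, mul_comm]
    simp only [h1, h2]
    ring

lemma norm_reduction_le (n m i : ℕ) (hi : i < p ^ n) :
    ‖reduction p n m i‖ * discRadius p n ^ i ≤ discRadius p n ^ m := by
  have h0 := discRadius_pos p n
  have hN : p ^ n - 1 + 1 = p ^ n :=
    Nat.sub_add_cancel (Nat.pos_of_ne_zero (pow_ne_zero n hp.out.ne_zero))
  induction m generalizing i with
  | zero => rcases i with _ | i <;> simp [reduction]
  | succ m ih =>
    have h1 := ih (p ^ n - 1) (by omega)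
    have h2 : discRadius p n ^ p ^ n * ‖reduction p n m (p ^ n - 1)‖ ≤
        discRadius p n ^ (m + 1) := by
      rw [← hN, pow_succ, hN, pow_succ, mul_right_comm, mul_comm (_ ^ _) ‖_‖]
      exact mul_le_mul_of_nonneg_right h1 h0.le
    rcases i with _ | i
    · rw [reduction, pow_zero, mul_one]
      refine (norm_mul_le _ _).trans (le_trans ?_ h2)
      have h := discRadius_pow_pow p 0 n
      rw [zero_add] at h
      rw [h]
      exact mul_le_mul_of_nonneg_right RSeries.norm_X_le (norm_nonneg _)
    · rw [reduction]
      rw [sub_eq_add_neg]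
      refine (mul_le_mul_of_nonneg_right (IsUltrametricDist.norm_add_le_max _ _)
        (pow_nonneg h0.le _)).trans ?_
      rw [norm_neg, max_mul_of_nonneg _ _ (pow_nonneg h0.le _)]
      refine max_le ?_ ?_
      · rw [pow_succ, pow_succ, ← mul_assoc]
        exact mul_le_mul_of_nonneg_right (ih i (by omega)) h0.le
      · refine le_trans ?_ ((mul_le_mul_of_nonneg_right (norm_choose_mul_le n i)
          (norm_nonneg _)).trans h2)
        rw [mul_right_comm]
        exact mul_le_mul_of_nonneg_right (norm_smul_le _ _) (pow_nonneg h0.le _)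

/-- The functions on the disc of radius `discRadius p n` are generated by the powers `X ^ i`,
`i < p ^ n`, over the functions of `(1 + X) ^ p ^ n - 1`. -/
lemma exists_eq_sum_powHom (n : ℕ) (F : RSeries ℚ_[p] (discRadius p n)) :
    ∃ f : ℕ → RSeries ℚ_[p] (discRadius p 0),
      F = ∑ i ∈ Finset.range (p ^ n), powHom p n (f i) * RSeries.X ^ i := by
  have h0 := discRadius_pos p n
  have hs : ∀ i ∈ Finset.range (p ^ n),
      Summable fun m => RSeries.coeff m F • reduction p n m i := fun i hi => by
    refine summable_smul_of_tendsto (w := fun m => discRadius p n ^ m)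
      (K := (discRadius p n ^ i)⁻¹) (fun m => ?_) ?_
    · rw [inv_mul_eq_div, le_div_iff₀ (pow_pos h0 _)]
      exact norm_reduction_le n m i (Finset.mem_range.1 hi)
    · rw [Nat.cofinite_eq_atTop]
      exact RSeries.tendsto_coeff F
  refine ⟨fun i => ∑' m, RSeries.coeff m F • reduction p n m i, ?_⟩
  refine (RSeries.hasSum_smul_X_pow F).unique (HasSum.congr_fun (hasSum_sum fun i hi =>
    (((hs i hi).hasSum.map (powHom p n) (powHom p n).continuous).mul_right _)) fun m => ?_)
  rw [X_pow_eq_sum_reduction, Finset.smul_sum]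
  exact Finset.sum_congr rfl fun i _ => by
    rw [Function.comp_apply, map_smul, smul_mul_assoc]

end

/-! ### The quotient of `𝒲⁰_n` by its `p ^ n`-torsion -/

section

variable {p : ℕ} [hp : Fact p.Prime]

/-- The algebra of functions on `𝒲⁰_n`. -/
abbrev discAlg (p : ℕ) [Fact p.Prime] (n : ℕ) : AffinoidAlgebra p :=
  discAlgebra p (discRadius p n) (discRadius_pow p n)

/-- The algebra of functions on the disc of radius `p ^ (n - 1 / (p - 1))`. -/
abbrev quotAlg (p : ℕ) [Fact p.Prime] (n : ℕ) : AffinoidAlgebra p :=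
  discAlgebra p (quotRadius p n) (quotRadius_pow p n)

/-- The homomorphism of evaluation at an element, as a morphism of affinoid algebras. -/
def discEval {r : ℝ} [Fact (0 < r)] (hd : ∃ (N : ℕ) (d : ℚ_[p]), 0 < N ∧ ‖d‖ * r ^ N = 1)
    {R : AffinoidAlgebra p} (a : R) (ha : GrowthLE a r) : discAlgebra p r hd ⟶ R :=
  show RSeries ℚ_[p] r →A[ℚ_[p]] R from RSeries.eval a ha

/-- A homomorphism from the functions on a disc, as a continuous homomorphism. -/
def discHom {r : ℝ} [Fact (0 < r)] {hd : ∃ (N : ℕ) (d : ℚ_[p]), 0 < N ∧ ‖d‖ * r ^ N = 1}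
    {R : AffinoidAlgebra p} (φ : discAlgebra p r hd ⟶ R) : RSeries ℚ_[p] r →A[ℚ_[p]] R := φ

lemma growthLE_discHom_X {r : ℝ} [Fact (0 < r)]
    {hd : ∃ (N : ℕ) (d : ℚ_[p]), 0 < N ∧ ‖d‖ * r ^ N = 1} {R : AffinoidAlgebra p}
    (φ : discAlgebra p r hd ⟶ R) : GrowthLE (discHom φ RSeries.X) r :=
  (GrowthLE.of_norm_le RSeries.norm_X_le).map (discHom φ)

lemma exists_universal (hp2 : p ≠ 2) (n : ℕ) : ∃ U : (disc p n).toGroup.obj (discAlg p n),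
    chi U.1 (gen p) = (1 + RSeries.X : RSeries ℚ_[p] (discRadius p n)) := by
  obtain ⟨ψ, hψ, e⟩ := exists_mem_disc_chi_gen_eq (R := discAlg p n) hp2
    (.of_norm_le (norm_one_add_X_sub_one_le (p := p) n))
  exact ⟨⟨ψ, hψ⟩, e⟩

/-- The homomorphism `discAlg p n ⟶ R` corresponding to a point of `𝒲⁰_n`. -/
def charEval (hp2 : p ≠ 2) {n : ℕ} {R : AffinoidAlgebra p} (ψ : (disc p n).toGroup.obj R) :
    discAlg p n ⟶ R := discEval _ (chi ψ.1 (gen p) - 1) ((mem_disc_iff hp2).1 ψ.2)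

/-- Every point of `𝒲⁰_n` is a specialization of the universal one. -/
lemma map_universal (hp2 : p ≠ 2) {n : ℕ} {U : (disc p n).toGroup.obj (discAlg p n)}
    (hU : chi U.1 (gen p) = (1 + RSeries.X : RSeries ℚ_[p] (discRadius p n)))
    {R : AffinoidAlgebra p} (ψ : (disc p n).toGroup.obj R) :
    (disc p n).toGroup.map (charEval hp2 ψ) U = ψ := by
  refine Subtype.ext (char_ext hp2 ?_)
  have h1 : chi ((disc p n).toGroup.map (charEval hp2 ψ) U).1 (gen p) =
      charEval hp2 ψ (chi U.1 (gen p)) := rfl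
  rw [h1, hU]
  have h2 := (RSeries.eval (p := p) (chi ψ.1 (gen p) - 1) ((mem_disc_iff hp2).1 ψ.2)).map_add
    1 RSeries.X
  rw [map_one, RSeries.eval_X, add_sub_cancel] at h2
  exact h2

lemma app_eq_charEval (hp2 : p ≠ 2) {n : ℕ} {U : (disc p n).toGroup.obj (discAlg p n)}
    (hU : chi U.1 (gen p) = (1 + RSeries.X : RSeries ℚ_[p] (discRadius p n)))
    (f : (disc p n).toGroup.toSpace ⟶ affineLine p) {R : AffinoidAlgebra p}
    (ψ : (disc p n).toGroup.obj R) :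
    (f.app R ψ : R) = charEval hp2 ψ (f.app (discAlg p n) U : discAlg p n) := by
  have h := congrArg (fun g => g U) (f.naturality (charEval hp2 ψ))
  refine Eq.trans ?_ h
  exact congrArg (f.app R) (map_universal hp2 hU ψ).symm

lemma growthLE_chi_pow_sub_one (hp2 : p ≠ 2) {n : ℕ} {R : AffinoidAlgebra p}
    (ψ : (disc p n).toGroup.obj R) :
    GrowthLE (chi ψ.1 (gen p) ^ p ^ n - 1) (discRadius p 0) :=
  growthLE_pow_prime_pow_sub_one (by rw [zero_add]; exact (mem_disc_iff hp2).1 ψ.2)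

lemma comp_powHom {n : ℕ} {R : AffinoidAlgebra p} {x : R}
    (φ : RSeries ℚ_[p] (discRadius p n) →A[ℚ_[p]] R)
    (hφ : φ RSeries.X = x - 1) (hx : GrowthLE (x ^ p ^ n - 1) (discRadius p 0))
    (F : RSeries ℚ_[p] (discRadius p 0)) :
    φ (powHom p n F) = RSeries.eval (x ^ p ^ n - 1) hx F := by
  have h : φ.comp (powHom p n) = RSeries.eval (x ^ p ^ n - 1) hx := RSeries.hom_ext (by
    rw [ContinuousAlgHom.comp_apply, powHom_X, RSeries.eval_X, powMap, map_sub, map_pow, map_add,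
      map_one, hφ, add_sub_cancel])
  exact congrArg (fun g : RSeries ℚ_[p] (discRadius p 0) →A[ℚ_[p]] R => g F) h

/-- The ideal of `A⟨Y⟩` whose quotient is the ring of functions on the `N`-th roots of unity
over `A`. -/
def rootIdeal (A : AffinoidAlgebra p) (N : ℕ) : Ideal (RSeries A 1) :=
  (Ideal.span {(RSeries.X ^ N - 1 : RSeries A 1)}).closure

instance isClosed_rootIdeal (A : AffinoidAlgebra p) (N : ℕ) :
    IsClosed (rootIdeal A N : Set (RSeries A 1)) := isClosed_closure

lemma X_pow_sub_mem_rootIdeal (A : AffinoidAlgebra p) (N : ℕ) :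
    RSeries.X ^ N - algebraMap A (RSeries A 1) 1 ∈ rootIdeal A N := by
  rw [map_one]
  exact subset_closure (Ideal.mem_span_singleton_self _)

/-- Comparison of the coefficients of `1` in the basis `1, Y, …, Y ^ (N - 1)` of functions on the
roots of unity. -/
lemma eq_sum_of_quotientHom_eq {A : AffinoidAlgebra p} {N : ℕ} (hN : 0 < N) {F x : A} {g : ℕ → A}
    (h : quotientHom (rootIdeal A N) (constHom A F) =
      ∑ i ∈ Finset.range N, quotientHom (rootIdeal A N) (constHom A (g i)) *
        (quotientHom (rootIdeal A N) RSeries.X * quotientHom (rootIdeal A N) (constHom A x) - 1) ^ i) :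
    F = ∑ i ∈ Finset.range N, (-1) ^ i * g i := by
  have hQ : quotientHom (rootIdeal A N) (constHom A F) = quotientHom (rootIdeal A N)
      (∑ i ∈ Finset.range N, g i • (x • RSeries.X + (-1 : RSeries A 1)) ^ i) := by
    rw [h, map_sum]
    refine Finset.sum_congr rfl fun i _ => ?_
    rw [Algebra.smul_def, Algebra.smul_def, map_mul, map_pow, map_add, map_mul, map_neg, map_one,
      constHom_apply, constHom_apply, mul_comm (quotientHom _ RSeries.X), sub_eq_add_neg]
  have h3 := multSum_eq_zero_of_mem hN
    ((ClosedQuotient.mk_eq_mk_iff (𝕜 := ℚ_[p]) (J := rootIdeal A N)).1 hQ)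
  have h4 : multSum hN (constHom A F) = F := by
    rw [constHom_apply, Algebra.algebraMap_eq_smul_one, multSum_smul, ← pow_zero RSeries.X,
      multSum_X_pow hN hN, if_pos rfl, mul_one]
  rw [map_sub, map_sum, sub_eq_zero, h4] at h3
  rw [h3]
  refine Finset.sum_congr rfl fun i hi => ?_
  rw [multSum_smul, multSum_smul_X_sub_one_pow hN _ (Finset.mem_range.1 hi), mul_comm]

/-- A function on `𝒲⁰_n` which is invariant under the `p ^ n`-torsion is a function of
`ψ(1 + p) ^ p ^ n - 1`.  Invariance is tested on the torsion point `y` of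
`B⟨Y⟩ / (Y ^ p ^ n - 1)`, where `B` is the ring of functions on `𝒲⁰_n`. -/
lemma exists_eq_eval_of_invariant (hp2 : p ≠ 2) {n : ℕ}
    (f : (disc p n).toGroup.toSpace ⟶ affineLine p)
    (hf : ∀ (R : AffinoidAlgebra p) (h : (torsionBy (disc p n).toGroup (p ^ n)).obj R)
      (g : (disc p n).toGroup.obj R),
      f.app R ((h : (disc p n).toGroup.obj R) * g) = f.app R g) :
    ∃ F : RSeries ℚ_[p] (discRadius p 0), ∀ (R : AffinoidAlgebra p) (ψ : (disc p n).toGroup.obj R),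
      f.app R ψ = RSeries.eval _ (growthLE_chi_pow_sub_one hp2 ψ) F := by
  obtain ⟨U, hU⟩ := exists_universal hp2 n
  have hN : 0 < p ^ n := pow_pos hp.out.pos n
  let F : RSeries ℚ_[p] (discRadius p n) := f.app (discAlg p n) U
  obtain ⟨G, hG⟩ := exists_eq_sum_powHom n F
  let J := rootIdeal (discAlg p n) (p ^ n)
  have hJ := X_pow_sub_mem_rootIdeal (discAlg p n) (p ^ n)
  let C : AffinoidAlgebra p := quotientAlgebra J hN .one hJ
  let Q : RSeries (discAlg p n) 1 →A[ℚ_[p]] C := quotientHom J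
  let c : RSeries ℚ_[p] (discRadius p n) →A[ℚ_[p]] C := Q.comp (constHom (discAlg p n))
  let y : C := Q RSeries.X
  have hy1 : y ^ p ^ n = 1 := by
    have h1 : Q (RSeries.X ^ p ^ n) = Q (algebraMap (discAlg p n) (RSeries (discAlg p n) 1) 1) :=
      ClosedQuotient.mk_eq_mk_iff.2 hJ
    rwa [map_pow, map_one, map_one] at h1
  have hyb : GrowthLE y 1 := (growthLE_one_iff.2 isPowerBounded_X).map Q
  have hy : GrowthLE (y - 1) (discRadius p n) := by
    have := hyb.sub_one_of_pow_prime_pow (p := p) (m := 0) (n := n) (by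
      rw [hy1, sub_self]; exact growthLE_zero (discRadius_pos p 0).le)
    rwa [zero_add] at this
  obtain ⟨h, hh, hhy⟩ := exists_mem_disc_chi_gen_eq (R := C) hp2 hy
  have htor : (⟨h, hh⟩ : (disc p n).toGroup.obj C) ∈
      (torsionBy (disc p n).toGroup (p ^ n)).obj C := by
    refine Subtype.ext (char_ext hp2 ?_)
    refine (chi_pow_char h (p ^ n) (gen p)).trans ?_
    rw [hhy, hy1]
    exact (chi_one_char (gen p)).symm
  let ψ : (disc p n).toGroup.obj C := (disc p n).toGroup.map (show discAlg p n ⟶ C from c) U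
  have hψ : chi ψ.1 (gen p) = c (1 + RSeries.X) := by
    rw [← hU]; rfl
  have hinv := hf C ⟨⟨h, hh⟩, htor⟩ ψ
  -- both sides, as values of `F`
  have hr : (f.app C ψ : C) = c F :=
    congrArg (fun g => g U) (f.naturality (show discAlg p n ⟶ C from c))
  let h' : (disc p n).toGroup.obj C := ⟨h, hh⟩
  let hψ' : (disc p n).toGroup.obj C := h' * ψ
  have hchi : chi hψ'.1 (gen p) = y * c (1 + RSeries.X) := by
    rw [← hψ, ← hhy]; rfl
  let e : RSeries ℚ_[p] (discRadius p n) →A[ℚ_[p]] C := charEval hp2 hψ'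
  have he : e RSeries.X = y * c (1 + RSeries.X) - 1 := by
    rw [← hchi]; exact RSeries.eval_X ((mem_disc_iff hp2).1 hψ'.2)
  have hl : e F = c F := ((app_eq_charEval hp2 hU f hψ').symm.trans hinv).trans hr
  have hce : ∀ g, e (powHom p n g) = c (powHom p n g) := fun g => by
    have h1 : GrowthLE (c (1 + RSeries.X) ^ p ^ n - 1) (discRadius p 0) := by
      rw [← hψ]; exact growthLE_chi_pow_sub_one hp2 ψ
    have h2 : GrowthLE ((y * c (1 + RSeries.X)) ^ p ^ n - 1) (discRadius p 0) := by
      rwa [mul_pow, hy1, one_mul]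
    rw [comp_powHom e he h2, comp_powHom c (by rw [map_add, map_one, add_sub_cancel_left]) h1]
    simp only [mul_pow, hy1, one_mul]
  have h5 : F = powHom p n (∑ i ∈ Finset.range (p ^ n), (-1) ^ i * G i) := by
    have h1 : c F = ∑ i ∈ Finset.range (p ^ n), c (powHom p n (G i)) *
        (y * c (1 + RSeries.X) - 1) ^ i := by
      rw [← hl]
      nth_rw 1 [hG]
      rw [map_sum]
      refine Finset.sum_congr rfl fun i _ => ?_
      rw [map_mul, map_pow, he, hce]
    have h2 := eq_sum_of_quotientHom_eq (A := discAlg p n) (F := F)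
      (x := (1 + RSeries.X : RSeries ℚ_[p] (discRadius p n)))
      (g := fun i => (powHom p n (G i) : RSeries ℚ_[p] (discRadius p n))) hN h1
    refine h2.trans ?_
    rw [map_sum]
    refine Finset.sum_congr rfl fun i _ => ?_
    rw [map_mul, map_pow, map_neg, map_one]
    rfl
  refine ⟨∑ i ∈ Finset.range (p ^ n), (-1) ^ i * G i, fun R φ => ?_⟩
  refine (app_eq_charEval hp2 hU f φ).trans ((congrArg (discHom (charEval hp2 φ)) h5).trans ?_)
  exact comp_powHom (discHom (charEval hp2 φ)) (RSeries.eval_X ((mem_disc_iff hp2).1 φ.2)) _ _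

end

section

variable {p : ℕ} [hp : Fact p.Prime]

/-- The homomorphism of evaluation at `ϑ(ψ)`, for a point `ψ` of `𝒲⁰_n`. -/
def thetaHom (hp2 : p ≠ 2) {n : ℕ} {R : AffinoidAlgebra p} (ψ : (disc p n).toGroup.obj R) :
    RSeries ℚ_[p] (quotRadius p n) →A[ℚ_[p]] R :=
  RSeries.eval (thetaVal ψ.1) (growthLE_thetaVal hp2 ψ.2)

lemma thetaHom_X (hp2 : p ≠ 2) {n : ℕ} {R : AffinoidAlgebra p} (ψ : (disc p n).toGroup.obj R) :
    thetaHom hp2 ψ RSeries.X = thetaVal ψ.1 := RSeries.eval_X (growthLE_thetaVal hp2 ψ.2)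

/-- The map `ϑ` from `𝒲⁰_n` to the disc of radius `p ^ (n - 1 / (p - 1))`. -/
def thetaDisc (hp2 : p ≠ 2) (n : ℕ) : (disc p n).toGroup.toSpace ⟶ Sp (quotAlg p n) where
  app R := ↾fun (ψ : (disc p n).toGroup.obj R) =>
    show quotAlg p n ⟶ R from thetaHom hp2 ψ
  naturality R R' f := by
    ext ψ
    refine RSeries.hom_ext (𝕜 := ℚ_[p]) ?_
    refine (thetaHom_X hp2 ((disc p n).toGroup.map f ψ)).trans ?_
    refine (map_thetaVal hp2 f ψ.1).trans ?_
    exact congrArg f (thetaHom_X hp2 ψ).symm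

lemma thetaDisc_app_eq_iff (hp2 : p ≠ 2) {n : ℕ} {R : AffinoidAlgebra p}
    (ψ ψ' : (disc p n).toGroup.obj R) :
    (thetaDisc hp2 n).app R ψ = (thetaDisc hp2 n).app R ψ' ↔ thetaVal ψ.1 = thetaVal ψ'.1 := by
  refine ⟨fun h => ?_, fun h => ?_⟩
  · have h' : thetaHom hp2 ψ = thetaHom hp2 ψ' := h
    rw [← thetaHom_X hp2 ψ, ← thetaHom_X hp2 ψ', h']
  · refine RSeries.hom_ext (𝕜 := ℚ_[p]) ?_
    exact (thetaHom_X hp2 ψ).trans (h.trans (thetaHom_X hp2 ψ').symm)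

lemma thetaVal_mul_of_thetaVal_eq_zero (hp2 : p ≠ 2) {R : AffinoidAlgebra p}
    {ψ ψ' : (identityComponent p).toGroup.obj R} (h : thetaVal ψ = 0) :
    thetaVal (ψ * ψ') = thetaVal ψ' := by rw [thetaVal_mul hp2, h, zero_add]

lemma coe_pow_eq_one_iff {n m : ℕ} {R : AffinoidAlgebra p} (ψ : (disc p n).toGroup.obj R) :
    ψ ∈ (torsionBy (disc p n).toGroup m).obj R ↔ ψ.1 ^ m = 1 := by
  have h : ψ ∈ (torsionBy (disc p n).toGroup m).obj R ↔ ψ ^ m = 1 := MonoidHom.mem_ker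
  rw [h]
  exact Subtype.ext_iff

lemma thetaVal_eq_zero_of_mem_torsionBy (hp2 : p ≠ 2) {n : ℕ} {R : AffinoidAlgebra p}
    {ψ : (disc p n).toGroup.obj R} (h : ψ ∈ (torsionBy (disc p n).toGroup (p ^ n)).obj R) :
    thetaVal ψ.1 = 0 :=
  (pow_eq_one_iff_thetaVal hp2 ψ.2).1 ((coe_pow_eq_one_iff ψ).1 h)

/-- On points over fields, `ϑ` maps `𝒲⁰_n` onto the disc of radius `p ^ (n - 1 / (p - 1))`: a point
of `𝒲⁰_0` is the `p ^ n`-th power of a point of `𝒲⁰_n` over a finite extension. -/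
lemma exists_thetaVal_eq_map (hp2 : p ≠ 2) {n : ℕ} {L : AffinoidAlgebra p} (hL : IsField L) {a : L}
    (ha : GrowthLE a (quotRadius p n)) : ∃ L' : AffinoidAlgebra p, IsField L' ∧
      ∃ (f : L ⟶ L') (ψ : (disc p n).toGroup.obj L'), thetaVal ψ.1 = f a := by
  obtain ⟨ψ₀, hψ₀, e⟩ := exists_thetaVal_eq hp2 (growthLE_quotRadius_iff.1 ha)
  obtain ⟨L', f, y, hL', hyb, hy⟩ := exists_root hL (isPowerBounded_charValue _ (gen p))
    (pow_pos hp.out.pos n)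
  have hy' : y ^ p ^ n = f (chi ψ₀ (gen p)) := hy
  have h1 : GrowthLE (y ^ p ^ n - 1) (discRadius p 0) := by
    have h2 := ((mem_disc_iff hp2).1 hψ₀).map (show L →A[ℚ_[p]] L' from f)
    rw [map_sub, map_one] at h2
    rw [hy']
    exact h2
  have h3 := (growthLE_one_iff.2 hyb).sub_one_of_pow_prime_pow h1
  rw [zero_add] at h3
  obtain ⟨ψ, hψ, hψy⟩ := exists_mem_disc_chi_gen_eq hp2 h3
  refine ⟨L', hL', f, ⟨ψ, hψ⟩, ?_⟩
  have h4 : ψ ^ p ^ n = (identityComponent p).toGroup.map f ψ₀ := char_ext hp2 (by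
    rw [chi_pow_char, hψy, chi_map, hy'])
  have h5 := thetaVal_pow hp2 ψ (p ^ n)
  rw [h4, map_thetaVal hp2, e] at h5
  have h6 : f (p ^ n • a) = p ^ n • f a := map_nsmul (show L →A[ℚ_[p]] L' from f) _ _
  rw [h6, nsmul_eq_padic_smul (p := p), nsmul_eq_padic_smul (p := p)] at h5
  exact (smul_right_injective L' (natCast_prime_pow_ne_zero (p := p) n) h5).symm

/-- On the disc of radius `p ^ (n - 1 / (p - 1))`, the function `p ^ n log (1 + p) s` takes values in
the domain of the exponential. -/
lemma growthLE_smul_X (hp2 : p ≠ 2) (n : ℕ) :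
    GrowthLE ((p ^ n : ℕ) • unitLog (gen p) • (RSeries.X : RSeries ℚ_[p] (quotRadius p n)))
      (discRadius p 0) := by
  have h0 := pow_pos (prime_real_pos p) n
  have h := ((GrowthLE.of_norm_le (RSeries.norm_X_le (r := quotRadius p n) (A := ℚ_[p]))).smul
    (unitLog (gen p))).smul ((p ^ n : ℕ) : ℚ_[p])
  have e : ((p : ℝ) ^ n)⁻¹ * ((p : ℝ)⁻¹ * quotRadius p n) = discRadius p 0 := by
    rw [quotRadius_eq, mul_left_comm (p : ℝ)⁻¹, inv_mul_cancel_left₀ h0.ne',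
      inv_mul_cancel_left₀ (prime_real_pos p).ne']
  rwa [norm_natCast_prime_pow, norm_unitLog_gen hp2, e, Nat.cast_smul_eq_nsmul] at h

/-- Functions of `ψ(1 + p) ^ p ^ n - 1` are functions of `ϑ(ψ)`, through the exponential. -/
lemma exists_eq_thetaHom (hp2 : p ≠ 2) (n : ℕ) (F : RSeries ℚ_[p] (discRadius p 0)) :
    ∃ g : RSeries ℚ_[p] (quotRadius p n), ∀ (R : AffinoidAlgebra p)
      (ψ : (disc p n).toGroup.obj R), RSeries.eval _ (growthLE_chi_pow_sub_one hp2 ψ) F =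
        thetaHom hp2 ψ g := by
  have hX := growthLE_smul_X hp2 n
  refine ⟨RSeries.eval _ (growthLE_exp_sub_one hX) F, fun R ψ => ?_⟩
  have hE : (thetaHom hp2 ψ).comp (RSeries.eval _ (growthLE_exp_sub_one hX)) =
      RSeries.eval _ (growthLE_chi_pow_sub_one hp2 ψ) := RSeries.hom_ext (by
    rw [ContinuousAlgHom.comp_apply, RSeries.eval_X, RSeries.eval_X, map_sub, map_one]
    congr 1
    -- both sides have the same logarithm
    have h1 : GrowthLE (thetaHom hp2 ψ
        (RSeries.eval _ hX (expSeries p)) - 1) (discRadius p 0) := by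
      have := (growthLE_exp_sub_one hX).map (thetaHom hp2 ψ)
      rwa [map_sub, map_one] at this
    refine eq_of_plog_eq hp2 h1 (growthLE_chi_pow_sub_one hp2 ψ) ?_
    have h2 := plog_map (thetaHom hp2 ψ) (discRadius_pos p 0).le
      (discRadius_lt_one p 0) (growthLE_exp_sub_one hX)
    rw [plog_exp] at h2
    rw [← h2, plog_pow (discRadius_pos p n).le (discRadius_lt_one p n) ((mem_disc_iff hp2).1 ψ.2),
      map_nsmul, map_smul, thetaHom_X, plog_chi_eq hp2 _ gen_mem])
  exact (congrArg (fun g : RSeries ℚ_[p] (discRadius p 0) →A[ℚ_[p]] R => g F) hE).symm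

/-- A function on the disc is determined by its values on the image of `𝒲⁰_0`, which is a smaller
disc. -/
lemma eq_of_forall_thetaHom_eq (hp2 : p ≠ 2) {n : ℕ} {g g' : RSeries ℚ_[p] (quotRadius p n)}
    (h : ∀ (R : AffinoidAlgebra p) (ψ : (disc p n).toGroup.obj R),
      thetaHom hp2 ψ g = thetaHom hp2 ψ g') : g = g' := by
  obtain ⟨ψ, hψ, e⟩ := exists_thetaVal_eq (R := quotAlg p 0) hp2
    (.of_norm_le (RSeries.norm_X_le (r := quotRadius p 0) (A := ℚ_[p])))
  let ψ' : (disc p n).toGroup.obj (quotAlg p 0) := ⟨ψ, disc_mono n.zero_le _ hψ⟩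
  let ρ : RSeries ℚ_[p] (quotRadius p n) →A[ℚ_[p]] RSeries ℚ_[p] (quotRadius p 0) :=
    thetaHom hp2 ψ'
  have hρ : ρ RSeries.X = RSeries.X := (thetaHom_X hp2 ψ').trans e
  have hcoeff : ∀ (f : RSeries ℚ_[p] (quotRadius p n)) (k : ℕ),
      RSeries.coeff k (ρ f) = RSeries.coeff k f := fun f k => by
    have h1 := ((RSeries.hasSum_smul_X_pow f).map ρ ρ.continuous).map
      (RSeries.coeff (A := ℚ_[p]) (r := quotRadius p 0) k) (RSeries.continuous_coeff k)
    refine h1.unique ((hasSum_ite_eq k (RSeries.coeff k f)).congr_fun fun j => ?_)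
    rw [Function.comp_apply, Function.comp_apply, map_smul, map_pow, hρ, RSeries.coeff_smul,
      RSeries.X_pow, RSeries.coeff_monomial]
    rcases eq_or_ne j k with rfl | hjk
    · simp
    · simp [hjk, hjk.symm]
  refine RSeries.ext fun k => ?_
  rw [← hcoeff g, ← hcoeff g']
  exact congrArg _ (h _ ψ')

/-- `ϑ` makes the disc of radius `p ^ (n - 1 / (p - 1))` the quotient of `𝒲⁰_n` by its
`p ^ n`-torsion. -/
theorem isQuotient_thetaDisc (hp2 : p ≠ 2) (n : ℕ) :
    IsQuotient (torsionBy (disc p n).toGroup (p ^ n)) (thetaDisc hp2 n) where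
  surjective L hL x := by
    obtain ⟨L', hL', f, ψ, hψ⟩ :=
      exists_thetaVal_eq_map hp2 hL (growthLE_discHom_X (hd := quotRadius_pow p n) x)
    refine ⟨L', hL', f, ψ, ?_⟩
    refine RSeries.hom_ext (𝕜 := ℚ_[p]) ?_
    exact (thetaHom_X hp2 ψ).trans hψ
  coincide R h g := (thetaDisc_app_eq_iff hp2 _ _).2
    (thetaVal_mul_of_thetaVal_eq_zero hp2 (thetaVal_eq_zero_of_mem_torsionBy hp2 h.2))
  isIso R := by
    refine ⟨fun x y hxy => ?_, fun ⟨⟨y₁, y₂⟩, hy⟩ => ?_⟩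
    · have h1 : ((x.1 : (disc p n).toGroup.obj R) * x.2, x.2) =
          ((y.1 : (disc p n).toGroup.obj R) * y.2, y.2) := congrArg Subtype.val hxy
      have h2 : x.2 = y.2 := (Prod.ext_iff.1 h1).2
      have h3 : (x.1 : (disc p n).toGroup.obj R) * x.2 = y.1 * y.2 := (Prod.ext_iff.1 h1).1
      rw [h2] at h3
      exact Prod.ext (Subtype.ext (mul_right_cancel h3)) h2
    · have h1 := (thetaDisc_app_eq_iff hp2 _ _).1 hy
      have h2 : y₁ * y₂⁻¹ ∈ (torsionBy (disc p n).toGroup (p ^ n)).obj R := by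
        rw [coe_pow_eq_one_iff, pow_eq_one_iff_thetaVal hp2 (y₁ * y₂⁻¹).2]
        have h3 := thetaVal_mul hp2 (y₁ * y₂⁻¹).1 y₂.1
        have h4 : (y₁ * y₂⁻¹).1 * y₂.1 = y₁.1 := congrArg Subtype.val (inv_mul_cancel_right y₁ y₂)
        rw [h4, h1] at h3
        exact left_eq_add.1 (h3.trans (add_comm _ _))
      exact ⟨⟨⟨_, h2⟩, y₂⟩, Subtype.ext (Prod.ext (inv_mul_cancel_right y₁ y₂) rfl)⟩
  functions f hf := by
    obtain ⟨F, hF⟩ := exists_eq_eval_of_invariant hp2 f hf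
    obtain ⟨g, hg⟩ := exists_eq_thetaHom hp2 n F
    have hfg : ∀ (R : AffinoidAlgebra p) (ψ : (disc p n).toGroup.obj R),
        thetaHom hp2 ψ g = f.app R ψ := fun R ψ =>
      ((hF R ψ).trans (hg R ψ)).symm
    refine ⟨spFun (A := quotAlg p n) g, ?_, fun f' hf' => ?_⟩
    · ext R ψ
      exact hfg R ψ
    · subst hf'
      rw [eq_spFun f'] at hfg ⊢
      congr 1
      exact eq_of_forall_thetaHom_eq hp2 fun R ψ => (hfg R ψ).symm

end

/-! ### Gluings -/

section

variable {p : ℕ} [hp : Fact p.Prime] {X : ℕ → AffinoidAlgebra p}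
  {i : ∀ n, Sp (X n) ⟶ Sp (X (n + 1))}

lemma comp_gluingι (n : ℕ) : i n ≫ gluingι i (n + 1) = gluingι i n := by
  have h := Limits.colimit.w (Functor.ofSequence i) (homOfLE (Nat.le_add_right n 1))
  rw [Functor.ofSequence_map_homOfLE_succ] at h
  exact h

lemma gluingι_app_app (n : ℕ) {R : AffinoidAlgebra p} (x : (Sp (X n)).obj R) :
    (gluingι i (n + 1)).app R ((i n).app R x) = (gluingι i n).app R x :=
  congrArg (fun f : Sp (X n) ⟶ gluing i => f.app R x) (comp_gluingι n)

lemma exists_gluingι_eq {m n : ℕ} (h : m ≤ n) {R : AffinoidAlgebra p} (x : (Sp (X m)).obj R) :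
    ∃ y : (Sp (X n)).obj R, (gluingι i n).app R y = (gluingι i m).app R x := by
  induction n, h using Nat.le_induction with
  | base => exact ⟨x, rfl⟩
  | succ n _ ih =>
    obtain ⟨y, hy⟩ := ih
    exact ⟨(i n).app R y, (gluingι_app_app n y).trans hy⟩

/-- Every point of a gluing lies in one of the pieces. -/
lemma gluing_surjective {R : AffinoidAlgebra p} (x : (gluing i).obj R) :
    ∃ (n : ℕ) (y : (Sp (X n)).obj R), (gluingι i n).app R y = x :=
  Limits.Types.jointly_surjective _ (Limits.isColimitOfPreserves ((evaluation _ _).obj R)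
    (Limits.colimit.isColimit (Functor.ofSequence i))) x

lemma gluing_hom_ext {Y : Space p} {f g : gluing i ⟶ Y}
    (h : ∀ n, gluingι i n ≫ f = gluingι i n ≫ g) : f = g := Limits.colimit.hom_ext h

lemma exists_gluing_desc {Y : Space p} (f : ∀ n, Sp (X n) ⟶ Y) (hf : ∀ n, i n ≫ f (n + 1) = f n) :
    ∃ F : gluing i ⟶ Y, ∀ n, gluingι i n ≫ F = f n := by
  let c : Limits.Cocone (Functor.ofSequence i) :=
    { pt := Y
      ι := NatTrans.ofSequence f fun n => by
        rw [Functor.ofSequence_map_homOfLE_succ]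
        exact (hf n).trans (Category.comp_id _).symm }
  exact ⟨Limits.colimit.desc _ c, fun n => Limits.colimit.ι_desc c n⟩

/-- A map out of a gluing is an isomorphism if its restrictions to the pieces are injective and
their images cover the target. -/
lemma isIso_of_gluing {Y : Space p} (F : gluing i ⟶ Y)
    (hinj : ∀ n R, Function.Injective ((gluingι i n ≫ F).app R))
    (hsurj : ∀ (R : AffinoidAlgebra p) (y : Y.obj R),
      ∃ (n : ℕ) (x : (Sp (X n)).obj R), (gluingι i n ≫ F).app R x = y) : IsIso F := by
  rw [NatTrans.isIso_iff_isIso_app]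
  intro R
  rw [isIso_iff_bijective]
  refine ⟨fun x y hxy => ?_, fun y => ?_⟩
  · obtain ⟨m, x, rfl⟩ := gluing_surjective x
    obtain ⟨n, y, rfl⟩ := gluing_surjective y
    obtain ⟨x', hx⟩ := exists_gluingι_eq (i := i) (le_max_left m n) x
    obtain ⟨y', hy⟩ := exists_gluingι_eq (i := i) (le_max_right m n) y
    rw [← hx, ← hy] at hxy ⊢
    rw [hinj (max m n) R hxy]
  · obtain ⟨n, x, hx⟩ := hsurj R y
    exact ⟨(gluingι i n).app R x, hx⟩

end

/-! ### The quotient of `𝒲⁰` by its torsion -/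

section

variable {p : ℕ} [hp : Fact p.Prime]

/-- The inclusion of the disc of radius `p ^ (n - 1 / (p - 1))` in the affine line. -/
def discIncl (p : ℕ) [Fact p.Prime] (n : ℕ) : Sp (quotAlg p n) ⟶ affineLine p :=
  spFun (A := quotAlg p n) (RSeries.X : RSeries ℚ_[p] (quotRadius p n))

lemma discIncl_injective (n : ℕ) (R : AffinoidAlgebra p) :
    Function.Injective ((discIncl p n).app R) := fun _ _ h => RSeries.hom_ext (𝕜 := ℚ_[p]) h

lemma exists_discIncl_eq_iff {n : ℕ} {R : AffinoidAlgebra p} {a : R} :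
    (∃ x, (discIncl p n).app R x = a) ↔ SupNormLE (p := p) a (quotRadius p n) := by
  rw [supNormLE_iff_growthLE (quotRadius_pos p n) (quotRadius_pow p n)]
  refine ⟨?_, fun h => ⟨discEval (quotRadius_pow p n) a h, RSeries.eval_X h⟩⟩
  rintro ⟨x, rfl⟩
  exact growthLE_discHom_X (hd := quotRadius_pow p n) x

lemma thetaDisc_comp_discIncl (hp2 : p ≠ 2) (n : ℕ) : thetaDisc hp2 n ≫ discIncl p n =
    GroupSpace.mapSpace (disc p n).ι ≫ theta hp2 := by
  ext R ψ
  exact thetaHom_X hp2 ψ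

/-- Two quotients of the same group by the same subgroup are isomorphic. -/
lemma IsQuotient.exists_iso {G : GroupSpace p} {H : SubgroupSpace G} {X Y : AffinoidAlgebra p}
    {q : G.toSpace ⟶ Sp X} {r : G.toSpace ⟶ Sp Y} (hq : IsQuotient H q) (hr : IsQuotient H r) :
    ∃ e : Sp X ≅ Sp Y, q ≫ e.hom = r := by
  obtain ⟨f, hf, -⟩ := hq.existsUnique_desc r hr.coincide
  obtain ⟨g, hg, -⟩ := hr.existsUnique_desc q hq.coincide
  refine ⟨⟨f, g, (hq.existsUnique_desc q hq.coincide).unique ?_ (Category.comp_id _),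
    (hr.existsUnique_desc r hr.coincide).unique ?_ (Category.comp_id _)⟩, hf⟩
  · rw [← Category.assoc, hf, hg]
  · rw [← Category.assoc, hg, hf]

lemma IsQuotient.hom_ext {G : GroupSpace p} {H : SubgroupSpace G} {X : Space p}
    {q : G.toSpace ⟶ X} (hq : IsQuotient H q) {f g : X ⟶ affineLine p} (h : q ≫ f = q ≫ g) :
    f = g := by
  refine (hq.functions (q ≫ f) fun R a b => ?_).unique rfl h.symm
  exact congrArg (fun z => f.app R z) (hq.coincide R a b)

/-- Every quotient of `𝒲⁰_n` by its `p ^ n`-torsion is embedded in the affine line by `ϑ`, with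
image the disc of radius `p ^ (n - 1 / (p - 1))`. -/
lemma IsQuotient.exists_embedding (hp2 : p ≠ 2) {n : ℕ} {X : AffinoidAlgebra p}
    {q : (disc p n).toGroup.toSpace ⟶ Sp X}
    (hq : IsQuotient (torsionBy (disc p n).toGroup (p ^ n)) q) :
    ∃ j : Sp X ⟶ affineLine p, q ≫ j = GroupSpace.mapSpace (disc p n).ι ≫ theta hp2 ∧
      (∀ R, Function.Injective (j.app R)) ∧ ∀ (R : AffinoidAlgebra p) (a : R),
        (∃ x, j.app R x = a) ↔ SupNormLE (p := p) a (quotRadius p n) := by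
  obtain ⟨e, he⟩ := hq.exists_iso (isQuotient_thetaDisc hp2 n)
  have hb : ∀ R, Function.Bijective (e.hom.app R) := fun R =>
    (isIso_iff_bijective _).1 inferInstance
  refine ⟨e.hom ≫ discIncl p n, ?_, fun R => (discIncl_injective n R).comp (hb R).1,
    fun R a => ?_⟩
  · rw [← Category.assoc, he, thetaDisc_comp_discIncl]
  · rw [← exists_discIncl_eq_iff]
    exact ((hb R).2.exists (p := fun y => (discIncl p n).app R y = a)).symm

/-- The transition maps between discs are inclusions of rational subdomains: if `|d| * r ^ N = 1`,
the disc of radius `r` is defined by the power-boundedness of `d * s ^ N`. -/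
lemma isRationalOpenImmersion_of_embedding {A A' : AffinoidAlgebra p} {n : ℕ} {i : Sp A' ⟶ Sp A}
    {j : Sp A ⟶ affineLine p} {j' : Sp A' ⟶ affineLine p} (hij : i ≫ j = j')
    (hj : ∀ R, Function.Injective (j.app R)) (hj' : ∀ R, Function.Injective (j'.app R))
    (himg : ∀ (R : AffinoidAlgebra p) (a : R), (∃ x, j'.app R x = a) ↔
      SupNormLE (p := p) a (quotRadius p n)) : IsRationalOpenImmersion i := by
  obtain ⟨N, d, hN, hd⟩ := quotRadius_pow p n
  obtain ⟨s, rfl⟩ : ∃ s : A, j = spFun s := ⟨_, eq_spFun j⟩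
  have happ : ∀ (R : AffinoidAlgebra p) (y : (Sp A').obj R),
      (spFun s).app R (i.app R y) = j'.app R y := fun R y =>
    congrArg (fun f : Sp A' ⟶ affineLine p => f.app R y) hij
  refine ⟨1, fun _ => d • s ^ N, 1, ?_, fun R => ⟨fun y y' h => hj' R ?_, fun x => ?_⟩⟩
  · exact Ideal.eq_top_of_isUnit_mem _ (Ideal.subset_span (Set.mem_insert _ _)) isUnit_one
  · rw [← happ, ← happ, h]
  · let x' : A →A[ℚ_[p]] R := x
    have hx : x' (d • s ^ N) = d • x' s ^ N := by rw [map_smul, map_pow]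
    have h1 : (∃ y, i.app R y = x) ↔ ∃ y, j'.app R y = (x' s : R) := by
      refine exists_congr fun y => ⟨fun h => ?_, fun h => hj R ?_⟩
      · rw [← happ, h]; rfl
      · rw [happ, h]; rfl
    rw [h1, himg, supNormLE_iff_growthLE (quotRadius_pos p n) ⟨N, d, hN, hd⟩]
    have h2 : GrowthLE (x' s) (quotRadius p n) ↔ IsPowerBounded (d • x' s ^ N) := by
      refine ⟨fun h => ?_, fun h => ?_⟩
      · rw [← growthLE_one_iff, ← hd]
        exact (h.pow N).smul d
      · have hd0 : d ≠ 0 := by rintro rfl; simp at hd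
        have h3 := (growthLE_one_iff.2 h).smul d⁻¹
        rw [smul_smul, inv_mul_cancel₀ hd0, one_smul, mul_one, norm_inv,
          ← eq_inv_of_mul_eq_one_right hd] at h3
        exact .of_pow hN (quotRadius_pos p n) h3
    rw [h2]
    constructor
    · intro h
      refine ⟨(isUnit_one (M := A)).map x', fun _ => ⟨d • x' s ^ N, h, ?_⟩⟩
      change x' (d • s ^ N) = x' 1 * _
      rw [hx, map_one, one_mul]
    · rintro ⟨-, h⟩
      obtain ⟨h, hb, e⟩ := h 0
      change x' (d • s ^ N) = x' 1 * h at e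
      rw [map_one, one_mul, hx] at e
      rwa [e]

/-- A map from `𝒲⁰` is determined by its restrictions to the `𝒲⁰_n`. -/
lemma hom_ext_disc (hp2 : p ≠ 2) {Y : Space p} {f g : (identityComponent p).toGroup.toSpace ⟶ Y}
    (h : ∀ n, GroupSpace.mapSpace (disc p n).ι ≫ f = GroupSpace.mapSpace (disc p n).ι ≫ g) :
    f = g := by
  ext R ψ
  obtain ⟨n, hn⟩ := exists_mem_disc hp2 (R := R) ψ
  exact congrArg (fun F : (disc p n).toGroup.toSpace ⟶ Y => F.app R ⟨ψ, hn⟩) (h n)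

lemma incl_mem_torsionBy {n : ℕ} {R : AffinoidAlgebra p} {ψ : (disc p n).toGroup.obj R}
    (h : ψ ∈ (torsionBy (disc p n).toGroup (p ^ n)).obj R) :
    (SubgroupSpace.incl (disc_le_succ p n)).app R ψ ∈
      (torsionBy (disc p (n + 1)).toGroup (p ^ (n + 1))).obj R := by
  refine (coe_pow_eq_one_iff (n := n + 1) _).2 ?_
  change ψ.1 ^ p ^ (n + 1) = 1
  rw [pow_succ, pow_mul, (coe_pow_eq_one_iff ψ).1 h, one_pow]

lemma mem_torsion_of_pow_eq_one {G : GroupSpace p} {R : AffinoidAlgebra p} {g : G.obj R} {m : ℕ}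
    (hm : 0 < m) (h : g ^ m = 1) : g ∈ (torsion G).obj R := by
  have h1 : IsOfFinOrder g := isOfFinOrder_iff_pow_eq_one.2 ⟨m, hm, h⟩
  exact (CommGroup.mem_torsion g).2 h1

lemma coe_mem_torsion {n m : ℕ} (hm : 0 < m) {R : AffinoidAlgebra p} {ψ : (disc p n).toGroup.obj R}
    (h : ψ ∈ (torsionBy (disc p n).toGroup m).obj R) :
    ψ.1 ∈ (torsion (identityComponent p).toGroup).obj R :=
  mem_torsion_of_pow_eq_one hm ((coe_pow_eq_one_iff ψ).1 h)

/-- The kernel of `ϑ` on `𝒲⁰` is the torsion. -/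
lemma mem_torsion_of_thetaVal_eq_zero (hp2 : p ≠ 2) {R : AffinoidAlgebra p}
    {ψ : (identityComponent p).toGroup.obj R} (h : thetaVal ψ = 0) :
    ψ ∈ (torsion (identityComponent p).toGroup).obj R := by
  obtain ⟨n, hn⟩ := exists_mem_disc hp2 ψ
  exact mem_torsion_of_pow_eq_one (pow_pos hp.out.pos n) ((pow_eq_one_iff_thetaVal hp2 hn).2 h)

/-- A map from `𝒲⁰` to a gluing of quotients of the `𝒲⁰_n` whose composite with an embedding of the
gluing in the affine line is `ϑ` is the quotient of `𝒲⁰` by its torsion. -/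
lemma isQuotient_torsion (hp2 : p ≠ 2) {X : ℕ → AffinoidAlgebra p}
    {q : ∀ n, (disc p n).toGroup.toSpace ⟶ Sp (X n)}
    (hq : ∀ n, IsQuotient (torsionBy (disc p n).toGroup (p ^ n)) (q n))
    {i : ∀ n, Sp (X n) ⟶ Sp (X (n + 1))}
    (hi : ∀ n, q n ≫ i n =
      GroupSpace.mapSpace (SubgroupSpace.incl (disc_le_succ p n)) ≫ q (n + 1))
    {π : (identityComponent p).toGroup.toSpace ⟶ gluing i}
    (hπ : ∀ n, GroupSpace.mapSpace (disc p n).ι ≫ π = q n ≫ gluingι i n)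
    {Θ : gluing i ⟶ affineLine p} (hΘ : ∀ R, Function.Injective (Θ.app R))
    (hπΘ : π ≫ Θ = theta hp2) : IsQuotient (torsion (identityComponent p).toGroup) π := by
  have happ : ∀ (R : AffinoidAlgebra p) (ψ : (identityComponent p).toGroup.obj R),
      Θ.app R (π.app R ψ) = thetaVal ψ := fun R ψ =>
    congrArg (fun F : (identityComponent p).toGroup.toSpace ⟶ affineLine p => F.app R ψ) hπΘ
  have hπapp : ∀ (n : ℕ) (R : AffinoidAlgebra p) (ψ : (disc p n).toGroup.obj R),
      π.app R ψ.1 = (gluingι i n).app R ((q n).app R ψ) := fun n R ψ =>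
    congrArg (fun F : (disc p n).toGroup.toSpace ⟶ gluing i => F.app R ψ) (hπ n)
  have hiff : ∀ (R : AffinoidAlgebra p) (ψ ψ' : (identityComponent p).toGroup.obj R),
      π.app R ψ = π.app R ψ' ↔ thetaVal ψ = thetaVal ψ' := fun R ψ ψ' => by
    rw [← happ, ← happ]
    exact (hΘ R).eq_iff.symm
  refine
    { surjective := fun L hL x => ?_
      coincide := fun R h g => (hiff R _ _).2 (thetaVal_mul_of_thetaVal_eq_zero hp2
        (thetaVal_eq_zero_of_isOfFinOrder hp2 h.2))
      isIso := fun R => ?_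
      functions := fun f hf => ?_ }
  · obtain ⟨n, x, rfl⟩ := gluing_surjective x
    obtain ⟨L', hL', f, g, hg⟩ := (hq n).surjective L hL x
    refine ⟨L', hL', f, g.1, ?_⟩
    rw [hπapp, hg]
    exact congrArg (fun F => F x) ((gluingι i n).naturality f)
  · refine ⟨fun x y hxy => ?_, fun ⟨⟨y₁, y₂⟩, hy⟩ => ?_⟩
    · have h1 : ((x.1 : (identityComponent p).toGroup.obj R) * x.2, x.2) =
          ((y.1 : (identityComponent p).toGroup.obj R) * y.2, y.2) := congrArg Subtype.val hxy
      have h2 : x.2 = y.2 := (Prod.ext_iff.1 h1).2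
      have h3 : (x.1 : (identityComponent p).toGroup.obj R) * x.2 = y.1 * y.2 :=
        (Prod.ext_iff.1 h1).1
      rw [h2] at h3
      exact Prod.ext (Subtype.ext (mul_right_cancel h3)) h2
    · have h1 := (hiff R _ _).1 hy
      have h2 : y₁ * y₂⁻¹ ∈ (torsion (identityComponent p).toGroup).obj R := by
        refine mem_torsion_of_thetaVal_eq_zero hp2 ?_
        have h3 := thetaVal_mul hp2 (y₁ * y₂⁻¹) y₂
        rw [inv_mul_cancel_right, h1] at h3
        exact left_eq_add.1 (h3.trans (add_comm _ _))
      exact ⟨⟨⟨_, h2⟩, y₂⟩, Subtype.ext (Prod.ext (inv_mul_cancel_right y₁ y₂) rfl)⟩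
  · -- the invariant function descends to each piece, and the descended functions glue
    have hdesc : ∀ n, ∃! f' : Sp (X n) ⟶ affineLine p,
        q n ≫ f' = GroupSpace.mapSpace (disc p n).ι ≫ f := fun n =>
      (hq n).functions (GroupSpace.mapSpace (disc p n).ι ≫ f) fun R h g =>
        hf R ⟨h.1.1, coe_mem_torsion (pow_pos hp.out.pos n) h.2⟩ g.1
    choose f' hf' hf'u using hdesc
    obtain ⟨F, hF⟩ := exists_gluing_desc f' fun n => hf'u n _ (by
      change q n ≫ i n ≫ f' (n + 1) = _
      rw [← Category.assoc, hi, Category.assoc, hf']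
      rfl)
    refine ⟨F, hom_ext_disc hp2 fun n => ?_, fun F' hF' => gluing_hom_ext fun n => ?_⟩
    · rw [← Category.assoc, hπ, Category.assoc, hF, hf']
    · rw [hF]
      refine hf'u n _ ?_
      change q n ≫ gluingι i n ≫ F' = _
      rw [← Category.assoc, ← hπ, Category.assoc, hF']

end

end RigidWeight

end

theorem mainTheorem5 (p : ℕ) [Fact p.Prime] (hp : p ≠ 2) :
    -- the analytic function `ϑ` on `𝒲⁰` and the affinoids `𝒲⁰_n` are independent of the generator
    (∃! ϑ : (identityComponent p).toGroup.toSpace ⟶ affineLine p, IsTheta ϑ) ∧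
    (∀ (n : ℕ) (γ : ℤ_[p]ˣ), IsGenerator γ → ∀ (R : AffinoidAlgebra p)
      (ψ : (identityComponent p).toGroup.obj R), ψ ∈ (disc p n).obj R ↔
        SupNormLE (p := p) (charValue ((identityComponent p).ι.app R ψ) γ - 1) (discRadius p n)) ∧
    -- the affinoid quotients `X n = 𝒲⁰_n / 𝒲⁰_n[p ^ n]` exist
    (∀ n : ℕ, ∃ (X : AffinoidAlgebra p) (q : (disc p n).toGroup.toSpace ⟶ Sp X),
      IsQuotient (torsionBy (disc p n).toGroup (p ^ n)) q) ∧
    -- and for any choice of these quotients: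
    ∀ (X : ℕ → AffinoidAlgebra p) (q : ∀ n, (disc p n).toGroup.toSpace ⟶ Sp (X n)),
      (∀ n, IsQuotient (torsionBy (disc p n).toGroup (p ^ n)) (q n)) →
      -- there are unique natural maps `X n ⟶ X (n + 1)`, and they are open immersions
      ∃ i : ∀ n, Sp (X n) ⟶ Sp (X (n + 1)),
        (∀ n, q n ≫ i n =
          GroupSpace.mapSpace (SubgroupSpace.incl (disc_le_succ p n)) ≫ q (n + 1)) ∧
        (∀ n (i' : Sp (X n) ⟶ Sp (X (n + 1))), q n ≫ i' =
          GroupSpace.mapSpace (SubgroupSpace.incl (disc_le_succ p n)) ≫ q (n + 1) → i' = i n) ∧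
        (∀ n (R : AffinoidAlgebra p), Function.Injective ((i n).app R)) ∧
        (∀ n, IsRationalOpenImmersion (i n)) ∧
        -- the `q n` glue to a unique map `π`, which makes the gluing the quotient `𝒲⁰ / 𝒲⁰_tors`
        ∃ π : (identityComponent p).toGroup.toSpace ⟶ gluing i,
          (∀ n, GroupSpace.mapSpace (disc p n).ι ≫ π = q n ≫ gluingι i n) ∧
          (∀ π' : (identityComponent p).toGroup.toSpace ⟶ gluing i,
            (∀ n, GroupSpace.mapSpace (disc p n).ι ≫ π' = q n ≫ gluingι i n) → π' = π) ∧
          IsQuotient (torsion (identityComponent p).toGroup) π ∧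
          -- and `ϑ` induces an isomorphism of `𝒲⁰ / 𝒲⁰_tors` onto the affine line, mapping `X n`
          -- onto the closed disc of radius `p ^ (n - 1 / (p - 1))`
          ∀ ϑ : (identityComponent p).toGroup.toSpace ⟶ affineLine p, IsTheta ϑ →
            ∃ Θ : gluing i ⟶ affineLine p, π ≫ Θ = ϑ ∧
              (∀ Θ' : gluing i ⟶ affineLine p, π ≫ Θ' = ϑ → Θ' = Θ) ∧ IsIso Θ ∧
              ∀ (n : ℕ) (R : AffinoidAlgebra p) (a : R),
                (∃ x : (Sp (X n)).obj R, (gluingι i n ≫ Θ).app R x = a) ↔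
                  SupNormLE (p := p) a ((p : ℝ) ^ ((n : ℝ) - 1 / ((p : ℝ) - 1))) := by
  refine ⟨⟨theta hp, isTheta_theta hp, fun ϑ h => h.eq_theta hp⟩, fun n γ hγ R ψ => ?_,
    fun n => ⟨_, _, isQuotient_thetaDisc hp n⟩, fun X q hq => ?_⟩
  · exact (mem_disc_iff_of_isGenerator hγ).trans
      (supNormLE_iff_growthLE (discRadius_pos p n) (discRadius_pow p n)).symm
  choose j hqj hj himg using fun n => (hq n).exists_embedding hp
  choose i hi hiu using fun n => (hq n).existsUnique_desc
    (GroupSpace.mapSpace (SubgroupSpace.incl (disc_le_succ p n)) ≫ q (n + 1)) fun R h g => by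
      exact (hq (n + 1)).coincide R ⟨_, incl_mem_torsionBy h.2⟩
        ((SubgroupSpace.incl (disc_le_succ p n)).app R g)
  have hij : ∀ n, i n ≫ j (n + 1) = j n := fun n => (hq n).hom_ext (by
    have h1 : q n ≫ i n = _ := hi n
    rw [← Category.assoc, h1, Category.assoc, hqj, hqj]
    rfl)
  obtain ⟨Θ, hΘ⟩ := exists_gluing_desc j hij
  have hIso : IsIso Θ := isIso_of_gluing Θ (fun n R => by rw [hΘ]; exact hj n R) fun R a => by
    obtain ⟨n, hn⟩ := exists_le_quotRadius p ‖(a : R)‖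
    refine ⟨n, ?_⟩
    rw [hΘ]
    exact (himg n R a).2 ((supNormLE_iff_growthLE (quotRadius_pos p n) (quotRadius_pow p n)).2
      (.of_norm_le hn))
  have hΘinj : ∀ R, Function.Injective (Θ.app R) := fun R =>
    ((isIso_iff_bijective (Θ.app R)).1 inferInstance).1
  have hπ : ∀ n, GroupSpace.mapSpace (disc p n).ι ≫ theta hp ≫ inv Θ = q n ≫ gluingι i n :=
    fun n => by
      rw [← Category.assoc, IsIso.comp_inv_eq, Category.assoc, hΘ, hqj]
  have hπΘ : (theta hp ≫ inv Θ) ≫ Θ = theta hp := by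
    rw [Category.assoc, IsIso.inv_hom_id, Category.comp_id]
  have hQ := isQuotient_torsion hp hq hi hπ hΘinj hπΘ
  refine ⟨i, hi, fun n => hiu n, fun n R x y hxy => hj n R ?_, fun n =>
    isRationalOpenImmersion_of_embedding (hij n) (hj (n + 1)) (hj n) (himg n), theta hp ≫ inv Θ, hπ,
    fun π' hπ' => hom_ext_disc hp fun n => (hπ' n).trans (hπ n).symm, hQ, fun ϑ hϑ => ?_⟩
  · rw [← hij n]
    exact congrArg (fun z => (j (n + 1)).app R z) hxy
  · obtain rfl := hϑ.eq_theta hp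
    refine ⟨Θ, hπΘ, fun Θ' h => hQ.hom_ext (h.trans hπΘ.symm), hIso, fun n R a => ?_⟩
    rw [hΘ]
    exact himg n R a
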